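/- **Setting.** Let $n\ge 1$. An *$n$-polygraph modulo* $(R,E,S)$ consists of an $(n-1)$-polygraph $(R_0,\dots,R_{n-1})$ with free (strict, globular) $(n-1)$-category $R_{n-1}^*$, two cellular extensions $R=R_n$ and $E=E_n$ of $R_{n-1}^*$ (sets of generating $n$-cells attached to $(n-1)$-spheres), and a cellular extension $S$ of $R_{n-1}^*$ with $R\subseteq S\subseteq {}_ER_E$. Here $E^\top$ is the free $(n,n-1)$-category over $R_{n-1}^*$ generated by $E$ (its $n$-cells are invertible), and ${}_ER_E$ is the set of triples $(e,f,e')$ with $e,e'$ in $E^\top$, $f$ an $n$-cell of the free $n$-category $R^*$ containing exactly one generating $n$-cell, and $e,f,e'$ composable; its source is the source of $e$ and its target is the target of $e'$. A rule $\rho\in R$ is identified with the triple $(1,\rho,1)$. Let $S^*$ and $S^\top$ be the free $n$-category and the free $(n,n-1)$-category over $R_{n-1}^*$ generated by $S$, and let $R^*(E)$ be the free $n$-category over $R_{n-1}^*$ generated by $R\sqcup E\sqcup E^{-}$ in which the cells of $E$ and $E^-$ are mutually inverse. Cells of $S^*$ and of $E^\top$ are evaluated in $R^*(E)$, the rule $(e,f,e')$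 being sent to the composite $e\star_{n-1} f\star_{n-1} e'$. **Squares.** Let $V$ and $H$ be $n$-categories with the same underlying $(n-1)$-category. A *square* over $(V,H)$ is a quadruple $(f,g,e,e')$ with horizontal $n$-cells $f:u\to u'$ and $g:v\to v'$ of $H$ and vertical $n$-cells $e:u\to v$ and $e':u'\to v'$ of $V$. A *square extension* of $(V,H)$ is a family of squares over $(V,H)$; its elements are regarded as generating square cells. A square extension of $(E^\top,S^*)$ is also regarded as one of $(E^\top,S^\top)$, through the canonical functor $S^*\to S^\top$. * $\mathrm{Peiffer}(E^\top,S^*)$ consists of the squares $(f\star_i v,\ f\star_i v',\ u\star_i e,\ u'\star_i e)$ and $(v\star_i f,\ v'\star_i f,\ e\star_i u,\ e\star_i u')$, for $f:u\to u'$ in $S^*$, $e:v\to v'$ in $E^\top$ and $0\le i\le n-2$ such that the composites are defined. * For a square extension $\Gamma$ of $(E^\top,S^\top)$, the set $E\rtimes\Gamma$ consists of the squares $(e_1f,\ e_2^-g,\ e_1ee_2,\ e')$, where $(f,g,e,e')$ is a generating square of $\Gamma$ whose horizontal cells $f,g$ lie in $S^*$, and $e_1,e_2$ are $n$-cells of $E^\top$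 such that $e_1ee_2$ is defined and the composites $e_1f$ and $e_2^-g$, computed in $R^*(E)$, are given by $n$-cells of $S^*$. * $\mathrm{conf}(E)$ is the set of squares obtained by choosing, for each critical branching $(e,e')$ of $E$ (a pair of distinct $n$-cells of $E^*$ with a common source, each containing exactly one generating $n$-cell, not of the Peiffer form $(f\star_i v,\,u\star_i g)$ with $f,g$ of sources $u,v$, and minimal for whiskering by cells of $R_{n-1}^*$; the pairs $(e,e')$ and $(e',e)$ are identified), a confluence $(e_1,e_1')$ of it in $E^*$. The corresponding square has identities as horizontal cells, left vertical cell $e\star_{n-1}e_1$ and right vertical cell $e'\star_{n-1}e_1'$. **Rewriting.** For a cellular extension $X$ of $R_{n-1}^*$, a cell $u$ reduces to $v$ with respect to $X$ if there is a non-identity $n$-cell $u\to v$ in $X^*$; $\mathrm{Irr}(X)$ is the set of $(n-1)$-cells that do not reduce to anything; $\mathrm{NF}(X,u)$ is the set of $v\in\mathrm{Irr}(X)$ such that there is an $n$-cell $u\to v$ (possibly an identity) in $X^*$; $X$ terminates if there is no infinite reduction sequence; $X$ is convergent if it terminates and every pair of $n$-cells of $X^*$ with a common source is confluent. $S$ is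 *$\Gamma$-diconvergent* if 1. $S$ is $\Gamma$-confluent modulo $E$: for all $f,g$ in $S^*$ and $e$ in $E^\top$ from the source of $f$ to the source of $g$, with $f$ not an identity, there are $f',g'$ in $S^*$, $e'$ in $E^\top$, and a square cell with boundary $(f\star_{n-1}f',\ g\star_{n-1}g',\ e,\ e')$ in the free $(n-1)$-category enriched in double categories, with vertical $n$-cells $E^\top$ and horizontal $n$-cells $S^*$, whose square cells are generated by $E\rtimes\Gamma\cup\mathrm{Peiffer}(E^\top,S^*)$, those square cells being invertible for the composition in the vertical direction (the composition that composes the cells of $E^\top$); 2. ${}_ER_E$ terminates; 3. $E$ is convergent. $\mathrm{Irr}(E)$ is *$E$-normalizing with respect to $S$* if $\mathrm{NF}(S,u)\cap\mathrm{Irr}(E)\neq\emptyset$ for every $u\in\mathrm{Irr}(E)$. **Theorem.** Let $(R,E,S)$ be an $n$-polygraph modulo and let $\Gamma$ be a square extension of $(E^\top,S^\top)$ such that $S$ is $\Gamma$-diconvergent. If $\mathrm{Irr}(E)$ is $E$-normalizing with respect to $S$, then, for any choice of $\mathrm{conf}(E)$, the square extension $$E\rtimes\Gamma\ \cup\ \mathrm{Peiffer}(E^\top,S^*)\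 \cup\ \mathrm{conf}(E)$$ of $(E^\top,S^\top)$ is acyclic: every square over $(E^\top,S^\top)$ is the boundary of a square cell of the free $(n-1)$-category enriched in double groupoids generated by this square extension over $(E^\top,S^\top)$. -/

import Mathlib

universe u

namespace PolyMod

/-! ## Strict globular `n`-categories -/

/-- A small strict globular `n`-category, in the single-set presentation: `Cell` is the set of all
cells, a `k`-cell being identified with its identity cells of higher dimension.  `bd false i x` and
`bd true i x` are the `i`-source and the `i`-target of `x`, `comp i x y _` is the composite
`x ⋆_i y` of two `i`-composable cells.  The `k`-cells are the fixed points of `bd false k`; every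
cell is an `n`-cell by `bd_of_le`. -/
structure NCat (n : ℕ) : Type (u + 1) where
  Cell : Type u
  bd : Bool → ℕ → Cell → Cell
  bd_bd_of_lt : ∀ (α β : Bool) {i j : ℕ} (x : Cell), i < j → bd α i (bd β j x) = bd α i x
  bd_bd_of_le : ∀ (α β : Bool) {i j : ℕ} (x : Cell), i ≤ j → bd α j (bd β i x) = bd β i x
  bd_of_le : ∀ (α : Bool) {i : ℕ} (x : Cell), n ≤ i → bd α i x = x
  comp : ∀ (i : ℕ) (x y : Cell), bd true i x = bd false i y → Cell
  src_comp : ∀ (i : ℕ) (x y : Cell) (h), bd false i (comp i x y h) = bd false i x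
  tgt_comp : ∀ (i : ℕ) (x y : Cell) (h), bd true i (comp i x y h) = bd true i y
  bd_comp : ∀ (α : Bool) {i j : ℕ} (x y : Cell) (h h'), i < j →
    bd α j (comp i x y h) = comp i (bd α j x) (bd α j y) h'
  id_comp : ∀ (i : ℕ) (x : Cell) (h), comp i (bd false i x) x h = x
  comp_id : ∀ (i : ℕ) (x : Cell) (h), comp i x (bd true i x) h = x
  assoc : ∀ (i : ℕ) (x y z : Cell) (h₁ h₂ h₃ h₄),
    comp i (comp i x y h₁) z h₂ = comp i x (comp i y z h₃) h₄
  exchange : ∀ {i j : ℕ} (x y x' y' : Cell) (h₁ h₂ h₃ h₄ h₅ h₆), i < j →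
    comp i (comp j x y h₁) (comp j x' y' h₂) h₅ = comp j (comp i x x' h₃) (comp i y y' h₄) h₆

/-- A set, seen as a `0`-category. -/
def NCat.discrete (X : Type u) : NCat.{u} 0 where
  Cell := X
  bd _ _ x := x
  bd_bd_of_lt _ _ _ _ _ _ := rfl
  bd_bd_of_le _ _ _ _ _ _ := rfl
  bd_of_le _ _ _ _ := rfl
  comp _ x _ _ := x
  src_comp _ _ _ _ := rfl
  tgt_comp _ _ _ h := h
  bd_comp _ _ _ _ _ _ _ _ := rfl
  id_comp _ _ _ := rfl
  comp_id _ _ _ := rfl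
  assoc _ _ _ _ _ _ _ _ := rfl
  exchange _ _ _ _ _ _ _ _ _ _ _ := rfl

/-- A cellular extension of an `n`-category `C`: a set of generating `(n+1)`-cells with a source
`bd false γ` and a target `bd true γ` forming an `n`-sphere of `C`. -/
structure CellExt {n : ℕ} (C : NCat.{u} n) : Type (u + 1) where
  Gen : Type u
  bd : Bool → Gen → C.Cell
  sphere : ∀ (α : Bool) {i : ℕ} (γ : Gen), i < n →
    C.bd α i (bd false γ) = C.bd α i (bd true γ)

/-- An `(n+1)`-category whose underlying `n`-category is `C`: the cells of `C` are included by `ι`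
as the cells of dimension at most `n`, and `face false f`, `face true f` are the `n`-source and the
`n`-target of `f`, as cells of `C`. -/
structure ExtCat {n : ℕ} (C : NCat.{u} n) : Type (u + 1) where
  cat : NCat.{u} (n + 1)
  ι : C.Cell → cat.Cell
  face : Bool → cat.Cell → C.Cell
  ι_face : ∀ (α : Bool) (f : cat.Cell), ι (face α f) = cat.bd α n f
  face_ι : ∀ (α : Bool) (x : C.Cell), face α (ι x) = x
  ι_bd : ∀ (α : Bool) (i : ℕ) (x : C.Cell), ι (C.bd α i x) = cat.bd α i (ι x)
  ι_comp : ∀ (i : ℕ) (x y : C.Cell) (h h'), ι (C.comp i x y h) = cat.comp i (ι x) (ι y) h'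

namespace ExtCat

variable {n : ℕ} {C : NCat.{u} n} (D : ExtCat C)

theorem ι_injective {x y : C.Cell} (h : D.ι x = D.ι y) : x = y := by
  rw [← D.face_ι false x, ← D.face_ι false y, h]

theorem bd_eq (α β : Bool) {i : ℕ} (f : D.cat.Cell) (hi : i < n) :
    D.cat.bd α i f = D.ι (C.bd α i (D.face β f)) := by
  rw [D.ι_bd, D.ι_face, D.cat.bd_bd_of_lt _ _ _ hi]

/-- The `n`-source and the `n`-target of a cell form an `n`-sphere. -/
theorem face_parallel (α β β' : Bool) {i : ℕ} (f : D.cat.Cell) (hi : i < n) :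
    C.bd α i (D.face β f) = C.bd α i (D.face β' f) :=
  D.ι_injective (by rw [← D.bd_eq α β f hi, ← D.bd_eq α β' f hi])

theorem bd_iff {i : ℕ} (hi : i < n) (f g : D.cat.Cell) (β β' : Bool) :
    D.cat.bd true i f = D.cat.bd false i g ↔
      C.bd true i (D.face β f) = C.bd false i (D.face β' g) := by
  rw [D.bd_eq true β f hi, D.bd_eq false β' g hi]
  exact ⟨fun h => D.ι_injective h, fun h => by rw [h]⟩

theorem seq_aux {f g : D.cat.Cell} (h : D.face true f = D.face false g) :
    D.cat.bd true n f = D.cat.bd false n g := by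
  rw [← D.ι_face, ← D.ι_face, h]

/-- The composite `f ⋆_n g` of two `(n+1)`-cells with `t_n f = s_n g`. -/
def seq (f g : D.cat.Cell) (h : D.face true f = D.face false g) : D.cat.Cell :=
  D.cat.comp n f g (D.seq_aux h)

theorem face_false_seq (f g : D.cat.Cell) (h) : D.face false (D.seq f g h) = D.face false f :=
  D.ι_injective (by rw [D.ι_face, D.ι_face, seq, D.cat.src_comp])

theorem face_true_seq (f g : D.cat.Cell) (h) : D.face true (D.seq f g h) = D.face true g :=
  D.ι_injective (by rw [D.ι_face, D.ι_face, seq, D.cat.tgt_comp])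

theorem face_comp (α : Bool) {i : ℕ} (hi : i < n) (f g : D.cat.Cell) (h h') :
    D.face α (D.cat.comp i f g h) = C.comp i (D.face α f) (D.face α g) h' := by
  apply D.ι_injective
  have h2 : D.cat.bd true i (D.ι (D.face α f)) = D.cat.bd false i (D.ι (D.face α g)) := by
    rw [← D.ι_bd, ← D.ι_bd, h']
  have h3 : D.cat.bd true i (D.cat.bd α n f) = D.cat.bd false i (D.cat.bd α n g) := by
    rw [← D.ι_face, ← D.ι_face, h2]
  rw [D.ι_face, D.cat.bd_comp α f g h h3 hi, D.ι_comp i _ _ h' h2]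
  congr 1 <;> rw [D.ι_face]

theorem bd_eq_ι (α : Bool) (f : D.cat.Cell) : D.cat.bd α n f = D.ι (D.face α f) :=
  (D.ι_face α f).symm

theorem id_seq (x : C.Cell) (f : D.cat.Cell) (h) (hx : x = D.face false f) :
    D.seq (D.ι x) f h = f := by
  subst hx
  have := D.cat.id_comp n f (D.cat.bd_bd_of_le _ _ _ le_rfl)
  unfold seq
  convert this using 2
  exact D.ι_face _ _

theorem seq_id (x : C.Cell) (f : D.cat.Cell) (h) (hx : x = D.face true f) :
    D.seq f (D.ι x) h = f := by
  subst hx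
  have := D.cat.comp_id n f (D.cat.bd_bd_of_le _ _ _ le_rfl).symm
  unfold seq
  convert this using 2
  exact D.ι_face _ _

theorem seq_assoc (f g k : D.cat.Cell) (h₁ h₂ h₃ h₄) :
    D.seq (D.seq f g h₁) k h₂ = D.seq f (D.seq g k h₃) h₄ :=
  D.cat.assoc _ _ _ _ _ _ _ _

/-- `g` is the inverse of the `(n+1)`-cell `f` for `⋆_n`. -/
structure IsInv (f g : D.cat.Cell) : Prop where
  tgt : D.face true f = D.face false g
  src : D.face true g = D.face false f
  right : D.seq f g tgt = D.ι (D.face false f)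
  left : D.seq g f src = D.ι (D.face true f)

theorem IsInv.unique {f g g' : D.cat.Cell} (h : D.IsInv f g) (h' : D.IsInv f g') : g = g' := by
  have e := D.seq_assoc g f g' h.src (by rw [D.face_true_seq, h'.tgt]) h'.tgt
    (by rw [D.face_false_seq, h.src])
  simp only [h.left, h'.right] at e
  rw [D.id_seq _ _ _ h'.tgt, D.seq_id _ _ _ h.src.symm] at e
  exact e.symm

end ExtCat

/-! ## Free `(n+1)`-categories -/

section Free

variable {n : ℕ} {C : NCat.{u} n}

/-- Formal composites of the generating cells of a cellular extension `Γ` of `C` and of identities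
of cells of `C`, with their `n`-source and `n`-target. -/
inductive Term (Γ : CellExt C) : C.Cell → C.Cell → Type u
  | id (x : C.Cell) : Term Γ x x
  | gen (γ : Γ.Gen) : Term Γ (Γ.bd false γ) (Γ.bd true γ)
  | seq {x y y' z : C.Cell} (a : Term Γ x y) (b : Term Γ y' z) (h : y = y') : Term Γ x z
  | star (i : ℕ) (hi : i < n) {x y x' y' : C.Cell} (a : Term Γ x y) (b : Term Γ x' y')
      (h : C.bd true i x = C.bd false i x') (h' : C.bd true i y = C.bd false i y') :
      Term Γ (C.comp i x x' h) (C.comp i y y' h')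

/-- A formal composite together with its source and target. -/
structure Pre (Γ : CellExt C) where
  face : Bool → C.Cell
  term : Term Γ (face false) (face true)

/-- The formal composite `a`, bundled with its source and target. -/
def Term.pack {Γ : CellExt C} {x y : C.Cell} (a : Term Γ x y) : Pre Γ :=
  ⟨fun α => cond α y x, a⟩

/-- A family of relations between parallel formal composites. -/
abbrev TermRel (Γ : CellExt C) := ∀ x y : C.Cell, Term Γ x y → Term Γ x y → Prop

/-- The congruence on formal composites generated by the axioms of `(n+1)`-categories and by the
relations `r`. -/
inductive Rel {Γ : CellExt C} (r : TermRel Γ) : Pre Γ → Pre Γ → Prop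
  | of {x y} (a b : Term Γ x y) : r x y a b → Rel r a.pack b.pack
  | refl (p) : Rel r p p
  | symm {p q} : Rel r p q → Rel r q p
  | trans {p q s} : Rel r p q → Rel r q s → Rel r p s
  | seq_congr {x y y' z x₁ y₁ y₁' z₁} {a : Term Γ x y} {b : Term Γ y' z}
      {a₁ : Term Γ x₁ y₁} {b₁ : Term Γ y₁' z₁} (h h₁) :
      Rel r a.pack a₁.pack → Rel r b.pack b₁.pack → Rel r (a.seq b h).pack (a₁.seq b₁ h₁).pack
  | star_congr {i hi x y x' y' x₁ y₁ x₁' y₁'} {a : Term Γ x y} {b : Term Γ x' y'}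
      {a₁ : Term Γ x₁ y₁} {b₁ : Term Γ x₁' y₁'} (h h' h₁ h₁') :
      Rel r a.pack a₁.pack → Rel r b.pack b₁.pack →
        Rel r (Term.star i hi a b h h').pack (Term.star i hi a₁ b₁ h₁ h₁').pack
  | id_seq {w x y} (a : Term Γ x y) (h : w = x) : Rel r ((Term.id w).seq a h).pack a.pack
  | seq_id {x y w} (a : Term Γ x y) (h : y = w) : Rel r (a.seq (Term.id w) h).pack a.pack
  | seq_assoc {x y y' z z' w} (a : Term Γ x y) (b : Term Γ y' z) (c : Term Γ z' w) (h h') :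
      Rel r ((a.seq b h).seq c h').pack (a.seq (b.seq c h') h).pack
  | id_star {i hi w x y} (a : Term Γ x y) (hw : C.bd false i x = w) (h h') :
      Rel r (Term.star i hi (Term.id w) a h h').pack a.pack
  | star_id {i hi w x y} (a : Term Γ x y) (hw : C.bd true i x = w) (h h') :
      Rel r (Term.star i hi a (Term.id w) h h').pack a.pack
  | star_assoc {i hi x y x' y' x'' y''} (a : Term Γ x y) (b : Term Γ x' y') (c : Term Γ x'' y'')
      (h₁ h₁' h₂ h₂' h₃ h₃' h₄ h₄') :
      Rel r (Term.star i hi (Term.star i hi a b h₁ h₁') c h₂ h₂').pack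
        (Term.star i hi a (Term.star i hi b c h₃ h₃') h₄ h₄').pack
  | id_star_id {i hi x y} (h h') :
      Rel r (Term.star i hi (Term.id x) (Term.id y) h h').pack (Term.id (C.comp i x y h)).pack
  | seq_star_seq {i hi x y y₁ z x' y' y₁' z'} (a : Term Γ x y) (b : Term Γ y₁ z)
      (a' : Term Γ x' y') (b' : Term Γ y₁' z') (h h' h₁ h₁' h₂ h₂' h₃ h₃' h₄) :
      Rel r (Term.star i hi (a.seq b h) (a'.seq b' h') h₁ h₁').pack
        ((Term.star i hi a a' h₂ h₂').seq (Term.star i hi b b' h₃ h₃') h₄).pack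
  | star_star_star {i hi j hj x y z w x' y' z' w'} (a : Term Γ x x') (b : Term Γ y y')
      (c : Term Γ z z') (d : Term Γ w w') (h₁ h₁' h₂ h₂' h₃ h₃' h₄ h₄' h₅ h₅' h₆ h₆') : i < j →
      Rel r (Term.star i hi (Term.star j hj a b h₁ h₁') (Term.star j hj c d h₂ h₂') h₅ h₅').pack
        (Term.star j hj (Term.star i hi a c h₃ h₃') (Term.star i hi b d h₄ h₄') h₆ h₆').pack

theorem Term.pack_face_false {Γ : CellExt C} {x y : C.Cell} (a : Term Γ x y) :
    a.pack.face false = x := rfl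

theorem Term.pack_face_true {Γ : CellExt C} {x y : C.Cell} (a : Term Γ x y) :
    a.pack.face true = y := rfl

theorem Pre.pack_term {Γ : CellExt C} (p : Pre Γ) : p.term.pack = p := by
  obtain ⟨f, t⟩ := p
  have : (fun α => cond α (f true) (f false)) = f := by
    funext α; cases α <;> rfl
  unfold Term.pack
  congr 1

theorem NCat.comp_congr (C : NCat.{u} n) {i : ℕ} {x y x' y' : C.Cell} (hx : x = x') (hy : y = y')
    (h h') : C.comp i x y h = C.comp i x' y' h' := by
  subst hx; subst hy; rfl

theorem Term.parallel {Γ : CellExt C} {x y : C.Cell} (a : Term Γ x y) (α : Bool) {i : ℕ}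
    (hi : i < n) : C.bd α i x = C.bd α i y := by
  induction a generalizing α i with
  | id x => rfl
  | gen γ => exact Γ.sphere α γ hi
  | seq a b h iha ihb => rw [iha α hi, h, ihb α hi]
  | star j hj a b h h' iha ihb =>
    rename_i x y x' y'
    rcases lt_trichotomy i j with hij | hij | hij
    · rw [← C.bd_bd_of_lt α false (C.comp j x x' h) hij,
        ← C.bd_bd_of_lt α false (C.comp j y y' h') hij, C.src_comp, C.src_comp,
        C.bd_bd_of_lt _ _ _ hij, C.bd_bd_of_lt _ _ _ hij, iha α hi]
    · subst hij
      cases α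
      · rw [C.src_comp, C.src_comp, iha _ hi]
      · rw [C.tgt_comp, C.tgt_comp, ihb _ hi]
    · have key : ∀ {u v : C.Cell}, C.bd true j u = C.bd false j v →
          C.bd true j (C.bd α i u) = C.bd false j (C.bd α i v) := by
        intro u v e
        rw [C.bd_bd_of_lt _ _ _ hij, C.bd_bd_of_lt _ _ _ hij, e]
      rw [C.bd_comp α _ _ h (key h) hij, C.bd_comp α _ _ h' (key h') hij]
      exact C.comp_congr (iha α hi) (ihb α hi) _ _

theorem Rel.face_eq {Γ : CellExt C} {r : TermRel Γ} {p q : Pre Γ} (h : Rel r p q) (α : Bool) :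
    p.face α = q.face α := by
  induction h with
  | of a b _ => rfl
  | refl p => rfl
  | symm _ ih => exact ih.symm
  | trans _ _ ih₁ ih₂ => exact ih₁.trans ih₂
  | seq_congr h h₁ _ _ iha ihb =>
    cases α
    · exact iha
    · exact ihb
  | star_congr h h' h₁ h₁' _ _ iha ihb =>
    cases α
    · exact C.comp_congr iha ihb _ _
    · exact C.comp_congr iha ihb _ _
  | id_seq a h => cases α <;> [exact h; rfl]
  | seq_id a h => cases α <;> [rfl; exact h.symm]
  | seq_assoc a b c h h' => cases α <;> rfl
  | @id_star i hi w x y a hw h h' =>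
    subst hw
    cases α
    · exact C.id_comp i x h
    · have e := a.parallel false hi
      exact (C.comp_congr e rfl _ (e ▸ h')).trans (C.id_comp i y _)
  | @star_id i hi w x y a hw h h' =>
    subst hw
    cases α
    · exact C.comp_id i x h
    · have e := a.parallel true hi
      exact (C.comp_congr rfl e _ (e ▸ h')).trans (C.comp_id i y _)
  | star_assoc a b c h₁ h₁' h₂ h₂' h₃ h₃' h₄ h₄' =>
    cases α
    · exact C.assoc _ _ _ _ _ _ _ _
    · exact C.assoc _ _ _ _ _ _ _ _
  | id_star_id h h' => cases α <;> rfl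
  | seq_star_seq a b a' b' h h' h₁ h₁' h₂ h₂' h₃ h₃' h₄ => cases α <;> rfl
  | star_star_star a b c d h₁ h₁' h₂ h₂' h₃ h₃' h₄ h₄' h₅ h₅' h₆ h₆' hij =>
    cases α
    · exact C.exchange _ _ _ _ _ _ _ _ _ _ hij
    · exact C.exchange _ _ _ _ _ _ _ _ _ _ hij

/-- The equivalence relation `Rel r`. -/
def relSetoid {Γ : CellExt C} (r : TermRel Γ) : Setoid (Pre Γ) :=
  ⟨Rel r, Rel.refl, Rel.symm, Rel.trans⟩

/-- Cells of the free `(n+1)`-category on `Γ` modulo the relations `r`. -/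
def FreeCell {Γ : CellExt C} (r : TermRel Γ) : Type u := Quotient (relSetoid r)

namespace FreeCell

variable {Γ : CellExt C} {r : TermRel Γ}

/-- The cell represented by a formal composite. -/
def mk (r : TermRel Γ) {x y : C.Cell} (a : Term Γ x y) : FreeCell r :=
  Quotient.mk (relSetoid r) a.pack

theorem sound {x y x' y' : C.Cell} {a : Term Γ x y} {b : Term Γ x' y'}
    (h : Rel r a.pack b.pack) : mk r a = mk r b := Quotient.sound (s := relSetoid r) h

theorem exact {x y x' y' : C.Cell} {a : Term Γ x y} {b : Term Γ x' y'}
    (h : mk r a = mk r b) : Rel r a.pack b.pack := Quotient.exact (s := relSetoid r) h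

theorem ind {motive : FreeCell r → Prop} (h : ∀ (x y : C.Cell) (a : Term Γ x y), motive (mk r a))
    (q : FreeCell r) : motive q := by
  induction q using Quotient.inductionOn with
  | h p => have := h _ _ p.term; unfold mk at this; rwa [p.pack_term] at this

/-- `n`-source and `n`-target. -/
def face (α : Bool) (q : FreeCell r) : C.Cell :=
  Quotient.lift (s := relSetoid r) (fun p => p.face α) (fun _ _ h => Rel.face_eq h α) q

theorem face_false_mk {x y : C.Cell} (a : Term Γ x y) : face false (mk r a) = x := rfl

theorem face_true_mk {x y : C.Cell} (a : Term Γ x y) : face true (mk r a) = y := rfl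

theorem parallel (q : FreeCell r) (α β β' : Bool) {i : ℕ} (hi : i < n) :
    C.bd α i (face β q) = C.bd α i (face β' q) := by
  induction q using ind with
  | h x y a =>
    cases β <;> cases β' <;>
      simp only [face_false_mk, face_true_mk, a.parallel α hi]

/-- Identity cells. -/
def ι (x : C.Cell) : FreeCell r := mk r (Term.id x)

/-- Boundaries in all dimensions. -/
def bd (α : Bool) (i : ℕ) (q : FreeCell r) : FreeCell r :=
  if i ≤ n then ι (C.bd α i (face α q)) else q

theorem ι_injective {x y : C.Cell} (h : (ι x : FreeCell r) = ι y) : x = y :=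
  congrArg (face false) h

theorem exists_rep (q : FreeCell r) : ∃ a : Term Γ (face false q) (face true q), mk r a = q := by
  induction q using ind with
  | h x y a => exact ⟨a, rfl⟩

/-- A formal composite that represents `q`. -/
noncomputable def out (q : FreeCell r) : Term Γ (face false q) (face true q) :=
  Classical.choose q.exists_rep

theorem mk_out (q : FreeCell r) : mk r q.out = q := Classical.choose_spec q.exists_rep

theorem bd_of_le {i : ℕ} (hi : i ≤ n) (α : Bool) (q : FreeCell r) :
    bd α i q = ι (C.bd α i (face α q)) := if_pos hi

theorem bd_of_lt {i : ℕ} (hi : i < n) (α β : Bool) (q : FreeCell r) :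
    bd α i q = ι (C.bd α i (face β q)) := by
  rw [bd_of_le hi.le, q.parallel α α β hi]

theorem bd_self (α : Bool) (q : FreeCell r) : bd α n q = ι (face α q) := by
  rw [bd_of_le le_rfl, C.bd_of_le _ _ le_rfl]

theorem bd_of_gt {i : ℕ} (hi : n < i) (α : Bool) (q : FreeCell r) : bd α i q = q :=
  if_neg (not_le.2 hi)

theorem face_of_bd {i : ℕ} (hi : i < n) {q q' : FreeCell r} (h : bd true i q = bd false i q')
    (β β' : Bool) : C.bd true i (face β q) = C.bd false i (face β' q') := by
  rw [bd_of_lt hi true β, bd_of_lt hi false β'] at h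
  exact ι_injective h

theorem face_of_bd_self {q q' : FreeCell r} (h : bd true n q = bd false n q') :
    face true q = face false q' := by
  rw [bd_self, bd_self] at h
  exact ι_injective h

/-- Composition `q ⋆_i q'`, computed on representatives; see `comp_mk_of_lt`, `comp_mk_self`. -/
noncomputable def comp (i : ℕ) (q q' : FreeCell r) (h : bd true i q = bd false i q') :
    FreeCell r :=
  if hi : i < n then
    mk r (Term.star i hi q.out q'.out (face_of_bd hi h false false) (face_of_bd hi h true true))
  else if hn : i = n then
    mk r (q.out.seq q'.out (by subst hn; exact face_of_bd_self h))
  else q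

theorem comp_mk_of_lt {i : ℕ} (hi : i < n) {x y x' y' : C.Cell} (a : Term Γ x y)
    (b : Term Γ x' y') (h h₁ h₂) :
    comp i (mk r a) (mk r b) h = mk r (Term.star i hi a b h₁ h₂) := by
  rw [comp, dif_pos hi]
  exact sound (Rel.star_congr _ _ _ _ (exact (mk_out (mk r a))) (exact (mk_out (mk r b))))

theorem comp_mk_self {x y x' y' : C.Cell} (a : Term Γ x y)
    (b : Term Γ x' y') (h h₁) :
    comp n (mk r a) (mk r b) h = mk r (a.seq b h₁) := by
  rw [comp, dif_neg (lt_irrefl _), dif_pos rfl]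
  exact sound (Rel.seq_congr _ _ (exact (mk_out (mk r a))) (exact (mk_out (mk r b))))

theorem comp_of_gt {i : ℕ} (hi : n < i) (q q' : FreeCell r) (h) : comp i q q' h = q := by
  rw [comp, dif_neg (by omega), dif_neg (by omega)]

theorem face_ι (α : Bool) (x : C.Cell) : face α (ι x : FreeCell r) = x := by
  cases α <;> rfl

theorem ι_bd (α : Bool) (i : ℕ) (x : C.Cell) : (ι (C.bd α i x) : FreeCell r) = bd α i (ι x) := by
  by_cases hi : i ≤ n
  · rw [bd_of_le hi, face_ι]
  · rw [bd_of_gt (by omega), C.bd_of_le _ _ (by omega)]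

theorem comp_congr {i : ℕ} {q q' p p' : FreeCell r} (hq : q = p) (hq' : q' = p') (h h') :
    comp i q q' h = comp i p p' h' := by
  subst hq; subst hq'; rfl

theorem ι_comp (i : ℕ) (x y : C.Cell) (h h') :
    (ι (C.comp i x y h) : FreeCell r) = comp i (ι x) (ι y) h' := by
  rcases lt_trichotomy i n with hi | rfl | hi
  · exact ((comp_mk_of_lt hi _ _ _ h h).trans (sound (Rel.id_star_id _ _))).symm
  · have hxy : x = y := by rwa [C.bd_of_le _ _ le_rfl, C.bd_of_le _ _ le_rfl] at h
    subst hxy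
    refine (congrArg ι ?_).trans ((comp_mk_self _ _ _ rfl).trans (sound (Rel.id_seq _ rfl))).symm
    exact (C.comp_congr (C.bd_of_le _ _ le_rfl).symm rfl _ (by
      rw [C.bd_of_le _ _ le_rfl, C.bd_of_le _ _ le_rfl])).trans (C.id_comp i x (by
      rw [C.bd_of_le _ _ le_rfl, C.bd_of_le _ _ le_rfl]))
  · have hxy : x = y := by rwa [C.bd_of_le _ _ hi.le, C.bd_of_le _ _ hi.le] at h
    subst hxy
    rw [comp_of_gt hi]
    refine congrArg ι ?_
    exact (C.comp_congr (C.bd_of_le _ _ hi.le).symm rfl _ (by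
      rw [C.bd_of_le _ _ hi.le, C.bd_of_le _ _ hi.le])).trans (C.id_comp i x (by
      rw [C.bd_of_le _ _ hi.le, C.bd_of_le _ _ hi.le]))

theorem face_comp {i : ℕ} (hi : i < n) (α : Bool) (q q' : FreeCell r) (h h') :
    face α (comp i q q' h) = C.comp i (face α q) (face α q') h' := by
  induction q using ind with
  | h x y a =>
  induction q' using ind with
  | h x' y' b =>
  rw [comp_mk_of_lt hi a b h (face_of_bd hi h false false) (face_of_bd hi h true true)]
  cases α <;> rfl

theorem face_false_comp_self (q q' : FreeCell r) (h) :
    face false (comp n q q' h) = face false q := by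
  induction q using ind with
  | h x y a =>
  induction q' using ind with
  | h x' y' b =>
  rw [comp_mk_self a b h (face_of_bd_self h)]; rfl

theorem face_true_comp_self (q q' : FreeCell r) (h) :
    face true (comp n q q' h) = face true q' := by
  induction q using ind with
  | h x y a =>
  induction q' using ind with
  | h x' y' b =>
  rw [comp_mk_self a b h (face_of_bd_self h)]; rfl

theorem src_comp (i : ℕ) (q q' : FreeCell r) (h) : bd false i (comp i q q' h) = bd false i q := by
  rcases lt_trichotomy i n with hi | rfl | hi
  · rw [bd_of_le hi.le, bd_of_le hi.le, face_comp hi _ _ _ _ (face_of_bd hi h false false),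
      C.src_comp]
  · rw [bd_self, bd_self, face_false_comp_self]
  · rw [comp_of_gt hi]

theorem tgt_comp (i : ℕ) (q q' : FreeCell r) (h) : bd true i (comp i q q' h) = bd true i q' := by
  rcases lt_trichotomy i n with hi | rfl | hi
  · rw [bd_of_le hi.le, bd_of_le hi.le, face_comp hi _ _ _ _ (face_of_bd hi h true true),
      C.tgt_comp]
  · rw [bd_self, bd_self, face_true_comp_self]
  · rw [comp_of_gt hi, h, bd_of_gt hi, bd_of_gt hi]

end FreeCell

/-- The free `(n+1)`-category on `Γ` modulo the relations `r`. -/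
noncomputable def freeMod {Γ : CellExt C} (r : TermRel Γ) : ExtCat C where
  cat :=
    { Cell := FreeCell r
      bd := FreeCell.bd
      comp := FreeCell.comp
      src_comp := FreeCell.src_comp
      tgt_comp := FreeCell.tgt_comp
      bd_bd_of_lt := by
        intro α β i j q hij
        rcases Nat.lt_or_ge n j with hj | hj
        · rw [FreeCell.bd_of_gt hj]
        · rw [FreeCell.bd_of_le hj, ← FreeCell.ι_bd, C.bd_bd_of_lt _ _ _ hij,
            FreeCell.bd_of_lt (by omega) α β]
      bd_bd_of_le := by
        intro α β i j q hij
        rcases Nat.lt_or_ge n j with hj | hj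
        · rw [FreeCell.bd_of_gt hj]
        · rw [FreeCell.bd_of_le (hij.trans hj) β, ← FreeCell.ι_bd, C.bd_bd_of_le _ _ _ hij]
      bd_of_le := fun α i q hi => FreeCell.bd_of_gt (by omega) α q
      bd_comp := by
        intro α i j q q' h h' hij
        rcases lt_trichotomy j n with hj | rfl | hj
        · have hi := hij.trans hj
          have h₁ := FreeCell.face_of_bd hi h
          have h₂ : C.bd true i (C.bd α j (FreeCell.face α q)) =
              C.bd false i (C.bd α j (FreeCell.face α q')) := by
            rw [C.bd_bd_of_lt _ _ _ hij, C.bd_bd_of_lt _ _ _ hij, h₁ α α]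
          rw [FreeCell.bd_of_le hj.le, FreeCell.face_comp hi _ _ _ _ (h₁ α α),
            C.bd_comp α _ _ (h₁ α α) h₂ hij, FreeCell.ι_comp i _ _ h₂ (by
              rw [← FreeCell.ι_bd, ← FreeCell.ι_bd, h₂])]
          exact FreeCell.comp_congr (FreeCell.bd_of_le hj.le _ _).symm
            (FreeCell.bd_of_le hj.le _ _).symm _ _
        · have h₁ := FreeCell.face_of_bd hij h
          rw [FreeCell.bd_self, FreeCell.face_comp hij _ _ _ _ (h₁ α α),
            FreeCell.ι_comp i _ _ (h₁ α α) (by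
              rw [← FreeCell.ι_bd, ← FreeCell.ι_bd, h₁ α α])]
          exact FreeCell.comp_congr (FreeCell.bd_self _ _).symm (FreeCell.bd_self _ _).symm _ _
        · rw [FreeCell.bd_of_gt hj]
          exact FreeCell.comp_congr (FreeCell.bd_of_gt hj _ _).symm
            (FreeCell.bd_of_gt hj _ _).symm _ _
      id_comp := by
        intro i q h
        rcases lt_trichotomy i n with hi | rfl | hi
        · induction q using FreeCell.ind with
          | h x y a =>
          have e : C.bd true i (C.bd false i x) = C.bd false i x := C.bd_bd_of_le _ _ _ le_rfl
          refine (FreeCell.comp_congr (FreeCell.bd_of_le hi.le _ _) rfl _ (by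
            rw [← FreeCell.bd_of_le hi.le, h])).trans ?_
          exact (FreeCell.comp_mk_of_lt hi _ _ _ e
            (e.trans (a.parallel false hi))).trans (FreeCell.sound (Rel.id_star _ rfl _ _))
        · induction q using FreeCell.ind with
          | h x y a =>
          refine (FreeCell.comp_congr (FreeCell.bd_self _ _) rfl _ (by
            rw [← FreeCell.bd_self, h])).trans ?_
          exact (FreeCell.comp_mk_self _ _ _ rfl).trans (FreeCell.sound (Rel.id_seq _ rfl))
        · rw [FreeCell.comp_of_gt hi, FreeCell.bd_of_gt hi]
      comp_id := by
        intro i q h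
        rcases lt_trichotomy i n with hi | rfl | hi
        · induction q using FreeCell.ind with
          | h x y a =>
          have e : C.bd false i (C.bd true i y) = C.bd true i y := C.bd_bd_of_le _ _ _ le_rfl
          refine (FreeCell.comp_congr rfl (FreeCell.bd_of_le hi.le _ _) _ (by
            rw [← FreeCell.bd_of_le hi.le]; exact h)).trans ?_
          exact (FreeCell.comp_mk_of_lt hi _ _ _ ((a.parallel true hi).trans e.symm)
            e.symm).trans (FreeCell.sound (Rel.star_id _ (a.parallel true hi) _ _))
        · induction q using FreeCell.ind with
          | h x y a =>
          refine (FreeCell.comp_congr rfl (FreeCell.bd_self _ _) _ (by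
            rw [← FreeCell.bd_self]; exact h)).trans ?_
          exact (FreeCell.comp_mk_self _ _ _ rfl).trans (FreeCell.sound (Rel.seq_id _ rfl))
        · rw [FreeCell.comp_of_gt hi]
      assoc := by
        intro i p q s h₁ h₂ h₃ h₄
        rcases lt_trichotomy i n with hi | rfl | hi
        · induction p using FreeCell.ind with
          | h x y a =>
          induction q using FreeCell.ind with
          | h x' y' b =>
          induction s using FreeCell.ind with
          | h x'' y'' c =>
          have f₁ := FreeCell.face_of_bd hi h₁
          have f₃ := FreeCell.face_of_bd hi h₃
          have f₂ : ∀ e : Term Γ (C.comp i x x' (f₁ false false)) (C.comp i y y' (f₁ true true)),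
              FreeCell.comp i (FreeCell.mk r a) (FreeCell.mk r b) h₁ = FreeCell.mk r e →
              C.bd true i (C.comp i x x' (f₁ false false)) = C.bd false i x'' ∧
              C.bd true i (C.comp i y y' (f₁ true true)) = C.bd false i y'' := by
            intro e he
            rw [he] at h₂
            exact ⟨FreeCell.face_of_bd hi h₂ false false, FreeCell.face_of_bd hi h₂ true true⟩
          have f₄ : ∀ e : Term Γ (C.comp i x' x'' (f₃ false false)) (C.comp i y' y'' (f₃ true true)),
              FreeCell.comp i (FreeCell.mk r b) (FreeCell.mk r c) h₃ = FreeCell.mk r e →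
              C.bd true i x = C.bd false i (C.comp i x' x'' (f₃ false false)) ∧
              C.bd true i y = C.bd false i (C.comp i y' y'' (f₃ true true)) := by
            intro e he
            rw [he] at h₄
            exact ⟨FreeCell.face_of_bd hi h₄ false false, FreeCell.face_of_bd hi h₄ true true⟩
          have e₁ := FreeCell.comp_mk_of_lt (r := r) hi a b h₁ (f₁ false false) (f₁ true true)
          have e₃ := FreeCell.comp_mk_of_lt (r := r) hi b c h₃ (f₃ false false) (f₃ true true)
          refine (FreeCell.comp_congr e₁ rfl _ (e₁ ▸ h₂)).trans ?_
          refine Eq.trans ?_ (FreeCell.comp_congr rfl e₃ h₄ (e₃ ▸ h₄)).symm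
          refine (FreeCell.comp_mk_of_lt hi _ _ _ (f₂ _ e₁).1 (f₂ _ e₁).2).trans ?_
          refine Eq.trans ?_ (FreeCell.comp_mk_of_lt hi _ _ _ (f₄ _ e₃).1 (f₄ _ e₃).2).symm
          exact FreeCell.sound (Rel.star_assoc _ _ _ _ _ _ _ _ _ _ _)
        · induction p using FreeCell.ind with
          | h x y a =>
          induction q using FreeCell.ind with
          | h x' y' b =>
          induction s using FreeCell.ind with
          | h x'' y'' c =>
          have f₁ := FreeCell.face_of_bd_self h₁
          have f₃ := FreeCell.face_of_bd_self h₃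
          have e₁ := FreeCell.comp_mk_self (r := r) a b h₁ f₁
          have e₃ := FreeCell.comp_mk_self (r := r) b c h₃ f₃
          refine (FreeCell.comp_congr e₁ rfl _ (e₁ ▸ h₂)).trans ?_
          refine Eq.trans ?_ (FreeCell.comp_congr rfl e₃ h₄ (e₃ ▸ h₄)).symm
          refine (FreeCell.comp_mk_self _ _ _ f₃).trans ?_
          refine Eq.trans ?_ (FreeCell.comp_mk_self _ _ _ f₁).symm
          exact FreeCell.sound (Rel.seq_assoc _ _ _ _ _)
        · rw [FreeCell.comp_of_gt hi, FreeCell.comp_of_gt hi, FreeCell.comp_of_gt hi]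
      exchange := by
        intro i j p q p' q' h₁ h₂ h₃ h₄ h₅ h₆ hij
        rcases lt_trichotomy j n with hj | rfl | hj
        · have hi := hij.trans hj
          induction p using FreeCell.ind with
          | h x y a =>
          induction q using FreeCell.ind with
          | h z w b =>
          induction p' using FreeCell.ind with
          | h x' y' a' =>
          induction q' using FreeCell.ind with
          | h z' w' b' =>
          have f₁ := FreeCell.face_of_bd hj h₁
          have f₂ := FreeCell.face_of_bd hj h₂
          have f₃ := FreeCell.face_of_bd hi h₃
          have f₄ := FreeCell.face_of_bd hi h₄
          have e₁ := FreeCell.comp_mk_of_lt (r := r) hj a b h₁ (f₁ false false) (f₁ true true)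
          have e₂ := FreeCell.comp_mk_of_lt (r := r) hj a' b' h₂ (f₂ false false) (f₂ true true)
          have e₃ := FreeCell.comp_mk_of_lt (r := r) hi a a' h₃ (f₃ false false) (f₃ true true)
          have e₄ := FreeCell.comp_mk_of_lt (r := r) hi b b' h₄ (f₄ false false) (f₄ true true)
          have h₅' := h₅
          have h₆' := h₆
          rw [e₁, e₂] at h₅'
          rw [e₃, e₄] at h₆'
          have f₅ := FreeCell.face_of_bd hi h₅'
          have f₆ := FreeCell.face_of_bd hj h₆'
          refine (FreeCell.comp_congr e₁ e₂ h₅ h₅').trans ?_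
          refine Eq.trans ?_ (FreeCell.comp_congr e₃ e₄ h₆ h₆').symm
          refine (FreeCell.comp_mk_of_lt hi _ _ _ (f₅ false false) (f₅ true true)).trans ?_
          refine Eq.trans ?_
            (FreeCell.comp_mk_of_lt hj _ _ _ (f₆ false false) (f₆ true true)).symm
          exact FreeCell.sound (Rel.star_star_star _ _ _ _ _ _ _ _ _ _ _ _ _ _ _ _ hij)
        · have hi := hij
          induction p using FreeCell.ind with
          | h x y a =>
          induction q using FreeCell.ind with
          | h z w b =>
          induction p' using FreeCell.ind with
          | h x' y' a' =>
          induction q' using FreeCell.ind with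
          | h z' w' b' =>
          have f₁ := FreeCell.face_of_bd_self h₁
          have f₂ := FreeCell.face_of_bd_self h₂
          have f₃ := FreeCell.face_of_bd hi h₃
          have f₄ := FreeCell.face_of_bd hi h₄
          have e₁ := FreeCell.comp_mk_self (r := r) a b h₁ f₁
          have e₂ := FreeCell.comp_mk_self (r := r) a' b' h₂ f₂
          have e₃ := FreeCell.comp_mk_of_lt (r := r) hi a a' h₃ (f₃ false false) (f₃ true true)
          have e₄ := FreeCell.comp_mk_of_lt (r := r) hi b b' h₄ (f₄ false false) (f₄ true true)
          have h₅' := h₅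
          have h₆' := h₆
          rw [e₁, e₂] at h₅'
          rw [e₃, e₄] at h₆'
          have f₅ := FreeCell.face_of_bd hi h₅'
          have f₆ := FreeCell.face_of_bd_self h₆'
          refine (FreeCell.comp_congr e₁ e₂ h₅ h₅').trans ?_
          refine Eq.trans ?_ (FreeCell.comp_congr e₃ e₄ h₆ h₆').symm
          refine (FreeCell.comp_mk_of_lt hi _ _ _ (f₅ false false) (f₅ true true)).trans ?_
          refine Eq.trans ?_ (FreeCell.comp_mk_self _ _ _ f₆).symm
          exact FreeCell.sound (Rel.seq_star_seq _ _ _ _ _ _ _ _ _ _ _ _ _)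
        · exact (FreeCell.comp_congr (FreeCell.comp_of_gt hj _ _ _)
            (FreeCell.comp_of_gt hj _ _ _) _ h₃).trans (FreeCell.comp_of_gt hj _ _ _).symm }
  ι := FreeCell.ι
  face := FreeCell.face
  ι_face α q := (FreeCell.bd_self α q).symm
  face_ι := FreeCell.face_ι
  ι_bd := FreeCell.ι_bd
  ι_comp := FreeCell.ι_comp

/-- The relation with no instance. -/
def TermRel.none (Γ : CellExt C) : TermRel Γ := fun _ _ _ _ => False

/-- The free `(n+1)`-category `C[Γ]` generated by `Γ` over `C`. -/
noncomputable def free (Γ : CellExt C) : ExtCat C := freeMod (TermRel.none Γ)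

/-- The cellular extension `Γ ⊔ E ⊔ E⁻`, where `E⁻` consists of the cells of `E` reversed. -/
def CellExt.withInv (Γ E : CellExt C) : CellExt C where
  Gen := Γ.Gen ⊕ (E.Gen ⊕ E.Gen)
  bd α := Sum.elim (Γ.bd α) (Sum.elim (E.bd α) (E.bd (!α)))
  sphere α i γ hi := by
    rcases γ with γ | γ | γ
    · exact Γ.sphere α γ hi
    · exact E.sphere α γ hi
    · exact (E.sphere α γ hi).symm

/-- A generating cell of `E`, as a formal composite. -/
def Term.pos (Γ : CellExt C) {E : CellExt C} (γ : E.Gen) :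
    Term (Γ.withInv E) (E.bd false γ) (E.bd true γ) :=
  Term.gen (Γ := Γ.withInv E) (Sum.inr (Sum.inl γ))

/-- A generating cell of `E⁻`, as a formal composite. -/
def Term.neg (Γ : CellExt C) {E : CellExt C} (γ : E.Gen) :
    Term (Γ.withInv E) (E.bd true γ) (E.bd false γ) :=
  Term.gen (Γ := Γ.withInv E) (Sum.inr (Sum.inr γ))

/-- The relations making the cells of `E` and `E⁻` inverse to each other. -/
inductive InvRel (Γ E : CellExt C) : TermRel (Γ.withInv E)
  | right (γ : E.Gen) : InvRel Γ E _ _ ((Term.pos Γ γ).seq (Term.neg Γ γ) rfl) (Term.id _)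
  | left (γ : E.Gen) : InvRel Γ E _ _ ((Term.neg Γ γ).seq (Term.pos Γ γ) rfl) (Term.id _)

/-- The free `(n+1)`-category `C[Γ, E, E⁻] / Inv(E, E⁻)`, in which the cells of `E` are
invertible. -/
noncomputable def freeInv (Γ E : CellExt C) : ExtCat C := freeMod (InvRel Γ E)

/-- The empty cellular extension. -/
def CellExt.empty (C : NCat.{u} n) : CellExt C where
  Gen := PEmpty
  bd _ := PEmpty.elim
  sphere _ _ γ := γ.elim

/-- The free `(n+1,n)`-category `C(E) = C[E, E⁻] / Inv(E)` generated by `E` over an `n`-category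
`C`. -/
noncomputable def freeGpd (E : CellExt C) : ExtCat C := freeInv (CellExt.empty C) E

/-- The number of generating cells in a formal composite. -/
def Term.size {Γ : CellExt C} {x y : C.Cell} : Term Γ x y → ℕ
  | .id _ => 0
  | .gen _ => 1
  | .seq a b _ => a.size + b.size
  | .star _ _ a b _ _ => a.size + b.size

theorem Rel.size_eq {Γ : CellExt C} {p q : Pre Γ} (h : Rel (TermRel.none Γ) p q) :
    p.term.size = q.term.size := by
  induction h with
  | of a b h => exact h.elim
  | refl p => rfl
  | symm _ ih => exact ih.symm
  | trans _ _ ih₁ ih₂ => exact ih₁.trans ih₂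
  | _ => simp only [Term.pack, Term.size] at *; try omega

/-- The size of an `(n+1)`-cell of `C[Γ]`: the number of generating cells of `Γ` it contains. -/
def size {Γ : CellExt C} (f : (free Γ).cat.Cell) : ℕ :=
  Quotient.lift (s := relSetoid (TermRel.none Γ)) (fun p : Pre Γ => p.term.size)
    (fun _ _ h => Rel.size_eq h) f

/-! ### Functors that are the identity on the underlying `n`-category -/

/-- Functors between two `(n+1)`-categories with underlying `n`-category `C` that are the identity
on `C`. -/
structure ExtHom (D D' : ExtCat C) where
  map : D.cat.Cell → D'.cat.Cell
  face_map : ∀ (α : Bool) (f : D.cat.Cell), D'.face α (map f) = D.face α f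
  map_ι : ∀ x : C.Cell, map (D.ι x) = D'.ι x
  map_comp : ∀ (i : ℕ) (f g : D.cat.Cell) (h h'),
    map (D.cat.comp i f g h) = D'.cat.comp i (map f) (map g) h'

/-- The value of a formal composite in `D`, given values for the generating cells. -/
def Term.eval {Γ : CellExt C} (D : ExtCat C) (φ : Γ.Gen → D.cat.Cell)
    (hφ : ∀ α γ, D.face α (φ γ) = Γ.bd α γ) {x y : C.Cell} :
    Term Γ x y → {d : D.cat.Cell // D.face false d = x ∧ D.face true d = y}
  | .id x => ⟨D.ι x, D.face_ι _ _, D.face_ι _ _⟩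
  | .gen γ => ⟨φ γ, hφ _ _, hφ _ _⟩
  | .seq a b h =>
    ⟨D.seq (a.eval D φ hφ).1 (b.eval D φ hφ).1
        (((a.eval D φ hφ).2.2.trans h).trans (b.eval D φ hφ).2.1.symm),
      by rw [D.face_false_seq]; exact (a.eval D φ hφ).2.1,
      by rw [D.face_true_seq]; exact (b.eval D φ hφ).2.2⟩
  | .star i hi a b h h' =>
    ⟨D.cat.comp i (a.eval D φ hφ).1 (b.eval D φ hφ).1
        ((D.bd_iff hi _ _ false false).2
          (by rw [(a.eval D φ hφ).2.1, (b.eval D φ hφ).2.1]; exact h)),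
      (D.face_comp false hi _ _ _
        (by rw [(a.eval D φ hφ).2.1, (b.eval D φ hφ).2.1]; exact h)).trans
        (C.comp_congr (a.eval D φ hφ).2.1 (b.eval D φ hφ).2.1 _ _),
      (D.face_comp true hi _ _ _
        (by rw [(a.eval D φ hφ).2.2, (b.eval D φ hφ).2.2]; exact h')).trans
        (C.comp_congr (a.eval D φ hφ).2.2 (b.eval D φ hφ).2.2 _ _)⟩

theorem ExtCat.seq_congr (D : ExtCat C) {f g f' g' : D.cat.Cell} (hf : f = f') (hg : g = g')
    (h h') : D.seq f g h = D.seq f' g' h' := by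
  subst hf; subst hg; rfl

theorem ExtCat.ι_star (D : ExtCat C) {i : ℕ} (w : C.Cell) (f : D.cat.Cell) (h)
    (hw : D.ι w = D.cat.bd false i f) : D.cat.comp i (D.ι w) f h = f :=
  (D.cat.comp_congr hw rfl h (hw ▸ h)).trans (D.cat.id_comp i f _)

theorem ExtCat.star_ι (D : ExtCat C) {i : ℕ} (w : C.Cell) (f : D.cat.Cell) (h)
    (hw : D.ι w = D.cat.bd true i f) : D.cat.comp i f (D.ι w) h = f :=
  (D.cat.comp_congr rfl hw h (hw ▸ h)).trans (D.cat.comp_id i f _)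

theorem ExtCat.ι_seq_ι (D : ExtCat C) (x : C.Cell) (h) : D.seq (D.ι x) (D.ι x) h = D.ι x :=
  D.id_seq _ _ _ (D.face_ι _ _).symm

theorem Rel.eval_eq {Γ : CellExt C} {r : TermRel Γ} (D : ExtCat C) (φ : Γ.Gen → D.cat.Cell)
    (hφ : ∀ α γ, D.face α (φ γ) = Γ.bd α γ)
    (hr : ∀ x y (a b : Term Γ x y), r x y a b → (a.eval D φ hφ).1 = (b.eval D φ hφ).1)
    {p q : Pre Γ} (h : Rel r p q) :
    (p.term.eval D φ hφ).1 = (q.term.eval D φ hφ).1 := by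
  induction h with
  | of a b h => exact hr _ _ _ _ h
  | refl p => rfl
  | symm _ ih => exact ih.symm
  | trans _ _ ih₁ ih₂ => exact ih₁.trans ih₂
  | @seq_congr x y y' z x₁ y₁ y₁' z₁ a b a₁ b₁ h h₁ _ _ iha ihb =>
    exact D.seq_congr iha ihb
      (((a.eval D φ hφ).2.2.trans h).trans (b.eval D φ hφ).2.1.symm)
      (((a₁.eval D φ hφ).2.2.trans h₁).trans (b₁.eval D φ hφ).2.1.symm)
  | star_congr h h' h₁ h₁' _ _ iha ihb => exact D.cat.comp_congr iha ihb _ _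
  | id_seq a h =>
    exact D.id_seq _ _ ((D.face_ι _ _).trans (h.trans (a.eval D φ hφ).2.1.symm))
      (h.trans (a.eval D φ hφ).2.1.symm)
  | seq_id a h =>
    exact D.seq_id _ _ ((a.eval D φ hφ).2.2.trans (h.trans (D.face_ι _ _).symm))
      (h.symm.trans (a.eval D φ hφ).2.2.symm)
  | seq_assoc a b c h h' =>
    have h₁ := ((a.eval D φ hφ).2.2.trans h).trans (b.eval D φ hφ).2.1.symm
    have h₃ := ((b.eval D φ hφ).2.2.trans h').trans (c.eval D φ hφ).2.1.symm
    exact D.seq_assoc _ _ _ h₁ ((D.face_true_seq _ _ _).trans h₃) h₃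
      (h₁.trans (D.face_false_seq _ _ _).symm)
  | @id_star i hi w x y a hw h h' =>
    refine D.ι_star _ _ _ ?_
    rw [D.bd_eq false false _ hi, (a.eval D φ hφ).2.1, hw]
  | @star_id i hi w x y a hw h h' =>
    refine D.star_ι _ _ _ ?_
    rw [D.bd_eq true false _ hi, (a.eval D φ hφ).2.1, hw]
  | star_assoc a b c h₁ h₁' h₂ h₂' h₃ h₃' h₄ h₄' => exact D.cat.assoc _ _ _ _ _ _ _ _
  | id_star_id h h' => exact (D.ι_comp _ _ _ h _).symm
  | @seq_star_seq i hi => exact D.cat.exchange _ _ _ _ _ _ _ _ _ _ hi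
  | star_star_star a b c d h₁ h₁' h₂ h₂' h₃ h₃' h₄ h₄' h₅ h₅' h₆ h₆' hij =>
    exact D.cat.exchange _ _ _ _ _ _ _ _ _ _ hij

/-- The functor out of a free `(n+1)`-category modulo relations determined by its values on
generating cells. -/
def freeModLift {Γ : CellExt C} {r : TermRel Γ} (D : ExtCat C) (φ : Γ.Gen → D.cat.Cell)
    (hφ : ∀ α γ, D.face α (φ γ) = Γ.bd α γ)
    (hr : ∀ x y (a b : Term Γ x y), r x y a b → (a.eval D φ hφ).1 = (b.eval D φ hφ).1) :
    ExtHom (freeMod r) D where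
  map := fun f : FreeCell r => Quotient.lift (s := relSetoid r)
    (fun p : Pre Γ => (p.term.eval D φ hφ).1) (fun _ _ h => Rel.eval_eq D φ hφ hr h) f
  face_map α f := by
    induction f using FreeCell.ind with
    | h x y a =>
    cases α
    · exact (a.eval D φ hφ).2.1
    · exact (a.eval D φ hφ).2.2
  map_ι _ := rfl
  map_comp i f g h h' := by
    induction f using FreeCell.ind with
    | h x y a =>
    induction g using FreeCell.ind with
    | h x' y' b =>
    rcases lt_trichotomy i n with hi | rfl | hi
    · have := FreeCell.comp_mk_of_lt hi a b h (FreeCell.face_of_bd hi h false false)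
        (FreeCell.face_of_bd hi h true true)
      exact (congrArg (Quotient.lift (s := relSetoid r) (fun p : Pre Γ => (p.term.eval D φ hφ).1)
        (fun _ _ h => Rel.eval_eq D φ hφ hr h)) this)
    · have := FreeCell.comp_mk_self a b h (FreeCell.face_of_bd_self h)
      exact (congrArg (Quotient.lift (s := relSetoid r) (fun p : Pre Γ => (p.term.eval D φ hφ).1)
        (fun _ _ h => Rel.eval_eq D φ hφ hr h)) this)
    · have e : FreeCell.mk r a = FreeCell.mk r b := by
        have h2 := h
        change FreeCell.bd _ _ _ = FreeCell.bd _ _ _ at h2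
        rwa [FreeCell.bd_of_gt hi, FreeCell.bd_of_gt hi] at h2
      have this := FreeCell.comp_of_gt hi (FreeCell.mk r a) (FreeCell.mk r b) h
      refine (congrArg (Quotient.lift (s := relSetoid r)
        (fun p : Pre Γ => (p.term.eval D φ hφ).1)
        (fun _ _ h => Rel.eval_eq D φ hφ hr h)) this).trans ?_
      have hb : ∀ d : D.cat.Cell, d = D.cat.bd true i d := fun d => (D.cat.bd_of_le _ _ hi).symm
      have e' := congrArg (Quotient.lift (s := relSetoid r)
        (fun p : Pre Γ => (p.term.eval D φ hφ).1)
        (fun _ _ h => Rel.eval_eq D φ hφ hr h)) e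
      refine (D.cat.comp_id i _ ?_).symm.trans (D.cat.comp_congr rfl ?_ _ _)
      · rw [D.cat.bd_bd_of_le _ _ _ le_rfl]
      · exact (hb _).symm.trans e'

/-- The functor out of `C[Γ]` determined by its values on generating cells. -/
noncomputable def freeLift {Γ : CellExt C} (D : ExtCat C) (φ : Γ.Gen → D.cat.Cell)
    (hφ : ∀ α γ, D.face α (φ γ) = Γ.bd α γ) : ExtHom (free Γ) D :=
  freeModLift D φ hφ (fun _ _ _ _ h => h.elim)

/-- The functor out of `C[Γ, E, E⁻] / Inv(E, E⁻)` determined by its values on generating cells. -/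
noncomputable def freeInvLift {Γ E : CellExt C} (D : ExtCat C) (φ : Γ.Gen → D.cat.Cell)
    (hφ : ∀ α γ, D.face α (φ γ) = Γ.bd α γ) (ψ ψ' : E.Gen → D.cat.Cell)
    (hψ : ∀ α γ, D.face α (ψ γ) = E.bd α γ) (hinv : ∀ γ, D.IsInv (ψ γ) (ψ' γ)) :
    ExtHom (freeInv Γ E) D :=
  freeModLift (r := InvRel Γ E) D (Sum.elim φ (Sum.elim ψ ψ'))
    (by
      rintro α (γ | γ | γ)
      · exact hφ α γ
      · exact hψ α γ
      · cases α
        · exact (hinv γ).tgt.symm.trans (hψ true γ)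
        · exact (hinv γ).src.trans (hψ false γ))
    (by
      rintro x y a b (γ | γ)
      · exact (hinv γ).right.trans (congrArg D.ι (hψ false γ))
      · exact (hinv γ).left.trans (congrArg D.ι (hψ true γ)))

/-- A generating cell of `Γ`, as a cell of `C[Γ]`. -/
noncomputable def freeGen {Γ : CellExt C} (γ : Γ.Gen) : (free Γ).cat.Cell :=
  FreeCell.mk (TermRel.none Γ) (Term.gen γ)

/-- A generating cell of the extension made invertible, as a cell. -/
noncomputable def invGen (Γ : CellExt C) {E : CellExt C} (γ : E.Gen) : (freeInv Γ E).cat.Cell :=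
  FreeCell.mk (InvRel Γ E) (Term.pos Γ γ)

/-- The formal inverse of a generating cell of the extension made invertible. -/
noncomputable def invGen' (Γ : CellExt C) {E : CellExt C} (γ : E.Gen) : (freeInv Γ E).cat.Cell :=
  FreeCell.mk (InvRel Γ E) (Term.neg Γ γ)

theorem face_invGen (Γ : CellExt C) {E : CellExt C} (α : Bool) (γ : E.Gen) :
    (freeInv Γ E).face α (invGen Γ γ) = E.bd α γ := by
  cases α <;> rfl

theorem isInv_invGen (Γ : CellExt C) {E : CellExt C} (γ : E.Gen) :
    (freeInv Γ E).IsInv (invGen Γ γ) (invGen' Γ γ) where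
  tgt := rfl
  src := rfl
  right := (FreeCell.comp_mk_self (r := InvRel Γ E) (Term.pos Γ γ) (Term.neg Γ γ)
    ((freeInv Γ E).seq_aux (f := invGen Γ γ) (g := invGen' Γ γ) rfl) rfl).trans
    (FreeCell.sound (Rel.of _ _ (InvRel.right γ)))
  left := (FreeCell.comp_mk_self (r := InvRel Γ E) (Term.neg Γ γ) (Term.pos Γ γ)
    ((freeInv Γ E).seq_aux (f := invGen' Γ γ) (g := invGen Γ γ) rfl) rfl).trans
    (FreeCell.sound (Rel.of _ _ (InvRel.left γ)))

/-- The canonical functor `C[E] → C(E)`. -/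
noncomputable def toGpd (E : CellExt C) : ExtHom (free E) (freeGpd E) :=
  freeLift _ (invGen _) (face_invGen _)

end Free

/-! ## Polygraphs -/

/-- `n`-polygraphs, together with the free `n`-category on each of them. -/
noncomputable def polygraphAux : (n : ℕ) → (T : Type (u + 1)) × (T → NCat.{u} n)
  | 0 => ⟨Type u, NCat.discrete⟩
  | n + 1 => ⟨(P : (polygraphAux n).1) × CellExt ((polygraphAux n).2 P), fun P => (free P.2).cat⟩

/-- An `n`-polygraph `(P₀, …, Pₙ)`: a set `P₀` and, for each `k < n`, a cellular extension `Pₖ₊₁`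
of the free `k`-category `P₀[P₁]⋯[Pₖ]`. -/
def Polygraph (n : ℕ) : Type (u + 1) := (polygraphAux.{u} n).1

/-- The free `n`-category `P₀[P₁]⋯[Pₙ]` on an `n`-polygraph. -/
noncomputable def Polygraph.free {n : ℕ} (P : Polygraph.{u} n) : NCat.{u} n :=
  (polygraphAux.{u} n).2 P

/-! ## Squares and square extensions -/

section Squares

variable {n : ℕ} {C : NCat.{u} n}

/-- Squares over a pair `(V, H)` of `(n+1)`-categories with the same underlying `n`-category: the
horizontal cells `top`, `bot` are in `H` and the vertical cells `left`, `right` are in `V`. -/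
@[ext]
structure Square (V H : ExtCat C) where
  top : H.cat.Cell
  bot : H.cat.Cell
  left : V.cat.Cell
  right : V.cat.Cell
  nw : H.face false top = V.face false left
  ne : H.face true top = V.face false right
  sw : H.face false bot = V.face true left
  se : H.face true bot = V.face true right

/-- A square extension of the pair `(V, H)`. -/
structure SqExt (V H : ExtCat C) : Type (u + 1) where
  Gen : Type u
  sq : Gen → Square V H

/-- The union of two square extensions. -/
def SqExt.union {V H : ExtCat C} (Γ Δ : SqExt V H) : SqExt V H where
  Gen := Γ.Gen ⊕ Δ.Gen
  sq := Sum.elim Γ.sq Δ.sq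

/-- The image of a square under a functor on horizontal cells. -/
def Square.mapH {V H H' : ExtCat C} (F : ExtHom H H') (s : Square V H) : Square V H' where
  top := F.map s.top
  bot := F.map s.bot
  left := s.left
  right := s.right
  nw := (F.face_map _ _).trans s.nw
  ne := (F.face_map _ _).trans s.ne
  sw := (F.face_map _ _).trans s.sw
  se := (F.face_map _ _).trans s.se

/-- A square extension of `(V, H)`, seen as a square extension of `(V, H')` through a functor
`H → H'`. -/
def SqExt.mapH {V H H' : ExtCat C} (F : ExtHom H H') (Γ : SqExt V H) : SqExt V H' where
  Gen := Γ.Gen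
  sq A := (Γ.sq A).mapH F

/-- The part of a square extension of `(V, H')` whose horizontal cells come from `H`. -/
def SqExt.restrictH {V H H' : ExtCat C} (F : ExtHom H H') (Γ : SqExt V H') : SqExt V H where
  Gen := {p : Γ.Gen × Square V H // p.2.mapH F = Γ.sq p.1}
  sq p := p.1.2

/-- The data `(i, f, e)` of a Peiffer square: `s_n f` and `s_n e` are `i`-composable. -/
structure PeifferData (V H : ExtCat C) where
  i : ℕ
  hi : i < n
  f : H.cat.Cell
  e : V.cat.Cell
  comp : C.bd true i (H.face false f) = C.bd false i (V.face false e)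

/-- The data `(i, e, f)` of a Peiffer square: `s_n e` and `s_n f` are `i`-composable. -/
structure PeifferData' (V H : ExtCat C) where
  i : ℕ
  hi : i < n
  e : V.cat.Cell
  f : H.cat.Cell
  comp : C.bd true i (V.face false e) = C.bd false i (H.face false f)

theorem ExtCat.whisker_right (D : ExtCat C) {i : ℕ} (hi : i < n) (f : D.cat.Cell) (x : C.Cell)
    (β : Bool) (h : C.bd true i (D.face β f) = C.bd false i x) :
    D.cat.bd true i f = D.cat.bd false i (D.ι x) :=
  (D.bd_iff hi _ _ β false).2 (by rw [D.face_ι, h])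

theorem ExtCat.whisker_left (D : ExtCat C) {i : ℕ} (hi : i < n) (x : C.Cell) (f : D.cat.Cell)
    (β : Bool) (h : C.bd true i x = C.bd false i (D.face β f)) :
    D.cat.bd true i (D.ι x) = D.cat.bd false i f :=
  (D.bd_iff hi _ _ false β).2 (by rw [D.face_ι, h])

/-- The Peiffer square with horizontal cells `f ⋆ᵢ v`, `f ⋆ᵢ v'` and vertical cells `u ⋆ᵢ e`,
`u' ⋆ᵢ e`, for `f : u → u'` and `e : v → v'`. -/
def PeifferData.square {V H : ExtCat C} (p : PeifferData V H) : Square V H :=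
  have h : ∀ α β : Bool,
      C.bd true p.i (H.face α p.f) = C.bd false p.i (V.face β p.e) := fun α β => by
    rw [H.face_parallel true α false _ p.hi, V.face_parallel false β false _ p.hi, p.comp]
  { top := H.cat.comp p.i p.f (H.ι (V.face false p.e))
      (H.whisker_right p.hi _ _ false (h false false))
    bot := H.cat.comp p.i p.f (H.ι (V.face true p.e))
      (H.whisker_right p.hi _ _ false (h false true))
    left := V.cat.comp p.i (V.ι (H.face false p.f)) p.e
      (V.whisker_left p.hi _ _ false (h false false))
    right := V.cat.comp p.i (V.ι (H.face true p.f)) p.e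
      (V.whisker_left p.hi _ _ false (h true false))
    nw := by
      rw [H.face_comp _ p.hi _ _ _ (by rw [H.face_ι]; exact h _ _),
        V.face_comp _ p.hi _ _ _ (by rw [V.face_ι]; exact h _ _)]
      exact C.comp_congr (V.face_ι _ _).symm (H.face_ι _ _) _ _
    ne := by
      rw [H.face_comp _ p.hi _ _ _ (by rw [H.face_ι]; exact h _ _),
        V.face_comp _ p.hi _ _ _ (by rw [V.face_ι]; exact h _ _)]
      exact C.comp_congr (V.face_ι _ _).symm (H.face_ι _ _) _ _
    sw := by
      rw [H.face_comp _ p.hi _ _ _ (by rw [H.face_ι]; exact h _ _),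
        V.face_comp _ p.hi _ _ _ (by rw [V.face_ι]; exact h _ _)]
      exact C.comp_congr (V.face_ι _ _).symm (H.face_ι _ _) _ _
    se := by
      rw [H.face_comp _ p.hi _ _ _ (by rw [H.face_ι]; exact h _ _),
        V.face_comp _ p.hi _ _ _ (by rw [V.face_ι]; exact h _ _)]
      exact C.comp_congr (V.face_ι _ _).symm (H.face_ι _ _) _ _ }

/-- The Peiffer square with horizontal cells `w ⋆ᵢ f`, `w' ⋆ᵢ f` and vertical cells `e ⋆ᵢ u`,
`e ⋆ᵢ u'`, for `e : w → w'` and `f : u → u'`. -/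
def PeifferData'.square {V H : ExtCat C} (p : PeifferData' V H) : Square V H :=
  have h : ∀ α β : Bool,
      C.bd true p.i (V.face α p.e) = C.bd false p.i (H.face β p.f) := fun α β => by
    rw [V.face_parallel true α false _ p.hi, H.face_parallel false β false _ p.hi, p.comp]
  { top := H.cat.comp p.i (H.ι (V.face false p.e)) p.f
      (H.whisker_left p.hi _ _ false (h false false))
    bot := H.cat.comp p.i (H.ι (V.face true p.e)) p.f
      (H.whisker_left p.hi _ _ false (h true false))
    left := V.cat.comp p.i p.e (V.ι (H.face false p.f))
      (V.whisker_right p.hi _ _ false (h false false))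
    right := V.cat.comp p.i p.e (V.ι (H.face true p.f))
      (V.whisker_right p.hi _ _ false (h false true))
    nw := by
      rw [H.face_comp _ p.hi _ _ _ (by rw [H.face_ι]; exact h _ _),
        V.face_comp _ p.hi _ _ _ (by rw [V.face_ι]; exact h _ _)]
      exact C.comp_congr (H.face_ι _ _) (V.face_ι _ _).symm _ _
    ne := by
      rw [H.face_comp _ p.hi _ _ _ (by rw [H.face_ι]; exact h _ _),
        V.face_comp _ p.hi _ _ _ (by rw [V.face_ι]; exact h _ _)]
      exact C.comp_congr (H.face_ι _ _) (V.face_ι _ _).symm _ _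
    sw := by
      rw [H.face_comp _ p.hi _ _ _ (by rw [H.face_ι]; exact h _ _),
        V.face_comp _ p.hi _ _ _ (by rw [V.face_ι]; exact h _ _)]
      exact C.comp_congr (H.face_ι _ _) (V.face_ι _ _).symm _ _
    se := by
      rw [H.face_comp _ p.hi _ _ _ (by rw [H.face_ι]; exact h _ _),
        V.face_comp _ p.hi _ _ _ (by rw [V.face_ι]; exact h _ _)]
      exact C.comp_congr (H.face_ι _ _) (V.face_ι _ _).symm _ _ }

/-- The Peiffer square extension of the pair `(V, H)`. -/
def peiffer (V H : ExtCat C) : SqExt V H where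
  Gen := PeifferData V H ⊕ PeifferData' V H
  sq := Sum.elim PeifferData.square PeifferData'.square

/-! ### Free enriched categories on a square extension -/

/-- Formal composites of square cells over `(V, H)`: they are built from the squares of `Γ`, the
identities `i₁ʰ(f)` and `i₁ᵛ(e)`, the compositions `⋄ᵛ` (`compV`) and `⋄ʰ` (`compH`), the
compositions `⋆ᵢ` for `i < n` (`star`; with an identity square as one of its arguments, this is
the action of contexts of `C`), the `⋄ʰ`-inverses and, when `gpd` holds, the `⋄ᵛ`-inverses.  The
indices are the top, bottom, left and right faces. -/
inductive SqTerm {V H : ExtCat C} (Γ : SqExt V H) (gpd : Prop) :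
    H.cat.Cell → H.cat.Cell → V.cat.Cell → V.cat.Cell → Type u
  | gen (A : Γ.Gen) : SqTerm Γ gpd (Γ.sq A).top (Γ.sq A).bot (Γ.sq A).left (Γ.sq A).right
  | idH (f : H.cat.Cell) : SqTerm Γ gpd f f (V.ι (H.face false f)) (V.ι (H.face true f))
  | idV (e : V.cat.Cell) : SqTerm Γ gpd (H.ι (V.face false e)) (H.ι (V.face true e)) e e
  | compV {f g f' g' : H.cat.Cell} {e e' d d' : V.cat.Cell}
      (A : SqTerm Γ gpd f g e e') (B : SqTerm Γ gpd f' g' d d') (h : e' = d)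
      (hf : H.face true f = H.face false f') (hg : H.face true g = H.face false g') :
      SqTerm Γ gpd (H.seq f f' hf) (H.seq g g' hg) e d'
  | compH {f g f' g' : H.cat.Cell} {e e' d d' : V.cat.Cell}
      (A : SqTerm Γ gpd f g e e') (B : SqTerm Γ gpd f' g' d d') (h : g = f')
      (he : V.face true e = V.face false d) (he' : V.face true e' = V.face false d') :
      SqTerm Γ gpd f g' (V.seq e d he) (V.seq e' d' he')
  | star (i : ℕ) (hi : i < n) {f g f' g' : H.cat.Cell} {e e' d d' : V.cat.Cell}
      (A : SqTerm Γ gpd f g e e') (B : SqTerm Γ gpd f' g' d d')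
      (hf : H.cat.bd true i f = H.cat.bd false i f')
      (hg : H.cat.bd true i g = H.cat.bd false i g')
      (he : V.cat.bd true i e = V.cat.bd false i d)
      (he' : V.cat.bd true i e' = V.cat.bd false i d') :
      SqTerm Γ gpd (H.cat.comp i f f' hf) (H.cat.comp i g g' hg)
        (V.cat.comp i e d he) (V.cat.comp i e' d' he')
  | invH {f g : H.cat.Cell} {e e' : V.cat.Cell} (A : SqTerm Γ gpd f g e e')
      (d d' : V.cat.Cell) (h : V.IsInv e d) (h' : V.IsInv e' d') : SqTerm Γ gpd g f d d'
  | invV {f g : H.cat.Cell} {e e' : V.cat.Cell} (hgpd : gpd) (A : SqTerm Γ gpd f g e e')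
      (f' g' : H.cat.Cell) (h : H.IsInv f f') (h' : H.IsInv g g') : SqTerm Γ gpd f' g' e' e

/-- A formal composite of squares, together with its faces. -/
structure SqPre {V H : ExtCat C} (Γ : SqExt V H) (gpd : Prop) where
  top : H.cat.Cell
  bot : H.cat.Cell
  left : V.cat.Cell
  right : V.cat.Cell
  term : SqTerm Γ gpd top bot left right

/-- The formal composite `A`, bundled with its faces. -/
def SqTerm.pack {V H : ExtCat C} {Γ : SqExt V H} {gpd : Prop} {f g : H.cat.Cell}
    {e e' : V.cat.Cell} (A : SqTerm Γ gpd f g e e') : SqPre Γ gpd := ⟨f, g, e, e', A⟩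

open SqTerm in
/-- The congruence on formal composites of squares generated by the axioms of `n`-categories
enriched in double categories, and the axioms of inverses. -/
inductive SqRel {V H : ExtCat C} {Γ : SqExt V H} {gpd : Prop} :
    SqPre Γ gpd → SqPre Γ gpd → Prop
  | refl (P) : SqRel P P
  | symm {P Q} : SqRel P Q → SqRel Q P
  | trans {P Q R} : SqRel P Q → SqRel Q R → SqRel P R
  -- congruence
  | compV_congr {f g f' g' e e' d d' f₁ g₁ f₁' g₁' e₁ e₁' d₁ d₁'}
      {A : SqTerm Γ gpd f g e e'} {B : SqTerm Γ gpd f' g' d d'}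
      {A₁ : SqTerm Γ gpd f₁ g₁ e₁ e₁'} {B₁ : SqTerm Γ gpd f₁' g₁' d₁ d₁'} (h hf hg h₁ hf₁ hg₁) :
      SqRel A.pack A₁.pack → SqRel B.pack B₁.pack →
        SqRel (compV A B h hf hg).pack (compV A₁ B₁ h₁ hf₁ hg₁).pack
  | compH_congr {f g f' g' e e' d d' f₁ g₁ f₁' g₁' e₁ e₁' d₁ d₁'}
      {A : SqTerm Γ gpd f g e e'} {B : SqTerm Γ gpd f' g' d d'}
      {A₁ : SqTerm Γ gpd f₁ g₁ e₁ e₁'} {B₁ : SqTerm Γ gpd f₁' g₁' d₁ d₁'} (h he he' h₁ he₁ he₁') :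
      SqRel A.pack A₁.pack → SqRel B.pack B₁.pack →
        SqRel (compH A B h he he').pack (compH A₁ B₁ h₁ he₁ he₁').pack
  | star_congr {i hi f g f' g' e e' d d' f₁ g₁ f₁' g₁' e₁ e₁' d₁ d₁'}
      {A : SqTerm Γ gpd f g e e'} {B : SqTerm Γ gpd f' g' d d'}
      {A₁ : SqTerm Γ gpd f₁ g₁ e₁ e₁'} {B₁ : SqTerm Γ gpd f₁' g₁' d₁ d₁'}
      (hf hg he he' hf₁ hg₁ he₁ he₁') :
      SqRel A.pack A₁.pack → SqRel B.pack B₁.pack →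
        SqRel (star i hi A B hf hg he he').pack (star i hi A₁ B₁ hf₁ hg₁ he₁ he₁').pack
  | invH_congr {f g e e' f₁ g₁ e₁ e₁'} {A : SqTerm Γ gpd f g e e'}
      {A₁ : SqTerm Γ gpd f₁ g₁ e₁ e₁'} (d d' h h' d₁ d₁' h₁ h₁') :
      SqRel A.pack A₁.pack → SqRel (invH A d d' h h').pack (invH A₁ d₁ d₁' h₁ h₁').pack
  | invV_congr {f g e e' f₁ g₁ e₁ e₁'} {A : SqTerm Γ gpd f g e e'}
      {A₁ : SqTerm Γ gpd f₁ g₁ e₁ e₁'} (hgpd f' g' h h' f₁' g₁' h₁ h₁') :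
      SqRel A.pack A₁.pack → SqRel (invV hgpd A f' g' h h').pack (invV hgpd A₁ f₁' g₁' h₁ h₁').pack
  -- double categories
  | idV_compV {f g e e'} (A : SqTerm Γ gpd f g e e') (hf hg) :
      SqRel (compV (idV e) A rfl hf hg).pack A.pack
  | compV_idV {f g e e'} (A : SqTerm Γ gpd f g e e') (hf hg) :
      SqRel (compV A (idV e') rfl hf hg).pack A.pack
  | compV_assoc {f g f' g' f'' g'' e e' d d' c c'} (A : SqTerm Γ gpd f g e e')
      (B : SqTerm Γ gpd f' g' d d') (D : SqTerm Γ gpd f'' g'' c c')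
      (h h' hf₁ hg₁ hf₂ hg₂ hf₃ hg₃ hf₄ hg₄) :
      SqRel (compV (compV A B h hf₁ hg₁) D h' hf₂ hg₂).pack
        (compV A (compV B D h' hf₃ hg₃) h hf₄ hg₄).pack
  | idH_compH {f g e e'} (A : SqTerm Γ gpd f g e e') (he he') :
      SqRel (compH (idH f) A rfl he he').pack A.pack
  | compH_idH {f g e e'} (A : SqTerm Γ gpd f g e e') (he he') :
      SqRel (compH A (idH g) rfl he he').pack A.pack
  | compH_assoc {f g f' g' f'' g'' e e' d d' c c'} (A : SqTerm Γ gpd f g e e')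
      (B : SqTerm Γ gpd f' g' d d') (D : SqTerm Γ gpd f'' g'' c c')
      (h h' he₁ he₁' he₂ he₂' he₃ he₃' he₄ he₄') :
      SqRel (compH (compH A B h he₁ he₁') D h' he₂ he₂').pack
        (compH A (compH B D h' he₃ he₃') h he₄ he₄').pack
  | interchange {f₁ g₁ e₁ e₁' f₂ g₂ e₂ e₂' f₃ g₃ e₃ e₃' f₄ g₄ e₄ e₄'}
      (A : SqTerm Γ gpd f₁ g₁ e₁ e₁') (A' : SqTerm Γ gpd f₂ g₂ e₂ e₂')
      (B : SqTerm Γ gpd f₃ g₃ e₃ e₃') (B' : SqTerm Γ gpd f₄ g₄ e₄ e₄')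
      (h₁ hf₁ hg₁ h₂ hf₂ hg₂ h₃ he₃ he₃' h₄ he₄ he₄' h₅ he₅ he₅' h₆ hf₆ hg₆) :
      SqRel (compH (compV A A' h₁ hf₁ hg₁) (compV B B' h₂ hf₂ hg₂) h₅ he₅ he₅').pack
        (compV (compH A B h₃ he₃ he₃') (compH A' B' h₄ he₄ he₄') h₆ hf₆ hg₆).pack
  | idH_seq (f f' : H.cat.Cell) (h h₁ h₂ h₃) :
      SqRel (idH (H.seq f f' h)).pack (compV (idH f) (idH f') h₁ h₂ h₃).pack
  | idV_seq (e e' : V.cat.Cell) (h h₁ h₂ h₃) :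
      SqRel (idV (V.seq e e' h)).pack (compH (idV e) (idV e') h₁ h₂ h₃).pack
  | idH_ι (x : C.Cell) : SqRel (idH (H.ι x)).pack (idV (V.ι x)).pack
  -- inverses
  | compH_invH {f g e e'} (A : SqTerm Γ gpd f g e e') (d d' h h' he he') :
      SqRel (compH A (invH A d d' h h') rfl he he').pack (idH f).pack
  | invH_compH {f g e e'} (A : SqTerm Γ gpd f g e e') (d d' h h' he he') :
      SqRel (compH (invH A d d' h h') A rfl he he').pack (idH g).pack
  | compV_invV {f g e e'} (A : SqTerm Γ gpd f g e e') (hgpd f' g' h h' hf hg) :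
      SqRel (compV A (invV hgpd A f' g' h h') rfl hf hg).pack (idV e).pack
  | invV_compV {f g e e'} (A : SqTerm Γ gpd f g e e') (hgpd f' g' h h' hf hg) :
      SqRel (compV (invV hgpd A f' g' h h') A rfl hf hg).pack (idV e').pack
  -- compositions along cells of lower dimension
  | id_star {i hi f g e e'} (A : SqTerm Γ gpd f g e e') (w : C.Cell)
      (hw : w = C.bd false i (H.face false f)) (hf hg he he') :
      SqRel (star i hi (idH (H.ι w)) A hf hg he he').pack A.pack
  | star_id {i hi f g e e'} (A : SqTerm Γ gpd f g e e') (w : C.Cell)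
      (hw : w = C.bd true i (H.face false f)) (hf hg he he') :
      SqRel (star i hi A (idH (H.ι w)) hf hg he he').pack A.pack
  | star_assoc {i hi f g f' g' f'' g'' e e' d d' c c'} (A : SqTerm Γ gpd f g e e')
      (B : SqTerm Γ gpd f' g' d d') (D : SqTerm Γ gpd f'' g'' c c')
      (hf₁ hg₁ he₁ he₁' hf₂ hg₂ he₂ he₂' hf₃ hg₃ he₃ he₃' hf₄ hg₄ he₄ he₄') :
      SqRel (star i hi (star i hi A B hf₁ hg₁ he₁ he₁') D hf₂ hg₂ he₂ he₂').pack
        (star i hi A (star i hi B D hf₃ hg₃ he₃ he₃') hf₄ hg₄ he₄ he₄').pack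
  | star_star_star {i hi j hj f₁ g₁ e₁ e₁' f₂ g₂ e₂ e₂' f₃ g₃ e₃ e₃' f₄ g₄ e₄ e₄'}
      (A : SqTerm Γ gpd f₁ g₁ e₁ e₁') (A' : SqTerm Γ gpd f₂ g₂ e₂ e₂')
      (B : SqTerm Γ gpd f₃ g₃ e₃ e₃') (B' : SqTerm Γ gpd f₄ g₄ e₄ e₄')
      (k₁ k₂ k₃ k₄ l₁ l₂ l₃ l₄ m₁ m₂ m₃ m₄ p₁ p₂ p₃ p₄ q₁ q₂ q₃ q₄ r₁ r₂ r₃ r₄) : i < j →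
      SqRel (star i hi (star j hj A A' k₁ k₂ k₃ k₄) (star j hj B B' l₁ l₂ l₃ l₄) m₁ m₂ m₃ m₄).pack
        (star j hj (star i hi A B p₁ p₂ p₃ p₄) (star i hi A' B' q₁ q₂ q₃ q₄) r₁ r₂ r₃ r₄).pack
  | compV_star_compV {i hi f₁ g₁ e₁ e₁' f₂ g₂ e₂ e₂' f₃ g₃ e₃ e₃' f₄ g₄ e₄ e₄'}
      (A : SqTerm Γ gpd f₁ g₁ e₁ e₁') (A' : SqTerm Γ gpd f₂ g₂ e₂ e₂')
      (B : SqTerm Γ gpd f₃ g₃ e₃ e₃') (B' : SqTerm Γ gpd f₄ g₄ e₄ e₄')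
      (k₁ k₂ k₃ l₁ l₂ l₃ m₁ m₂ m₃ m₄ p₁ p₂ p₃ p₄ q₁ q₂ q₃ q₄ r₁ r₂ r₃) :
      SqRel (star i hi (compV A A' k₁ k₂ k₃) (compV B B' l₁ l₂ l₃) m₁ m₂ m₃ m₄).pack
        (compV (star i hi A B p₁ p₂ p₃ p₄) (star i hi A' B' q₁ q₂ q₃ q₄) r₁ r₂ r₃).pack
  | compH_star_compH {i hi f₁ g₁ e₁ e₁' f₂ g₂ e₂ e₂' f₃ g₃ e₃ e₃' f₄ g₄ e₄ e₄'}
      (A : SqTerm Γ gpd f₁ g₁ e₁ e₁') (A' : SqTerm Γ gpd f₂ g₂ e₂ e₂')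
      (B : SqTerm Γ gpd f₃ g₃ e₃ e₃') (B' : SqTerm Γ gpd f₄ g₄ e₄ e₄')
      (k₁ k₂ k₃ l₁ l₂ l₃ m₁ m₂ m₃ m₄ p₁ p₂ p₃ p₄ q₁ q₂ q₃ q₄ r₁ r₂ r₃) :
      SqRel (star i hi (compH A A' k₁ k₂ k₃) (compH B B' l₁ l₂ l₃) m₁ m₂ m₃ m₄).pack
        (compH (star i hi A B p₁ p₂ p₃ p₄) (star i hi A' B' q₁ q₂ q₃ q₄) r₁ r₂ r₃).pack
  | idH_star_idH {i hi} (f f' : H.cat.Cell) (h hf hg he he') :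
      SqRel (star i hi (idH f) (idH f') hf hg he he').pack (idH (H.cat.comp i f f' h)).pack
  | idV_star_idV {i hi} (e e' : V.cat.Cell) (h hf hg he he') :
      SqRel (star i hi (idV e) (idV e') hf hg he he').pack (idV (V.cat.comp i e e' h)).pack

/-- The faces of a formal composite of squares form a square. -/
theorem SqTerm.incidence {V H : ExtCat C} {Γ : SqExt V H} {gpd : Prop} {f g : H.cat.Cell}
    {e e' : V.cat.Cell} (A : SqTerm Γ gpd f g e e') :
    H.face false f = V.face false e ∧ H.face true f = V.face false e' ∧
      H.face false g = V.face true e ∧ H.face true g = V.face true e' := by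
  induction A with
  | gen A => exact ⟨(Γ.sq A).nw, (Γ.sq A).ne, (Γ.sq A).sw, (Γ.sq A).se⟩
  | idH f => simp [V.face_ι]
  | idV e => simp [H.face_ι]
  | compV A B h hf hg ihA ihB =>
    simp only [H.face_false_seq, H.face_true_seq]
    exact ⟨ihA.1, ihB.2.1, ihA.2.2.1, ihB.2.2.2⟩
  | compH A B h hf hg ihA ihB =>
    simp only [V.face_false_seq, V.face_true_seq]
    exact ⟨ihA.1, ihA.2.1, ihB.2.2.1, ihB.2.2.2⟩
  | star i hi A B hf hg he he' ihA ihB =>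
    have hf' := fun α => (H.bd_iff hi _ _ α α).1 hf
    have hg' := fun α => (H.bd_iff hi _ _ α α).1 hg
    have he₁ := fun α => (V.bd_iff hi _ _ α α).1 he
    have he₂ := fun α => (V.bd_iff hi _ _ α α).1 he'
    refine ⟨?_, ?_, ?_, ?_⟩
    · rw [H.face_comp _ hi _ _ _ (hf' _), V.face_comp _ hi _ _ _ (he₁ _)]
      exact C.comp_congr ihA.1 ihB.1 _ _
    · rw [H.face_comp _ hi _ _ _ (hf' _), V.face_comp _ hi _ _ _ (he₂ _)]
      exact C.comp_congr ihA.2.1 ihB.2.1 _ _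
    · rw [H.face_comp _ hi _ _ _ (hg' _), V.face_comp _ hi _ _ _ (he₁ _)]
      exact C.comp_congr ihA.2.2.1 ihB.2.2.1 _ _
    · rw [H.face_comp _ hi _ _ _ (hg' _), V.face_comp _ hi _ _ _ (he₂ _)]
      exact C.comp_congr ihA.2.2.2 ihB.2.2.2 _ _
  | invH A d d' h h' ih =>
    exact ⟨ih.2.2.1.trans h.tgt, ih.2.2.2.trans h'.tgt, ih.1.trans h.src.symm,
      ih.2.1.trans h'.src.symm⟩
  | invV hgpd A f' g' h h' ih =>
    exact ⟨h.tgt.symm.trans ih.2.1, h.src.trans ih.1, h'.tgt.symm.trans ih.2.2.2,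
      h'.src.trans ih.2.2.1⟩

/-- The boundary of a formal composite of squares. -/
def SqPre.boundary {V H : ExtCat C} {Γ : SqExt V H} {gpd : Prop} (P : SqPre Γ gpd) :
    Square V H :=
  ⟨P.top, P.bot, P.left, P.right, P.term.incidence.1, P.term.incidence.2.1,
    P.term.incidence.2.2.1, P.term.incidence.2.2.2⟩

theorem SqRel.faces_eq {V H : ExtCat C} {Γ : SqExt V H} {gpd : Prop} {P Q : SqPre Γ gpd}
    (h : SqRel P Q) :
    P.top = Q.top ∧ P.bot = Q.bot ∧ P.left = Q.left ∧ P.right = Q.right := by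
  induction h with
  | refl P => exact ⟨rfl, rfl, rfl, rfl⟩
  | symm _ ih => exact ⟨ih.1.symm, ih.2.1.symm, ih.2.2.1.symm, ih.2.2.2.symm⟩
  | trans _ _ ih₁ ih₂ =>
    exact ⟨ih₁.1.trans ih₂.1, ih₁.2.1.trans ih₂.2.1, ih₁.2.2.1.trans ih₂.2.2.1,
      ih₁.2.2.2.trans ih₂.2.2.2⟩
  | compV_congr h hf hg h₁ hf₁ hg₁ _ _ ihA ihB =>
    exact ⟨H.seq_congr ihA.1 ihB.1 hf hf₁, H.seq_congr ihA.2.1 ihB.2.1 hg hg₁, ihA.2.2.1,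
      ihB.2.2.2⟩
  | compH_congr h he he' h₁ he₁ he₁' _ _ ihA ihB =>
    exact ⟨ihA.1, ihB.2.1, V.seq_congr ihA.2.2.1 ihB.2.2.1 he he₁,
      V.seq_congr ihA.2.2.2 ihB.2.2.2 he' he₁'⟩
  | star_congr hf hg he he' hf₁ hg₁ he₁ he₁' _ _ ihA ihB =>
    exact ⟨H.cat.comp_congr ihA.1 ihB.1 hf hf₁, H.cat.comp_congr ihA.2.1 ihB.2.1 hg hg₁,
      V.cat.comp_congr ihA.2.2.1 ihB.2.2.1 he he₁, V.cat.comp_congr ihA.2.2.2 ihB.2.2.2 he' he₁'⟩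
  | invH_congr d d' h h' d₁ d₁' h₁ h₁' _ ih =>
    obtain ⟨i₁, i₂, i₃, i₄⟩ := ih
    simp only [SqTerm.pack] at i₁ i₂ i₃ i₄
    subst i₃; subst i₄
    exact ⟨i₂, i₁, h.unique V h₁, h'.unique V h₁'⟩
  | invV_congr hgpd d d' h h' d₁ d₁' h₁ h₁' _ ih =>
    obtain ⟨i₁, i₂, i₃, i₄⟩ := ih
    simp only [SqTerm.pack] at i₁ i₂ i₃ i₄
    subst i₁; subst i₂
    exact ⟨h.unique H h₁, h'.unique H h₁', i₄, i₃⟩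
  | idV_compV A hf hg =>
    exact ⟨H.id_seq _ _ hf A.incidence.1.symm, H.id_seq _ _ hg A.incidence.2.2.1.symm, rfl, rfl⟩
  | compV_idV A hf hg =>
    exact ⟨H.seq_id _ _ hf A.incidence.2.1.symm, H.seq_id _ _ hg A.incidence.2.2.2.symm, rfl, rfl⟩
  | compV_assoc A B D h h' hf₁ hg₁ hf₂ hg₂ hf₃ hg₃ hf₄ hg₄ =>
    exact ⟨H.seq_assoc _ _ _ hf₁ hf₂ hf₃ hf₄, H.seq_assoc _ _ _ hg₁ hg₂ hg₃ hg₄, rfl, rfl⟩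
  | idH_compH A he he' =>
    exact ⟨rfl, rfl, V.id_seq _ _ he A.incidence.1, V.id_seq _ _ he' A.incidence.2.1⟩
  | compH_idH A he he' =>
    exact ⟨rfl, rfl, V.seq_id _ _ he A.incidence.2.2.1, V.seq_id _ _ he' A.incidence.2.2.2⟩
  | compH_assoc A B D h h' he₁ he₁' he₂ he₂' he₃ he₃' he₄ he₄' =>
    exact ⟨rfl, rfl, V.seq_assoc _ _ _ he₁ he₂ he₃ he₄,
      V.seq_assoc _ _ _ he₁' he₂' he₃' he₄'⟩
  | interchange => exact ⟨rfl, rfl, rfl, rfl⟩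
  | idH_seq f f' h h₁ h₂ h₃ =>
    exact ⟨rfl, rfl, congrArg V.ι (H.face_false_seq _ _ _), congrArg V.ι (H.face_true_seq _ _ _)⟩
  | idV_seq e e' h h₁ h₂ h₃ =>
    exact ⟨congrArg H.ι (V.face_false_seq _ _ _), congrArg H.ι (V.face_true_seq _ _ _), rfl, rfl⟩
  | idH_ι x =>
    exact ⟨congrArg H.ι (V.face_ι _ _).symm, congrArg H.ι (V.face_ι _ _).symm,
      congrArg V.ι (H.face_ι _ _), congrArg V.ι (H.face_ι _ _)⟩
  | compH_invH A d d' h h' he he' =>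
    exact ⟨rfl, rfl, h.right.trans (congrArg V.ι A.incidence.1.symm),
      h'.right.trans (congrArg V.ι A.incidence.2.1.symm)⟩
  | invH_compH A d d' h h' he he' =>
    exact ⟨rfl, rfl, h.left.trans (congrArg V.ι A.incidence.2.2.1.symm),
      h'.left.trans (congrArg V.ι A.incidence.2.2.2.symm)⟩
  | compV_invV A hgpd f' g' h h' hf hg =>
    exact ⟨h.right.trans (congrArg H.ι A.incidence.1),
      h'.right.trans (congrArg H.ι A.incidence.2.2.1), rfl, rfl⟩
  | invV_compV A hgpd f' g' h h' hf hg =>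
    exact ⟨h.left.trans (congrArg H.ι A.incidence.2.1),
      h'.left.trans (congrArg H.ι A.incidence.2.2.2), rfl, rfl⟩
  | @id_star i hi f g e e' A w hw hf hg he he' =>
    obtain ⟨a₁, a₂, a₃, a₄⟩ := A.incidence
    subst hw
    refine ⟨H.ι_star _ _ _ ?_, H.ι_star _ _ _ ?_,
      (V.cat.comp_congr (congrArg V.ι (H.face_ι _ _)) rfl _ ?_).trans (V.ι_star _ _ ?_ ?_),
      (V.cat.comp_congr (congrArg V.ι (H.face_ι _ _)) rfl _ ?_).trans (V.ι_star _ _ ?_ ?_)⟩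
    all_goals simp only [H.face_ι] at *
    · exact (H.bd_eq _ _ _ hi).symm
    · rw [H.bd_eq _ false _ hi, a₁, a₃, V.face_parallel _ true false _ hi]
    · exact he
    · exact he
    · rw [V.bd_eq _ false _ hi, a₁]
    · exact he'
    · exact he'
    · rw [V.bd_eq _ false _ hi, ← a₂, H.face_parallel _ true false _ hi]
  | @star_id i hi f g e e' A w hw hf hg he he' =>
    obtain ⟨a₁, a₂, a₃, a₄⟩ := A.incidence
    subst hw
    refine ⟨H.star_ι _ _ _ ?_, H.star_ι _ _ _ ?_,
      (V.cat.comp_congr rfl (congrArg V.ι (H.face_ι _ _)) _ ?_).trans (V.star_ι _ _ ?_ ?_),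
      (V.cat.comp_congr rfl (congrArg V.ι (H.face_ι _ _)) _ ?_).trans (V.star_ι _ _ ?_ ?_)⟩
    all_goals simp only [H.face_ι] at *
    · exact (H.bd_eq _ _ _ hi).symm
    · rw [H.bd_eq _ false _ hi, a₁, a₃, V.face_parallel _ true false _ hi]
    · exact he
    · exact he
    · rw [V.bd_eq _ false _ hi, a₁]
    · exact he'
    · exact he'
    · rw [V.bd_eq _ false _ hi, ← a₂, H.face_parallel _ true false _ hi]
  | star_assoc =>
    exact ⟨H.cat.assoc _ _ _ _ _ _ _ _, H.cat.assoc _ _ _ _ _ _ _ _,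
      V.cat.assoc _ _ _ _ _ _ _ _, V.cat.assoc _ _ _ _ _ _ _ _⟩
  | star_star_star A A' B B' k₁ k₂ k₃ k₄ l₁ l₂ l₃ l₄ m₁ m₂ m₃ m₄ p₁ p₂ p₃ p₄ q₁ q₂ q₃ q₄ r₁ r₂ r₃
      r₄ hij =>
    exact ⟨H.cat.exchange _ _ _ _ _ _ _ _ _ _ hij, H.cat.exchange _ _ _ _ _ _ _ _ _ _ hij,
      V.cat.exchange _ _ _ _ _ _ _ _ _ _ hij, V.cat.exchange _ _ _ _ _ _ _ _ _ _ hij⟩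
  | @compV_star_compV i hi =>
    exact ⟨H.cat.exchange _ _ _ _ _ _ _ _ _ _ hi, H.cat.exchange _ _ _ _ _ _ _ _ _ _ hi, rfl, rfl⟩
  | @compH_star_compH i hi =>
    exact ⟨rfl, rfl, V.cat.exchange _ _ _ _ _ _ _ _ _ _ hi, V.cat.exchange _ _ _ _ _ _ _ _ _ _ hi⟩
  | @idH_star_idH i hi f f' h hf hg he he' =>
    have hα := fun α => (H.bd_iff hi _ _ α α).1 h
    refine ⟨rfl, rfl, (V.ι_comp i _ _ (hα false) he).symm.trans (congrArg V.ι ?_),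
      (V.ι_comp i _ _ (hα true) he').symm.trans (congrArg V.ι ?_)⟩
    · exact (H.face_comp _ hi _ _ _ _).symm
    · exact (H.face_comp _ hi _ _ _ _).symm
  | @idV_star_idV i hi f f' h hf hg he he' =>
    have hα := fun α => (V.bd_iff hi _ _ α α).1 h
    refine ⟨(H.ι_comp i _ _ (hα false) hf).symm.trans (congrArg H.ι ?_),
      (H.ι_comp i _ _ (hα true) hg).symm.trans (congrArg H.ι ?_), rfl, rfl⟩
    · exact (V.face_comp _ hi _ _ _ _).symm
    · exact (V.face_comp _ hi _ _ _ _).symm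

/-- The equivalence relation `SqRel`. -/
def sqSetoid {V H : ExtCat C} (Γ : SqExt V H) (gpd : Prop) : Setoid (SqPre Γ gpd) :=
  ⟨SqRel, SqRel.refl, SqRel.symm, SqRel.trans⟩

/-- The square cells of the free `n`-category generated by the square extension `Γ` of `(V, H)`:
enriched in double groupoids when `gpd` holds, and enriched in double categories whose vertical
cells are invertible otherwise. -/
def SqCell {V H : ExtCat C} (Γ : SqExt V H) (gpd : Prop) : Type u := Quotient (sqSetoid Γ gpd)

/-- The boundary of a square cell. -/
def SqCell.boundary {V H : ExtCat C} {Γ : SqExt V H} {gpd : Prop} (A : SqCell Γ gpd) :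
    Square V H :=
  Quotient.lift (s := sqSetoid Γ gpd) SqPre.boundary (fun _ _ h => by
    obtain ⟨h₁, h₂, h₃, h₄⟩ := SqRel.faces_eq h
    exact Square.ext h₁ h₂ h₃ h₄) A

/-- A square extension `Γ` of a pair `(V, H)` of `(n+1,n)`-categories is acyclic when every square
over `(V, H)` is the boundary of a square cell of the free `n`-category enriched in double
groupoids generated by `Γ`. -/
def SqExt.Acyclic {V H : ExtCat C} (Γ : SqExt V H) : Prop :=
  ∀ s : Square V H, ∃ A : SqCell Γ True, A.boundary = s

end Squares

/-! ## Rewriting -/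

section Rewriting

variable {n : ℕ} {C : NCat.{u} n}

/-- The cell `f` is an identity. -/
def ExtCat.IsId (D : ExtCat C) (f : D.cat.Cell) : Prop := ∃ x : C.Cell, f = D.ι x

/-- `u` reduces to `v`: there is a non-identity cell `u → v` in `C[Γ]`. -/
def Reduces (Γ : CellExt C) (u v : C.Cell) : Prop :=
  ∃ f : (free Γ).cat.Cell,
    (free Γ).face false f = u ∧ (free Γ).face true f = v ∧ ¬ (free Γ).IsId f

/-- There is no infinite reduction sequence. -/
def Terminating (Γ : CellExt C) : Prop :=
  ¬ ∃ u : ℕ → C.Cell, ∀ k, Reduces Γ (u k) (u (k + 1))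

/-- The set of reduced cells. -/
def Irr (Γ : CellExt C) : Set C.Cell := {u | ∀ v, ¬ Reduces Γ u v}

/-- The set of normal forms of `u`: the reduced cells `v` such that there is a cell `u → v` in
`C[Γ]`, possibly an identity. -/
def NF (Γ : CellExt C) (u : C.Cell) : Set C.Cell :=
  {v | v ∈ Irr Γ ∧ ∃ f : (free Γ).cat.Cell, (free Γ).face false f = u ∧ (free Γ).face true f = v}

/-- A branching: a pair of cells of `C[Γ]` with the same source. -/
@[ext]
structure Branching (Γ : CellExt C) where
  fst : (free Γ).cat.Cell
  snd : (free Γ).cat.Cell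
  src_eq : (free Γ).face false fst = (free Γ).face false snd

/-- A confluence of a branching. -/
structure Confluence {Γ : CellExt C} (b : Branching Γ) where
  fst : (free Γ).cat.Cell
  snd : (free Γ).cat.Cell
  src_fst : (free Γ).face true b.fst = (free Γ).face false fst
  src_snd : (free Γ).face true b.snd = (free Γ).face false snd
  tgt_eq : (free Γ).face true fst = (free Γ).face true snd

/-- Termination and confluence. -/
def Convergent (Γ : CellExt C) : Prop :=
  Terminating Γ ∧ ∀ b : Branching Γ, Nonempty (Confluence b)

namespace Branching

variable {Γ : CellExt C}

/-- Branchings are considered up to exchange of their two cells. -/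
def swap (b : Branching Γ) : Branching Γ := ⟨b.snd, b.fst, b.src_eq.symm⟩

/-- A branching is local when it consists of two cells of size `1`. -/
def Local (b : Branching Γ) : Prop := size b.fst = 1 ∧ size b.snd = 1

/-- Local Peiffer branchings `(f ⋆ᵢ v, u ⋆ᵢ g)`, where `u` and `v` are the sources of `f` and
`g`. -/
def Peiffer (b : Branching Γ) : Prop :=
  ∃ (i : ℕ) (_ : i < n) (f g : (free Γ).cat.Cell)
    (h : (free Γ).cat.bd true i f = (free Γ).cat.bd false i ((free Γ).ι ((free Γ).face false g)))
    (h' : (free Γ).cat.bd true i ((free Γ).ι ((free Γ).face false f)) =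
      (free Γ).cat.bd false i g),
    size f = 1 ∧ size g = 1 ∧
    b.fst = (free Γ).cat.comp i f ((free Γ).ι ((free Γ).face false g)) h ∧
    b.snd = (free Γ).cat.comp i ((free Γ).ι ((free Γ).face false f)) g h'

/-- Overlapping branchings are the local branchings that are neither aspherical nor Peiffer. -/
def Overlapping (b : Branching Γ) : Prop :=
  b.Local ∧ b.fst ≠ b.snd ∧ ¬ b.Peiffer ∧ ¬ b.swap.Peiffer

/-- `b ⊑ b'`: the branching `b'` is obtained from `b` by the action of a whisker, that is, by
successive compositions with cells of `C` on either side. -/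
inductive Le (b : Branching Γ) : Branching Γ → Prop
  | refl : Le b b
  | left (i : ℕ) (hi : i < n) (w : C.Cell) (b' : Branching Γ) (h h' he) : Le b b' →
      Le b ⟨(free Γ).cat.comp i ((free Γ).ι w) b'.fst h,
        (free Γ).cat.comp i ((free Γ).ι w) b'.snd h', he⟩
  | right (i : ℕ) (hi : i < n) (w : C.Cell) (b' : Branching Γ) (h h' he) : Le b b' →
      Le b ⟨(free Γ).cat.comp i b'.fst ((free Γ).ι w) h,
        (free Γ).cat.comp i b'.snd ((free Γ).ι w) h', he⟩

/-- Critical branchings are the overlapping branchings that are minimal for `⊑`. -/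
def Critical (b : Branching Γ) : Prop :=
  b.Overlapping ∧ ∀ b' : Branching Γ, b'.Le b → b.Le b'

end Branching

/-- A choice of a family of generating confluences for the critical branchings of `E`: exactly one
confluence for each critical branching, the branchings `(f, g)` and `(g, f)` being identified. -/
structure GenConfluences (E : CellExt C) where
  branchings : Set (Branching E)
  critical : ∀ b ∈ branchings, b.Critical
  total : ∀ b : Branching E, b.Critical → b ∈ branchings ∨ b.swap ∈ branchings
  once : ∀ b ∈ branchings, b.swap ∉ branchings
  conf : ∀ b : branchings, Confluence b.1

theorem ExtHom.map_seq {D D' : ExtCat C} (F : ExtHom D D') (f g : D.cat.Cell) (h h') :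
    F.map (D.seq f g h) = D'.seq (F.map f) (F.map g) h' := F.map_comp _ _ _ _ _

/-- The coherent completion of `E` associated with a family of generating confluences: for each
critical branching `(e, e')` with its confluence `(e₁, e₁')`, a square with identities as horizontal
cells and with vertical cells `e ⋆ₙ e₁` and `e' ⋆ₙ e₁'`. -/
noncomputable def GenConfluences.squares {E : CellExt C} (K : GenConfluences E) (H : ExtCat C) :
    SqExt (freeGpd E) H where
  Gen := K.branchings
  sq b :=
    { top := H.ι ((free E).face false b.1.fst)
      bot := H.ι ((free E).face true (K.conf b).fst)
      left := (toGpd E).map ((free E).seq b.1.fst (K.conf b).fst (K.conf b).src_fst)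
      right := (toGpd E).map ((free E).seq b.1.snd (K.conf b).snd (K.conf b).src_snd)
      nw := by rw [H.face_ι, (toGpd E).face_map, (free E).face_false_seq]
      ne := by rw [H.face_ι, (toGpd E).face_map, (free E).face_false_seq, b.1.src_eq]
      sw := by rw [H.face_ι, (toGpd E).face_map, (free E).face_true_seq]
      se := by rw [H.face_ι, (toGpd E).face_map, (free E).face_true_seq, (K.conf b).tgt_eq] }

/-! ### Polygraphs modulo -/

/-- The elements `(e, f, e')` of `ₑRₑ`: `e` and `e'` are cells of `C(E)`, `f` is a cell of size `1`
of `C[R]`, and they are composable. -/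
structure EREGen (R E : CellExt C) where
  pre : (freeGpd E).cat.Cell
  mid : (free R).cat.Cell
  post : (freeGpd E).cat.Cell
  size_mid : size mid = 1
  pre_mid : (freeGpd E).face true pre = (free R).face false mid
  mid_post : (free R).face true mid = (freeGpd E).face false post

/-- The cellular extension `ₑRₑ`. -/
noncomputable def ere (R E : CellExt C) : CellExt C where
  Gen := EREGen R E
  bd α γ := cond α ((freeGpd E).face true γ.post) ((freeGpd E).face false γ.pre)
  sphere α i γ hi := by
    simp only [cond_true, cond_false]
    rw [(freeGpd E).face_parallel α false true _ hi, γ.pre_mid,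
      (free R).face_parallel α false true _ hi, γ.mid_post,
      (freeGpd E).face_parallel α false true _ hi]

/-- The inclusion of `R` in `ₑRₑ`. -/
noncomputable def ereOfRule (R E : CellExt C) (ρ : R.Gen) : (ere R E).Gen where
  pre := (freeGpd E).ι (R.bd false ρ)
  mid := freeGen ρ
  post := (freeGpd E).ι (R.bd true ρ)
  size_mid := rfl
  pre_mid := (freeGpd E).face_ι _ _
  mid_post := ((freeGpd E).face_ι _ _).symm

/-- The sub-extension of a cellular extension consisting of the generating cells in `S`. -/
def CellExt.sub (Γ : CellExt C) (S : Set Γ.Gen) : CellExt C where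
  Gen := S
  bd α γ := Γ.bd α γ.1
  sphere α _ γ hi := Γ.sphere α γ.1 hi

end Rewriting

/-- An `(n+1)`-polygraph modulo `(R, E, S)`: `base` is the `n`-polygraph `(R₀, …, Rₙ)`, the
primary rules `R` and the modulo rules `E` are cellular extensions of the free `n`-category on it,
and `S` is a cellular extension with `R ⊆ S ⊆ ₑRₑ`. -/
structure PolygraphModulo (n : ℕ) : Type (u + 1) where
  base : Polygraph.{u} n
  R : CellExt base.free
  E : CellExt base.free
  S : Set (ere R E).Gen
  R_subset : ∀ ρ : R.Gen, ereOfRule R E ρ ∈ S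

namespace PolygraphModulo

variable {n : ℕ} (P : PolygraphModulo.{u} n)

/-- The rules of `S`, as a cellular extension. -/
noncomputable def rules : CellExt P.base.free := (ere P.R P.E).sub P.S

/-- The `(n+1,n)`-category `E^⊤`. -/
noncomputable def Etop : ExtCat P.base.free := freeGpd P.E

/-- The free `(n+1)`-category `S^*`. -/
noncomputable def Sstar : ExtCat P.base.free := free P.rules

/-- The free `(n+1,n)`-category `S^⊤`. -/
noncomputable def Stop : ExtCat P.base.free := freeGpd P.rules

/-- The canonical functor `S^* → S^⊤`. -/
noncomputable def starToTop : ExtHom P.Sstar P.Stop := toGpd P.rules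

/-- The free `(n+1)`-category `R^*(E)` on the rules of `R` and `E`, those of `E` being invertible. -/
noncomputable def RE : ExtCat P.base.free := freeInv P.R P.E

/-- The canonical functor `E^⊤ → R^*(E)`. -/
noncomputable def EtopToRE : ExtHom P.Etop P.RE :=
  freeInvLift _ PEmpty.elim (fun _ γ => γ.elim) (invGen _) (invGen' _) (face_invGen _)
    (isInv_invGen _)

/-- A generating cell of `R`, as a cell of `R^*(E)`. -/
noncomputable def REgen (ρ : P.R.Gen) : P.RE.cat.Cell :=
  FreeCell.mk (InvRel P.R P.E) (Term.gen (Γ := P.R.withInv P.E) (Sum.inl ρ))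

/-- The canonical functor `R^* → R^*(E)`. -/
noncomputable def RstarToRE : ExtHom (free P.R) P.RE :=
  freeLift _ P.REgen (by rintro (_ | _) γ <;> rfl)

/-- The triple `(e, f, e')` underlying a rule of `S`. -/
def triple (γ : P.rules.Gen) : EREGen P.R P.E := γ.1

/-- The canonical functor `S^* → R^*(E)`, that sends a rule `(e, f, e')` to the composite
`e ⋆ₙ f ⋆ₙ e'`. -/
noncomputable def SstarToRE : ExtHom P.Sstar P.RE :=
  have h₁ : ∀ γ, P.RE.face true (P.EtopToRE.map (P.triple γ).pre) =
      P.RE.face false (P.RstarToRE.map (P.triple γ).mid) := fun γ =>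
    (P.EtopToRE.face_map _ _).trans ((P.triple γ).pre_mid.trans (P.RstarToRE.face_map _ _).symm)
  have h₂ : ∀ γ, P.RE.face true (P.RstarToRE.map (P.triple γ).mid) =
      P.RE.face false (P.EtopToRE.map (P.triple γ).post) := fun γ =>
    (P.RstarToRE.face_map _ _).trans ((P.triple γ).mid_post.trans (P.EtopToRE.face_map _ _).symm)
  freeLift _
    (fun γ => P.RE.seq (P.RE.seq (P.EtopToRE.map (P.triple γ).pre)
      (P.RstarToRE.map (P.triple γ).mid) (h₁ γ))
      (P.EtopToRE.map (P.triple γ).post) ((P.RE.face_true_seq _ _ _).trans (h₂ γ)))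
    (by
      rintro (_ | _) γ
      · exact (P.RE.face_false_seq _ _ _).trans ((P.RE.face_false_seq _ _ _).trans
          (P.EtopToRE.face_map _ _))
      · exact (P.RE.face_true_seq _ _ _).trans (P.EtopToRE.face_map _ _))

/-- The data defining an element of `E ⋊ Γ`: a square `A` of `Γ` with horizontal cells `f`, `g` and
left vertical cell `e`, and cells `e₁`, `e₂` of `E^⊤`, with `e₁`, `e`, `e₂` composable, such that
the composites `e₁ f` and `e₂⁻ g` of `R^*(E)` are given by cells `top` and `bot` of `S^*`. -/
structure BiactionData (Γ : SqExt P.Etop P.Sstar) where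
  A : Γ.Gen
  e₁ : P.Etop.cat.Cell
  e₂ : P.Etop.cat.Cell
  e₂' : P.Etop.cat.Cell
  inv : P.Etop.IsInv e₂ e₂'
  comp₁ : P.Etop.face true e₁ = P.Etop.face false (Γ.sq A).left
  comp₂ : P.Etop.face true (Γ.sq A).left = P.Etop.face false e₂
  top : P.Sstar.cat.Cell
  bot : P.Sstar.cat.Cell
  comp_top : P.RE.face true (P.EtopToRE.map e₁) = P.RE.face false (P.SstarToRE.map (Γ.sq A).top)
  comp_bot : P.RE.face true (P.EtopToRE.map e₂') = P.RE.face false (P.SstarToRE.map (Γ.sq A).bot)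
  top_eq : P.SstarToRE.map top =
    P.RE.seq (P.EtopToRE.map e₁) (P.SstarToRE.map (Γ.sq A).top) comp_top
  bot_eq : P.SstarToRE.map bot =
    P.RE.seq (P.EtopToRE.map e₂') (P.SstarToRE.map (Γ.sq A).bot) comp_bot

/-- The square extension `E ⋊ Γ` of `(E^⊤, S^*)`, consisting of the squares with horizontal cells
`e₁ f` and `e₂⁻ g`, left vertical cell `e₁ e e₂` and right vertical cell `e'`. -/
noncomputable def biaction (Γ : SqExt P.Etop P.Sstar) : SqExt P.Etop P.Sstar where
  Gen := P.BiactionData Γ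
  sq x :=
    { top := x.top
      bot := x.bot
      left := P.Etop.seq (P.Etop.seq x.e₁ (Γ.sq x.A).left x.comp₁) x.e₂
        ((P.Etop.face_true_seq _ _ _).trans x.comp₂)
      right := (Γ.sq x.A).right
      nw := by
        rw [← P.SstarToRE.face_map, x.top_eq, P.RE.face_false_seq, P.EtopToRE.face_map,
          P.Etop.face_false_seq, P.Etop.face_false_seq]
      ne := by
        rw [← P.SstarToRE.face_map, x.top_eq, P.RE.face_true_seq, P.SstarToRE.face_map,
          (Γ.sq x.A).ne]
      sw := by
        rw [← P.SstarToRE.face_map, x.bot_eq, P.RE.face_false_seq, P.EtopToRE.face_map,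
          P.Etop.face_true_seq, x.inv.tgt]
      se := by
        rw [← P.SstarToRE.face_map, x.bot_eq, P.RE.face_true_seq, P.SstarToRE.face_map,
          (Γ.sq x.A).se] }

/-- The square extension `E ⋊ Γ ∪ Peiffer(E^⊤, S^*)` of `(E^⊤, S^*)`. -/
noncomputable def completed (Γ : SqExt P.Etop P.Sstar) : SqExt P.Etop P.Sstar :=
  (P.biaction Γ).union (peiffer P.Etop P.Sstar)

/-- `S` is `Γ`-confluent modulo `E`: for each branching `(f, e, g)` of `S` modulo `E`, where `f` is
not an identity, there are `f'`, `g'` in `S^*`, `e'` in `E^⊤` and a square cell with boundary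
`(f f', g g', e, e')` in the free `n`-category enriched in double categories, with invertible
vertical cells, generated by `E ⋊ Γ ∪ Peiffer(E^⊤, S^*)`. -/
def GammaConfluent (Γ : SqExt P.Etop P.Sstar) : Prop :=
  ∀ (f g : P.Sstar.cat.Cell) (e : P.Etop.cat.Cell),
    P.Sstar.face false f = P.Etop.face false e → P.Etop.face true e = P.Sstar.face false g →
    ¬ P.Sstar.IsId f →
    ∃ (f' g' : P.Sstar.cat.Cell) (hf : P.Sstar.face true f = P.Sstar.face false f')
      (hg : P.Sstar.face true g = P.Sstar.face false g') (A : SqCell (P.completed Γ) False),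
      A.boundary.top = P.Sstar.seq f f' hf ∧ A.boundary.bot = P.Sstar.seq g g' hg ∧
        A.boundary.left = e

/-- `S` is `Γ`-diconvergent: it is `Γ`-confluent modulo `E`, the polygraph modulo `ₑRₑ` is
terminating, and `E` is convergent. -/
def GammaDiconvergent (Γ : SqExt P.Etop P.Sstar) : Prop :=
  P.GammaConfluent Γ ∧ Terminating (ere P.R P.E) ∧ Convergent P.E

/-- A set `X` of `n`-cells is `E`-normalizing with respect to `S`. -/
def ENormalizing (X : Set P.base.free.Cell) : Prop :=
  ∀ u ∈ X, (NF P.rules u ∩ Irr P.E).Nonempty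

end PolygraphModulo

end PolyMod

/-! The polygraph modulo has dimension `n + 1` here, so the composition `⋆_{n-1}` of the statement
is `⋆ₙ`, written `seq`. The proof joins a Squier theorem for `E` to a coherent Church-Rosser
property of `S` modulo `E`.

For `E`: call two cells of `E^⊤` equivalent (`SqExt.VEq`) when they are the vertical faces of a
fillable square with identities as horizontal faces. This is a congruence. The squares of `conf(E)`
make the critical branchings commute up to equivalence. A local branching is a whiskering of a
minimal one, which is aspherical, Peiffer or critical, so all local branchings are coherently
confluent (`Branching.Local.coherent`). The existence of minimal branchings rests on counting
generators, dimension by dimension (`Grading`). As `E` terminates, Newman's induction makes any two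
reductions of a cell to reduced cells equivalent (`veq_of_reduced`). Decomposing a cell of `E^⊤`
into a zigzag then shows that any two parallel cells of `E^⊤` are equivalent (`veq_of_parallel`).

For `S`: it inherits termination from `ₑRₑ`. Confluence modulo `E`, iterated along reductions, gives
the following: if `e` in `E^⊤` joins the sources of two reductions to `S`-reduced cells, then some
`e'` joins their targets and the resulting square is fillable (`ConfluentModulo.exists_filling`).
Reduced cells are thus unique only up to `E^⊤`. The same holds along zigzags of `S^⊤`
(`ConfluentModulo.exists_filling_gpd`).

Given an arbitrary square, reduce its four corners with respect to `S`. Each of its sides becomes a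
face of a fillable square towards the reduced corners. Pasting these squares fills the given one,
except that two parallel cells of `E^⊤` between reduced corners have to be identified, which is the
coherence of `E` (`ConfluentModulo.acyclic`). -/

namespace PolyMod

/-! ### Whiskering, inverses, and decomposition of cells into elementary ones. -/

section Cells

variable {n : ℕ} {C : NCat.{u} n}

namespace ExtCat

variable (D : ExtCat C)

/-- Exchange law applied to `f = f ⋆ₙ 1` and `g = 1 ⋆ₙ g`. Compositions below dimension `n` are
therefore expressible by whiskering and `⋆ₙ`, which is why closure under these two operations
suffices later on. -/
theorem comp_eq_seq {i : ℕ} (hi : i < n) (f g : D.cat.Cell) (h h₁ h₂ h₃) :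
    D.cat.comp i f g h = D.seq (D.cat.comp i f (D.ι (D.face false g)) h₁)
      (D.cat.comp i (D.ι (D.face true f)) g h₂) h₃ := by
  have e₁ : D.face true f = D.face false (D.ι (D.face true f)) := (D.face_ι _ _).symm
  have e₂ : D.face true (D.ι (D.face false g)) = D.face false g := D.face_ι _ _
  have a₁ : D.seq f (D.ι (D.face true f)) e₁ = f := D.seq_id _ _ _ rfl
  have a₂ : D.seq (D.ι (D.face false g)) g e₂ = g := D.id_seq _ _ _ rfl
  refine (D.cat.comp_congr a₁.symm a₂.symm h (by rw [a₁, a₂]; exact h)).trans ?_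
  exact D.cat.exchange _ _ _ _ _ _ _ _ _ _ hi

theorem face_whisker_left (α : Bool) {i : ℕ} (hi : i < n) (w : C.Cell) (f : D.cat.Cell) (h h') :
    D.face α (D.cat.comp i (D.ι w) f h) = C.comp i w (D.face α f) h' :=
  (D.face_comp α hi _ _ _ (by rw [D.face_ι]; exact h')).trans
    (C.comp_congr (D.face_ι _ _) rfl _ _)

theorem face_whisker_right (α : Bool) {i : ℕ} (hi : i < n) (w : C.Cell) (f : D.cat.Cell) (h h') :
    D.face α (D.cat.comp i f (D.ι w) h) = C.comp i (D.face α f) w h' :=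
  (D.face_comp α hi _ _ _ (by rw [D.face_ι]; exact h')).trans
    (C.comp_congr rfl (D.face_ι _ _) _ _)

/-- For `i < n` the `n`-source and the `n`-target of a cell have the same `i`-boundary, so
composability can be tested on whichever face `β` is convenient. -/
theorem left_bd {i : ℕ} (hi : i < n) {w : C.Cell} {f : D.cat.Cell}
    (h : D.cat.bd true i (D.ι w) = D.cat.bd false i f) (β : Bool) :
    C.bd true i w = C.bd false i (D.face β f) := by
  have := (D.bd_iff hi _ _ false β).1 h
  rwa [D.face_ι] at this

theorem right_bd {i : ℕ} (hi : i < n) {w : C.Cell} {f : D.cat.Cell}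
    (h : D.cat.bd true i f = D.cat.bd false i (D.ι w)) (β : Bool) :
    C.bd true i (D.face β f) = C.bd false i w := by
  have := (D.bd_iff hi _ _ β false).1 h
  rwa [D.face_ι] at this

theorem bd_seq_left {i : ℕ} (hi : i < n) {f g : D.cat.Cell} (h) (α : Bool) :
    D.cat.bd α i (D.seq f g h) = D.cat.bd α i f := by
  rw [D.bd_eq α false _ hi, D.face_false_seq, ← D.bd_eq α false _ hi]

theorem bd_seq_right {i : ℕ} (hi : i < n) {f g : D.cat.Cell} (h) (α : Bool) :
    D.cat.bd α i (D.seq f g h) = D.cat.bd α i g := by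
  rw [D.bd_eq α true _ hi, D.face_true_seq, ← D.bd_eq α true _ hi]

/-- Exchange law, after writing the whisker as `1 ⋆ₙ 1`. -/
theorem whisker_left_seq {i : ℕ} (hi : i < n) (w : C.Cell) (f g : D.cat.Cell) (h h' h₁ h₂ h₃) :
    D.cat.comp i (D.ι w) (D.seq f g h) h' =
      D.seq (D.cat.comp i (D.ι w) f h₁) (D.cat.comp i (D.ι w) g h₂) h₃ := by
  have e : D.face true (D.ι w) = D.face false (D.ι w) := by rw [D.face_ι, D.face_ι]
  refine (D.cat.comp_congr (D.ι_seq_ι w e).symm rfl h' (by rw [D.ι_seq_ι]; exact h')).trans ?_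
  exact D.cat.exchange _ _ _ _ _ _ _ _ _ _ hi

theorem whisker_right_seq {i : ℕ} (hi : i < n) (w : C.Cell) (f g : D.cat.Cell) (h h' h₁ h₂ h₃) :
    D.cat.comp i (D.seq f g h) (D.ι w) h' =
      D.seq (D.cat.comp i f (D.ι w) h₁) (D.cat.comp i g (D.ι w) h₂) h₃ := by
  have e : D.face true (D.ι w) = D.face false (D.ι w) := by rw [D.face_ι, D.face_ι]
  refine (D.cat.comp_congr rfl (D.ι_seq_ι w e).symm h' (by rw [D.ι_seq_ι]; exact h')).trans ?_
  exact D.cat.exchange _ _ _ _ _ _ _ _ _ _ hi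

theorem ι_comp' {i : ℕ} (x y : C.Cell) (h) (h') :
    D.cat.comp i (D.ι x) (D.ι y) h = D.ι (C.comp i x y h') := (D.ι_comp i x y h' h).symm

theorem isInv_ι (x : C.Cell) : D.IsInv (D.ι x) (D.ι x) where
  tgt := by rw [D.face_ι, D.face_ι]
  src := by rw [D.face_ι, D.face_ι]
  right := (D.ι_seq_ι x _).trans (by rw [D.face_ι])
  left := (D.ι_seq_ι x _).trans (by rw [D.face_ι])

theorem IsInv.symm {f g : D.cat.Cell} (h : D.IsInv f g) : D.IsInv g f :=
  ⟨h.src, h.tgt, h.left.trans (congrArg _ h.tgt), h.right.trans (congrArg _ h.src.symm)⟩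

theorem IsInv.seq {f g f' g' : D.cat.Cell} (h : D.IsInv f g) (h' : D.IsInv f' g') (e e') :
    D.IsInv (D.seq f f' e) (D.seq g' g e') := by
  -- Stated for arbitrary inverse pairs: the left inverse law is the same computation for the
  -- swapped pairs.
  have key : ∀ {f g f' g' : D.cat.Cell} (h : D.IsInv f g) (h' : D.IsInv f' g') (e e' e''),
      D.seq (D.seq f f' e) (D.seq g' g e') e'' = D.ι (D.face false f) := by
    intro f g f' g' h h' e e' e''
    have a₁ : D.face true f' = D.face false (D.seq g' g e') := by
      rw [D.face_false_seq, h'.tgt]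
    have a₂ : D.face true f = D.face false (D.seq f' (D.seq g' g e') a₁) := by
      rw [D.face_false_seq, e]
    have a₃ : D.face true (D.seq f' g' h'.tgt) = D.face false g := by
      rw [D.face_true_seq, e']
    rw [D.seq_assoc _ _ _ _ _ a₁ a₂]
    have : D.seq f' (D.seq g' g e') a₁ = g := by
      rw [← D.seq_assoc _ _ _ h'.tgt a₃]
      have b : D.face true (D.ι (D.face false f')) = D.face false g := by
        rw [D.face_ι, ← e, h.tgt]
      rw [D.seq_congr h'.right rfl _ b]
      exact D.id_seq _ _ _ (e.symm.trans h.tgt)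
    rw [D.seq_congr rfl this _ h.tgt, h.right]
  refine ⟨?_, ?_, ?_, ?_⟩
  · rw [D.face_true_seq, D.face_false_seq, h'.tgt]
  · rw [D.face_true_seq, D.face_false_seq, h.src]
  · rw [key h h', D.face_false_seq]
  · rw [key (h'.symm) (h.symm), D.face_true_seq, h'.tgt]

theorem IsInv.bd {f g : D.cat.Cell} (h : D.IsInv f g) {i : ℕ} (hi : i < n) (α : Bool) :
    D.cat.bd α i f = D.cat.bd α i g := by
  rw [D.bd_eq α true _ hi, h.tgt, ← D.bd_eq α false _ hi]

/-- The exchange law reduces the composite of `f ⋆ᵢ f'` and `g ⋆ᵢ g'` to the two inverse laws.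
Unlike for `⋆ₙ`, the order of the factors is not reversed. -/
theorem IsInv.star {f g f' g' : D.cat.Cell} (h : D.IsInv f g) (h' : D.IsInv f' g') {i : ℕ}
    (hi : i < n) (e e') : D.IsInv (D.cat.comp i f f' e) (D.cat.comp i g g' e') := by
  have key : ∀ {f g f' g' : D.cat.Cell} (h : D.IsInv f g) (h' : D.IsInv f' g') (e e' k),
      D.seq (D.cat.comp i f f' e) (D.cat.comp i g g' e') k =
        D.ι (D.face false (D.cat.comp i f f' e)) := by
    intro f g f' g' h h' e e' k
    have b := (D.bd_iff hi _ _ false false).1 e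
    have b' : D.cat.bd true i (D.seq f g h.tgt) = D.cat.bd false i (D.seq f' g' h'.tgt) := by
      rw [D.bd_seq_left hi, D.bd_seq_left hi, e]
    refine (D.cat.exchange (i := i) (j := n) f g f' g' (D.seq_aux h.tgt) (D.seq_aux h'.tgt)
      e e' b' (D.seq_aux k) hi).symm.trans ?_
    rw [D.face_comp _ hi _ _ _ b, D.ι_comp i _ _ b (by rw [← D.ι_bd, ← D.ι_bd, b])]
    exact D.cat.comp_congr h.right h'.right _ _
  have t₁ := (D.bd_iff hi _ _ true true).1 e
  have t₂ := (D.bd_iff hi _ _ true true).1 e'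
  have s₁ := (D.bd_iff hi _ _ false false).1 e
  have s₂ := (D.bd_iff hi _ _ false false).1 e'
  have ht : D.face true (D.cat.comp i f f' e) = D.face false (D.cat.comp i g g' e') := by
    rw [D.face_comp _ hi _ _ _ t₁, D.face_comp _ hi _ _ _ s₂]
    exact C.comp_congr h.tgt h'.tgt _ _
  have hs : D.face true (D.cat.comp i g g' e') = D.face false (D.cat.comp i f f' e) := by
    rw [D.face_comp _ hi _ _ _ t₂, D.face_comp _ hi _ _ _ s₁]
    exact C.comp_congr h.src h'.src _ _
  exact ⟨ht, hs, key h h' _ _ _, (key h.symm h'.symm _ _ _).trans (congrArg _ ht.symm)⟩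

/-- The closure of a class of cells under identities and `⋆ₙ`-composition. -/
inductive Chain (W : D.cat.Cell → Prop) : D.cat.Cell → Prop
  | id (x : C.Cell) : Chain W (D.ι x)
  | of (f : D.cat.Cell) : W f → Chain W f
  | seq (f g : D.cat.Cell) (h) : Chain W f → Chain W g → Chain W (D.seq f g h)

/-- A class of cells is stable by whiskering when it is closed under the action of `C`. -/
structure WhiskerStable (W : D.cat.Cell → Prop) : Prop where
  left : ∀ {i : ℕ} (_ : i < n) (w : C.Cell) (f : D.cat.Cell) (h), W f →
    W (D.cat.comp i (D.ι w) f h)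
  right : ∀ {i : ℕ} (_ : i < n) (w : C.Cell) (f : D.cat.Cell) (h), W f →
    W (D.cat.comp i f (D.ι w) h)

/-- Whiskering distributes over `⋆ₙ` and sends identities to identities, so it can be pushed to the
elementary factors. -/
theorem WhiskerStable.chain {W : D.cat.Cell → Prop} (hW : D.WhiskerStable W) :
    D.WhiskerStable (D.Chain W) where
  left := by
    intro i hi w f h hf
    induction hf with
    | id x =>
      rw [D.ι_comp' _ _ _ (by simpa only [D.face_ι] using D.left_bd hi h false)]
      exact .id _
    | of f hf => exact .of _ (hW.left hi w f h hf)
    | seq f g k _ _ ihf ihg =>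
      have h₁ := h.trans (D.bd_seq_left hi k false)
      have h₂ := h.trans (D.bd_seq_right hi k false)
      rw [D.whisker_left_seq hi w f g k h h₁ h₂ (by
        rw [D.face_whisker_left _ hi _ _ _ (D.left_bd hi h₁ true),
          D.face_whisker_left _ hi _ _ _ (D.left_bd hi h₂ false)]
        exact C.comp_congr rfl k _ _)]
      exact .seq _ _ _ (ihf _) (ihg _)
  right := by
    intro i hi w f h hf
    induction hf with
    | id x =>
      rw [D.ι_comp' _ _ _ (by simpa only [D.face_ι] using D.right_bd hi h false)]
      exact .id _
    | of f hf => exact .of _ (hW.right hi w f h hf)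
    | seq f g k _ _ ihf ihg =>
      have h₁ := (D.bd_seq_left hi k true).symm.trans h
      have h₂ := (D.bd_seq_right hi k true).symm.trans h
      rw [D.whisker_right_seq hi w f g k h h₁ h₂ (by
        rw [D.face_whisker_right _ hi _ _ _ (D.right_bd hi h₁ true),
          D.face_whisker_right _ hi _ _ _ (D.right_bd hi h₂ false)]
        exact C.comp_congr k rfl _ _)]
      exact .seq _ _ _ (ihf _) (ihg _)

/-- By `comp_eq_seq`, a lower composite is a `⋆ₙ`-composite of two whiskered chains. -/
theorem WhiskerStable.chain_star {W : D.cat.Cell → Prop} (hW : D.WhiskerStable W) {i : ℕ}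
    (hi : i < n) {f g : D.cat.Cell} (h) (hf : D.Chain W f) (hg : D.Chain W g) :
    D.Chain W (D.cat.comp i f g h) := by
  have b := fun α β => (D.bd_iff hi f g α β).1 h
  rw [D.comp_eq_seq hi f g h (D.whisker_right hi _ _ false (b _ _))
    (D.whisker_left hi _ _ false (b _ _)) (by
      rw [D.face_whisker_right _ hi _ _ _ (b _ _), D.face_whisker_left _ hi _ _ _ (b _ _)])]
  exact .seq _ _ _ (hW.chain.right hi _ _ _ hf) (hW.chain.left hi _ _ _ hg)

/-- A cell in a chain is an identity or factors through a first cell of the class. -/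
theorem Chain.cases_first {W : D.cat.Cell → Prop} {f : D.cat.Cell} (hf : D.Chain W f) :
    D.IsId f ∨ ∃ f₁ f₂ h, W f₁ ∧ f = D.seq f₁ f₂ h := by
  induction hf with
  | id x => exact .inl ⟨x, rfl⟩
  | of f hf =>
    exact .inr ⟨f, D.ι (D.face true f), (D.face_ι _ _).symm, hf, (D.seq_id _ _ _ rfl).symm⟩
  | seq f g h _ _ ihf ihg =>
    rcases ihf with ⟨x, rfl⟩ | ⟨f₁, f₂, k, hf₁, rfl⟩
    -- The first factor is an identity and disappears: a first elementary cell has to be sought in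
    -- `g`.
    · rwa [D.id_seq x g h ((D.face_ι _ _).symm.trans h)]
    · have a : D.face true f₂ = D.face false g := by rw [← h, D.face_true_seq]
      exact .inr ⟨f₁, D.seq f₂ g a, by rw [D.face_false_seq, k], hf₁, D.seq_assoc _ _ _ _ _ _ _⟩

theorem IsId.eq {f : D.cat.Cell} (h : D.IsId f) (α : Bool) : f = D.ι (D.face α f) := by
  obtain ⟨x, rfl⟩ := h
  rw [D.face_ι]

end ExtCat

/-- The cell of `freeMod r` given by a generating cell. -/
def modGen {Γ : CellExt C} (r : TermRel Γ) (γ : Γ.Gen) : (freeMod r).cat.Cell :=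
  FreeCell.mk r (Term.gen γ)

/-- This lemma and the next one turn the constructors of `Term` into compositions of cells, so that
an induction on representatives proves statements about cells. -/
theorem freeMod_mk_seq {Γ : CellExt C} (r : TermRel Γ) {x y y' z : C.Cell} (a : Term Γ x y)
    (b : Term Γ y' z) (h : y = y') :
    (FreeCell.mk r (a.seq b h) : FreeCell r) =
      (freeMod r).seq (FreeCell.mk r a) (FreeCell.mk r b) h :=
  (FreeCell.comp_mk_self a b
    ((freeMod r).seq_aux (f := FreeCell.mk r a) (g := FreeCell.mk r b) h) h).symm

theorem freeMod_mk_star {Γ : CellExt C} (r : TermRel Γ) {i : ℕ} (hi : i < n) {x y x' y' : C.Cell}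
    (a : Term Γ x y) (b : Term Γ x' y') (h h') :
    ∃ k, (FreeCell.mk r (Term.star i hi a b h h') : FreeCell r) =
      (freeMod r).cat.comp i (FreeCell.mk r a) (FreeCell.mk r b) k := by
  have k := ((freeMod r).bd_iff hi (FreeCell.mk r a) (FreeCell.mk r b) false false).2 h
  exact ⟨k, (FreeCell.comp_mk_of_lt hi a b k h h').symm⟩

/-- Every cell of a free category modulo relations is a chain of cells of any stable class that
contains the generating cells. -/
theorem freeMod_chain {Γ : CellExt C} {r : TermRel Γ} {W : (freeMod r).cat.Cell → Prop}
    (hW : (freeMod r).WhiskerStable W) (hgen : ∀ γ, W (modGen r γ)) (f : (freeMod r).cat.Cell) :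
    (freeMod r).Chain W f := by
  induction f using FreeCell.ind with
  | h x y a =>
  induction a with
  | id x => exact .id x
  | gen γ => exact .of _ (hgen γ)
  | seq a b h iha ihb =>
    rw [freeMod_mk_seq]
    exact .seq _ _ _ iha ihb
  | star i hi a b h h' iha ihb =>
    obtain ⟨k, e⟩ := freeMod_mk_star r hi a b h h'
    rw [e]
    exact hW.chain_star _ hi k iha ihb

/-- Generators are invertible by the defining relations, and invertibility passes to identities and
to all composites. -/
theorem freeInv_exists_inv (E : CellExt C) (f : (freeGpd E).cat.Cell) :
    ∃ g, (freeGpd E).IsInv f g := by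
  induction f using FreeCell.ind with
  | h x y a =>
  induction a with
  | id x => exact ⟨_, (freeGpd E).isInv_ι x⟩
  | gen γ =>
    rcases γ with γ | γ | γ
    · exact γ.elim
    · exact ⟨_, isInv_invGen _ γ⟩
    · exact ⟨_, (isInv_invGen _ γ).symm⟩
  | seq a b h iha ihb =>
    obtain ⟨g, hg⟩ := iha
    obtain ⟨g', hg'⟩ := ihb
    rw [freeMod_mk_seq]
    exact ⟨_, hg.seq _ hg' h (hg'.src.trans (h.symm.trans hg.tgt))⟩
  | star i hi a b h h' iha ihb =>
    obtain ⟨g, hg⟩ := iha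
    obtain ⟨g', hg'⟩ := ihb
    obtain ⟨k, e⟩ := freeMod_mk_star (InvRel (CellExt.empty C) E) hi a b h h'
    rw [e]
    exact ⟨_, hg.star _ hg' hi k ((hg.bd _ hi true).symm.trans (k.trans (hg'.bd _ hi false)))⟩

/-! ### Sizes -/

theorem size_ι {Γ : CellExt C} (x : C.Cell) : size ((free Γ).ι x) = 0 := rfl

theorem size_comp {Γ : CellExt C} {i : ℕ} (hi : i ≤ n) (f g : (free Γ).cat.Cell) (h) :
    size ((free Γ).cat.comp i f g h) = size f + size g := by
  induction f using FreeCell.ind with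
  | h x y a =>
  induction g using FreeCell.ind with
  | h x' y' b =>
  rcases hi.lt_or_eq with hi | rfl
  · exact congrArg size (FreeCell.comp_mk_of_lt (r := TermRel.none Γ) hi a b h
      (FreeCell.face_of_bd hi h false false) (FreeCell.face_of_bd hi h true true))
  · exact congrArg size (FreeCell.comp_mk_self (r := TermRel.none Γ) a b h
      (FreeCell.face_of_bd_self h))

theorem size_seq {Γ : CellExt C} (f g : (free Γ).cat.Cell) (h) :
    size ((free Γ).seq f g h) = size f + size g := size_comp le_rfl _ _ _

theorem free_whiskerStable (Γ : CellExt C) : (free Γ).WhiskerStable (fun f => size f = 1) where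
  left hi w f h hf := by rw [size_comp hi.le, size_ι, hf]
  right hi w f h hf := by rw [size_comp hi.le, size_ι, hf]

/-- A cell of `C[Γ]` is an identity or starts with a cell of size `1`. -/
theorem free_cases_first {Γ : CellExt C} (f : (free Γ).cat.Cell) :
    (free Γ).IsId f ∨ ∃ f₁ f₂ h, size f₁ = 1 ∧ f = (free Γ).seq f₁ f₂ h :=
  (freeMod_chain (free_whiskerStable Γ) (fun _ => rfl) f).cases_first

/-- Size is additive, and a cell that is not an identity starts with a factor of size `1`.
Non-identity thereby becomes a numerical condition that survives composition. -/
theorem isId_iff_size {Γ : CellExt C} (f : (free Γ).cat.Cell) :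
    (free Γ).IsId f ↔ size f = 0 := by
  constructor
  · rintro ⟨x, rfl⟩; rfl
  · intro h
    rcases free_cases_first f with hf | ⟨f₁, f₂, k, h₁, rfl⟩
    · exact hf
    · rw [size_seq] at h; omega

end Cells

end PolyMod

namespace PolyMod

/-! ### Gradings of polygraphs, and existence of minimal branchings. -/

section Gradings

/-- A grading of an `n`-category: `count x k` is additive for `⋆_i` when `i < k`, and a cell that is
not an `i`-cell has a nonzero highest count, in a degree `k > i`. On the free `n`-category on a
polygraph, `count x k` is the number of generating `k`-cells in the `k`-source of `x`. -/
structure Grading {n : ℕ} (C : NCat.{u} n) where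
  count : C.Cell → ℕ → ℕ
  count_comp : ∀ {i k : ℕ} (x y : C.Cell) (h), i < k →
    count (C.comp i x y h) k = count x k + count y k
  count_eq_zero : ∀ {k : ℕ} (x : C.Cell), n < k → count x k = 0
  exists_pos : ∀ {i : ℕ} (x : C.Cell), C.bd true i x ≠ x →
    ∃ k, i < k ∧ 0 < count x k ∧ ∀ j, k < j → count x j = 0

/-- The new top degree `n + 1` counts the generators of `Γ`; the lower degrees are read off the
source. A cell of size `0` is an identity, so its highest count is that of the `n`-cell below it. -/
theorem Grading.nonempty_free {n : ℕ} {C : NCat.{u} n} (G : Grading C) (Γ : CellExt C) :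
    Nonempty (Grading (free Γ).cat) := by
  refine ⟨⟨fun f k => if k = n + 1 then size f else G.count ((free Γ).face false f) k,
    ?_, ?_, ?_⟩⟩
  · intro i k f g h hik
    split_ifs with hk
    · exact size_comp (by omega) _ _ _
    · rcases Nat.lt_or_ge i n with hi | hi
      · have b := ((free Γ).bd_iff hi f g false false).1 h
        rw [(free Γ).face_comp _ hi _ _ _ b, G.count_comp _ _ _ hik]
      · rw [G.count_eq_zero _ (by omega), G.count_eq_zero _ (by omega),
          G.count_eq_zero _ (by omega)]
  · intro k f hk
    rw [if_neg (by omega), G.count_eq_zero _ (by omega)]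
  · intro i f hf
    -- Above dimension `n` every cell of the free category is its own boundary, contrary to `hf`.
    have hi : i ≤ n := by
      by_contra hi
      exact hf ((free Γ).cat.bd_of_le _ _ (by omega))
    rcases Nat.eq_zero_or_pos (size f) with h₀ | h₀
    · obtain ⟨x, rfl⟩ := (isId_iff_size f).2 h₀
      obtain ⟨k, hik, hk, hj⟩ := G.exists_pos x (i := i) (fun e => hf (by
        rw [← (free Γ).ι_bd, e]))
      have hkn : k ≤ n := by
        by_contra hkn
        rw [G.count_eq_zero _ (by omega)] at hk
        omega
      refine ⟨k, hik, ?_, fun j hkj => ?_⟩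
      · rw [if_neg (by omega), (free Γ).face_ι]
        exact hk
      · split_ifs
        · exact h₀
        · rw [(free Γ).face_ι]
          exact hj j hkj
    · refine ⟨n + 1, by omega, ?_, fun j hj => ?_⟩
      · rw [if_pos rfl]
        exact h₀
      · rw [if_neg (by omega), G.count_eq_zero _ (by omega)]

/-- Induction on the dimension. In a set every cell is its own boundary, so the zero counts satisfy
the positivity condition vacuously. -/
theorem polygraphAux_grading : ∀ (n : ℕ) (T : (polygraphAux.{u} n).1),
    Nonempty (Grading ((polygraphAux.{u} n).2 T))
  | 0, _ => ⟨⟨fun _ _ => 0, fun _ _ _ _ => rfl, fun _ _ => rfl, fun _ h => (h rfl).elim⟩⟩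
  | n + 1, T => by
    obtain ⟨G⟩ := polygraphAux_grading n T.1
    exact G.nonempty_free T.2

theorem Polygraph.exists_grading {n : ℕ} (P : Polygraph.{u} n) : Nonempty (Grading P.free) :=
  polygraphAux_grading n P

variable {n : ℕ} {C : NCat.{u} n}

theorem NCat.bd_eq_self {i : ℕ} {x : C.Cell} (α β : Bool) (h : C.bd α i x = x) :
    C.bd β i x = x := by
  rw [← h, C.bd_bd_of_le _ _ _ le_rfl]

namespace Branching

variable {E : CellExt C}

/-- The order on the degrees of the sources of branchings, the highest degree first. -/
def Smaller (G : Grading C) (b b' : Branching E) : Prop :=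
  ∃ k : Fin (n + 1),
    (∀ j : Fin (n + 1), k < j → G.count ((free E).face false b.fst) j =
      G.count ((free E).face false b'.fst) j) ∧
    G.count ((free E).face false b.fst) k < G.count ((free E).face false b'.fst) k

/-- Only the degrees `0, …, n` matter, so this is a lexicographic order on finitely many natural
numbers. -/
theorem wellFounded_smaller (G : Grading C) : WellFounded (Smaller G (E := E)) := by
  -- The order on the indices is reversed, so that the lexicographic comparison begins with the
  -- highest degree.
  have : IsStrictTotalOrder (Fin (n + 1)) (fun i j => j < i) :=
    inferInstanceAs (IsStrictTotalOrder (Fin (n + 1)) (Function.swap (· < ·)))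
  have wf : WellFounded (Pi.Lex (ι := Fin (n + 1)) (β := fun _ => ℕ) (fun i j => j < i)
      (fun {_} => (· < ·))) := Pi.Lex.wellFounded _ (fun _ => Nat.lt_wfRel.wf)
  exact InvImage.wf (fun (b : Branching E) (k : Fin (n + 1)) => G.count ((free E).face false b.fst) k) wf

/-- Compare at the highest degree `k` in which `w` has a generator. Above `k` the whisker adds
nothing, at `k` it adds something, and additivity applies because `i < k`. Degrees at most `i` are
not controlled, which is the reason for the lexicographic order. -/
theorem smaller_of_count (G : Grading C) {b b' : Branching E} {w : C.Cell} {i : ℕ}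
    (hw : C.bd true i w ≠ w)
    (h : ∀ k, i < k → G.count ((free E).face false b'.fst) k =
      G.count w k + G.count ((free E).face false b.fst) k) : Smaller G b b' := by
  obtain ⟨k, hik, hk, hj⟩ := G.exists_pos w hw
  have hkn : k ≤ n := by
    by_contra hkn
    rw [G.count_eq_zero _ (by omega)] at hk
    omega
  refine ⟨⟨k, by omega⟩, fun j hkj => ?_, ?_⟩
  · have hkj : k < j := hkj
    rw [h j (by omega), hj j hkj, zero_add]
  · have := h k hik
    dsimp only
    omega

theorem Smaller.trans {G : Grading C} {b b' b'' : Branching E} (h : Smaller G b b')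
    (h' : Smaller G b' b'') : Smaller G b b'' := by
  obtain ⟨k, hk, hlt⟩ := h
  obtain ⟨k', hk', hlt'⟩ := h'
  rcases lt_trichotomy k k' with e | rfl | e
  · exact ⟨k', fun j hj => (hk j (e.trans hj)).trans (hk' j hj), (hk k' e).trans_lt hlt'⟩
  · exact ⟨k, fun j hj => (hk j hj).trans (hk' j hj), hlt.trans hlt'⟩
  · exact ⟨k, fun j hj => (hk j hj).trans (hk' j (e.trans hj)), hlt.trans_eq (hk' k e)⟩

/-- A whisker for `⋆ᵢ` either is an `i`-cell, and acts trivially, or makes the source strictly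
larger. A strict step of `⊑` in the descending direction can thus be repeated only finitely often.
-/
theorem Le.eq_or_smaller (G : Grading C) {b b' : Branching E} (h : b.Le b') :
    b = b' ∨ Smaller G b b' := by
  induction h with
  | refl => exact .inl rfl
  | left i hi w b' h h' he _ ih =>
    -- If `w` is an `i`-cell, it is a unit for `⋆ᵢ` and the branching is unchanged.
    by_cases hw : C.bd true i w = w
    · have e : ∀ f : (free E).cat.Cell, (free E).cat.bd true i ((free E).ι w) =
          (free E).cat.bd false i f → (free E).ι w = (free E).cat.bd false i f := by
        intro f hf
        rw [← hf, ← (free E).ι_bd, hw]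
      have : b' = ⟨_, _, he⟩ :=
        Branching.ext ((free E).ι_star _ _ h (e _ h)).symm ((free E).ι_star _ _ h' (e _ h')).symm
      rwa [← this]
    · have key : Smaller G b' ⟨_, _, he⟩ := smaller_of_count G hw (fun k hk => by
        rw [(free E).face_whisker_left _ hi _ _ _ ((free E).left_bd hi h false),
          G.count_comp _ _ _ hk])
      rcases ih with rfl | ih
      · exact .inr key
      · exact .inr (ih.trans key)
  | right i hi w b' h h' he _ ih =>
    by_cases hw : C.bd true i w = w
    · have e : ∀ f : (free E).cat.Cell, (free E).cat.bd true i f =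
          (free E).cat.bd false i ((free E).ι w) → (free E).ι w = (free E).cat.bd true i f := by
        intro f hf
        rw [hf, ← (free E).ι_bd, NCat.bd_eq_self true false hw]
      have : b' = ⟨_, _, he⟩ :=
        Branching.ext ((free E).star_ι _ _ h (e _ h)).symm ((free E).star_ι _ _ h' (e _ h')).symm
      rwa [← this]
    · have key : Smaller G b' ⟨_, _, he⟩ := smaller_of_count G hw (fun k hk => by
        rw [(free E).face_whisker_right _ hi _ _ _ ((free E).right_bd hi h false),
          G.count_comp _ _ _ hk, add_comm])
      rcases ih with rfl | ih
      · exact .inr key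
      · exact .inr (ih.trans key)

theorem Le.trans {b b' b'' : Branching E} (h : b.Le b') (h' : b'.Le b'') : b.Le b'' := by
  induction h' with
  | refl => exact h
  | left i hi w b' h₁ h₂ he _ ih => exact .left i hi w b' h₁ h₂ he ih
  | right i hi w b' h₁ h₂ he _ ih => exact .right i hi w b' h₁ h₂ he ih

/-- Whiskers are identities of size `0`, so removing them preserves the sizes of the two cells. -/
theorem Le.local {b b' : Branching E} (h : b.Le b') (hb : b'.Local) : b.Local := by
  induction h with
  | refl => exact hb
  | left i hi w b' h h' he _ ih =>
    obtain ⟨h₁, h₂⟩ := hb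
    simp only [size_comp hi.le, size_ι, zero_add] at h₁ h₂
    exact ih ⟨h₁, h₂⟩
  | right i hi w b' h h' he _ ih =>
    obtain ⟨h₁, h₂⟩ := hb
    simp only [size_comp hi.le, size_ι, add_zero] at h₁ h₂
    exact ih ⟨h₁, h₂⟩

/-- Every branching is above a minimal one. -/
theorem exists_minimal (G : Grading C) (b : Branching E) :
    ∃ b₀ : Branching E, b₀.Le b ∧ ∀ b' : Branching E, b'.Le b₀ → b₀.Le b' := by
  induction b using (wellFounded_smaller G).induction with
  | h b ih =>
  by_cases hb : ∀ b' : Branching E, b'.Le b → b.Le b'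
  · exact ⟨b, .refl, hb⟩
  · push Not at hb
    obtain ⟨b', hle, hn⟩ := hb
    rcases hle.eq_or_smaller G with rfl | hs
    · exact (hn .refl).elim
    · obtain ⟨b₀, h₀, hmin⟩ := ih b' hs
      exact ⟨b₀, h₀.trans hle, hmin⟩

end Branching

/-! ### Reductions -/

theorem Terminating.wellFounded {E : CellExt C} (h : Terminating E) :
    WellFounded (fun v u => Reduces E u v) :=
  wellFounded_iff_isEmpty_descending_chain.2 ⟨fun f => h ⟨f.1, f.2⟩⟩

/-- Used repeatedly to see that a reduction issued from a reduced cell, for instance one produced by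
a confluence, is trivial. -/
theorem isId_of_mem_irr {E : CellExt C} {f : (free E).cat.Cell}
    (h : (free E).face false f ∈ Irr E) : (free E).IsId f := by
  by_contra hf
  exact h _ ⟨f, rfl, rfl, hf⟩

theorem eq_ι_of_mem_irr {E : CellExt C} {f : (free E).cat.Cell}
    (h : (free E).face false f ∈ Irr E) (α : Bool) : f = (free E).ι ((free E).face α f) :=
  (isId_of_mem_irr h).eq _ α

theorem not_isId_of_size_one {E : CellExt C} {f : (free E).cat.Cell} (h : size f = 1) :
    ¬ (free E).IsId f := by
  rw [isId_iff_size, h]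
  exact one_ne_zero

/-- Noetherian induction on `u`; the reductions found are composed along the way. -/
theorem exists_reduced {E : CellExt C} (hE : Terminating E) (u : C.Cell) :
    ∃ f : (free E).cat.Cell, (free E).face false f = u ∧ (free E).face true f ∈ Irr E := by
  induction u using hE.wellFounded.induction with
  | h u ih =>
  by_cases hu : u ∈ Irr E
  · exact ⟨(free E).ι u, (free E).face_ι _ _, by rwa [(free E).face_ι]⟩
  · simp only [Irr, Set.mem_ofPred_eq, not_forall, not_not] at hu
    obtain ⟨v, f, hf, hfv, hne⟩ := hu
    obtain ⟨g, hg, hirr⟩ := ih v ⟨f, hf, hfv, hne⟩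
    exact ⟨(free E).seq f g (hfv.trans hg.symm), by rw [(free E).face_false_seq, hf], by
      rwa [(free E).face_true_seq]⟩

end Gradings

end PolyMod

namespace PolyMod

/-! ### Fillable squares and the congruence they induce on vertical cells. -/

section Filling

variable {n : ℕ} {C : NCat.{u} n} {V H : ExtCat C}

/-- The square with faces `f`, `g`, `e`, `e'` is the boundary of a square cell of the free
`n`-category enriched in double groupoids generated by `Γ`. -/
def SqExt.Fillable (Γ : SqExt V H) (f g : H.cat.Cell) (e e' : V.cat.Cell) : Prop :=
  Nonempty (SqTerm Γ True f g e e')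

namespace SqExt.Fillable

variable {Γ : SqExt V H} {f g f' g' : H.cat.Cell} {e e' d d' : V.cat.Cell}

theorem of_union_left {Γ Δ : SqExt V H} (A : Γ.Gen) :
    (Γ.union Δ).Fillable (Γ.sq A).top (Γ.sq A).bot (Γ.sq A).left (Γ.sq A).right :=
  ⟨.gen (Γ := Γ.union Δ) (Sum.inl A)⟩

theorem of_union_right {Γ Δ : SqExt V H} (A : Δ.Gen) :
    (Γ.union Δ).Fillable (Δ.sq A).top (Δ.sq A).bot (Δ.sq A).left (Δ.sq A).right :=
  ⟨.gen (Γ := Γ.union Δ) (Sum.inr A)⟩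

theorem idH (f : H.cat.Cell) :
    Γ.Fillable f f (V.ι (H.face false f)) (V.ι (H.face true f)) := ⟨.idH f⟩

theorem incidence (h : Γ.Fillable f g e e') :
    H.face false f = V.face false e ∧ H.face true f = V.face false e' ∧
      H.face false g = V.face true e ∧ H.face true g = V.face true e' := h.some.incidence

theorem compV (A : Γ.Fillable f g e e') (B : Γ.Fillable f' g' e' d') (hf hg) :
    Γ.Fillable (H.seq f f' hf) (H.seq g g' hg) e d' := by
  obtain ⟨A⟩ := A
  obtain ⟨B⟩ := B
  exact ⟨.compV A B rfl hf hg⟩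

theorem compH (A : Γ.Fillable f g e e') (B : Γ.Fillable g g' d d') (he he') :
    Γ.Fillable f g' (V.seq e d he) (V.seq e' d' he') := by
  obtain ⟨A⟩ := A
  obtain ⟨B⟩ := B
  exact ⟨.compH A B rfl he he'⟩

theorem invH (A : Γ.Fillable f g e e') (h : V.IsInv e d) (h' : V.IsInv e' d') :
    Γ.Fillable g f d d' := by
  obtain ⟨A⟩ := A
  exact ⟨.invH A d d' h h'⟩

theorem invV (A : Γ.Fillable f g e e') (h : H.IsInv f f') (h' : H.IsInv g g') :
    Γ.Fillable f' g' e' e := by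
  obtain ⟨A⟩ := A
  exact ⟨.invV trivial A f' g' h h'⟩

end SqExt.Fillable

/-- The vertical cells `e` and `e'` are the vertical faces of a fillable square with identities as
horizontal faces. -/
def SqExt.VEq (Γ : SqExt V H) (e e' : V.cat.Cell) : Prop :=
  Γ.Fillable (H.ι (V.face false e)) (H.ι (V.face true e)) e e'

namespace SqExt.VEq

variable {Γ : SqExt V H} {e e' e'' d d' : V.cat.Cell}

theorem refl (e : V.cat.Cell) : Γ.VEq e e := ⟨.idV e⟩

theorem of_eq (h : e = e') : Γ.VEq e e' := h ▸ refl e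

/-- The incidence relations force `x` and `y` to be the faces of `e`, so the names of the horizontal
identities are irrelevant. -/
theorem of_fillable {x y : C.Cell} (h : Γ.Fillable (H.ι x) (H.ι y) e e') : Γ.VEq e e' := by
  obtain ⟨h₁, -, h₃, -⟩ := h.incidence
  rw [H.face_ι] at h₁ h₃
  subst h₁; subst h₃
  exact h

theorem face_eq (h : Γ.VEq e e') (α : Bool) : V.face α e = V.face α e' := by
  obtain ⟨-, h₂, -, h₄⟩ := h.incidence
  rw [H.face_ι] at h₂ h₄
  cases α <;> assumption

theorem fillable (h : Γ.VEq e e') {x y : C.Cell} (hx : x = V.face false e)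
    (hy : y = V.face true e) : Γ.Fillable (H.ι x) (H.ι y) e e' := by
  subst hx; subst hy
  exact h

/-- Identities are their own inverses, so the `⋄ᵛ`-inverse of the square only exchanges its vertical
faces. -/
theorem symm (h : Γ.VEq e e') : Γ.VEq e' e :=
  of_fillable (h.invV (H.isInv_ι _) (H.isInv_ι _))

/-- The two squares are pasted by `⋄ᵛ`, along the common vertical face `e'`; the horizontal faces
remain identities. -/
theorem trans (h : Γ.VEq e e') (h' : Γ.VEq e' e'') : Γ.VEq e e'' := by
  have := h.compV (h'.fillable (h.face_eq false) (h.face_eq true))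
    (by rw [H.face_ι, H.face_ι]) (by rw [H.face_ι, H.face_ι])
  rw [H.ι_seq_ι, H.ι_seq_ι] at this
  exact of_fillable this

theorem seq (h : Γ.VEq e e') (h' : Γ.VEq d d') (k k') : Γ.VEq (V.seq e d k) (V.seq e' d' k') :=
  of_fillable (h.compH (h'.fillable k rfl) k k')

/-- The filling is composed by `⋆ᵢ` with the identity square of `w`. -/
theorem whisker_left (h : Γ.VEq e e') {i : ℕ} (hi : i < n) (w : C.Cell) (k k') :
    Γ.VEq (V.cat.comp i (V.ι w) e k) (V.cat.comp i (V.ι w) e' k') := by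
  obtain ⟨A⟩ := h
  have h₁ := V.left_bd hi k false
  have h₂ := V.left_bd hi k true
  have a₁ : H.cat.bd true i (H.ι w) = H.cat.bd false i (H.ι (V.face false e)) := by
    rw [← H.ι_bd, ← H.ι_bd, h₁]
  have a₂ : H.cat.bd true i (H.ι w) = H.cat.bd false i (H.ι (V.face true e)) := by
    rw [← H.ι_bd, ← H.ι_bd, h₂]
  have B := SqTerm.star i hi (.idH (H.ι w)) A a₁ a₂ (by simpa only [H.face_ι] using k)
    (by simpa only [H.face_ι] using k')
  refine of_fillable (x := C.comp i w _ h₁) (y := C.comp i w _ h₂) ⟨?_⟩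
  rw [H.ι_comp i _ _ h₁ a₁, H.ι_comp i _ _ h₂ a₂]
  simp only [H.face_ι] at B
  exact B

theorem whisker_right (h : Γ.VEq e e') {i : ℕ} (hi : i < n) (w : C.Cell) (k k') :
    Γ.VEq (V.cat.comp i e (V.ι w) k) (V.cat.comp i e' (V.ι w) k') := by
  obtain ⟨A⟩ := h
  have h₁ := V.right_bd hi k false
  have h₂ := V.right_bd hi k true
  have a₁ : H.cat.bd true i (H.ι (V.face false e)) = H.cat.bd false i (H.ι w) := by
    rw [← H.ι_bd, ← H.ι_bd, h₁]
  have a₂ : H.cat.bd true i (H.ι (V.face true e)) = H.cat.bd false i (H.ι w) := by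
    rw [← H.ι_bd, ← H.ι_bd, h₂]
  have B := SqTerm.star i hi A (.idH (H.ι w)) a₁ a₂ (by simpa only [H.face_ι] using k)
    (by simpa only [H.face_ι] using k')
  refine of_fillable (x := C.comp i _ w h₁) (y := C.comp i _ w h₂) ⟨?_⟩
  rw [H.ι_comp i _ _ h₁ a₁, H.ι_comp i _ _ h₂ a₂]
  simp only [H.face_ι] at B
  exact B

/-- Compose both sides with the inverse of `d`, using that equivalence is a congruence for `⋆ₙ`. -/
theorem cancel_right (h : V.face true e = V.face false d) (h' : V.face true e' = V.face false d)
    (hd : V.IsInv d d') (k : Γ.VEq (V.seq e d h) (V.seq e' d h')) : Γ.VEq e e' := by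
  have key : ∀ (a : V.cat.Cell) (ha : V.face true a = V.face false d) (hb),
      V.seq (V.seq a d ha) d' hb = a := by
    intro a ha hb
    have e₁ : V.face true a = V.face false (V.ι (V.face false d)) := by rw [V.face_ι, ha]
    rw [V.seq_assoc _ _ _ _ _ hd.tgt (by rw [V.face_false_seq, ha]),
      V.seq_congr rfl hd.right _ e₁, V.seq_id _ _ _ ha.symm]
  have h₁ : V.face true (V.seq e d h) = V.face false d' := by rw [V.face_true_seq, hd.tgt]
  have h₂ : V.face true (V.seq e' d h') = V.face false d' := by rw [V.face_true_seq, hd.tgt]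
  have := k.seq (refl d') h₁ h₂
  rwa [key, key] at this

end SqExt.VEq

/-- The vertical faces of a fillable square can be replaced by equivalent cells. -/
theorem SqExt.Fillable.congr_vertical {Γ : SqExt V H} {f g : H.cat.Cell} {e e' d d' : V.cat.Cell}
    (h : Γ.Fillable f g e e') (he : Γ.VEq d e) (he' : Γ.VEq e' d') : Γ.Fillable f g d d' := by
  obtain ⟨h₁, h₂, h₃, h₄⟩ := h.incidence
  have a₁ := he.face_eq false
  have a₂ := he.face_eq true
  -- The squares witnessing the two equivalences are glued to the left and to the right of the given
  -- one; their horizontal faces, being identities, leave `f` and `g` unchanged.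
  have A := he.fillable (h₁.trans a₁.symm) (h₃.trans a₂.symm)
  have B := he'.fillable h₂ h₄
  have := (A.compV h (H.face_ι _ _) (H.face_ι _ _)).compV B
    (by rw [H.face_true_seq, H.face_ι]) (by rw [H.face_true_seq, H.face_ι])
  rwa [H.seq_id _ _ _ (H.face_true_seq _ _ _).symm, H.seq_id _ _ _ (H.face_true_seq _ _ _).symm,
    H.id_seq _ _ _ rfl, H.id_seq _ _ _ rfl] at this

end Filling

/-! ### Coherence of the modulo rules -/

section Coherence

variable {n : ℕ} {C : NCat.{u} n} {E : CellExt C} {H : ExtCat C}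

/-- The exchange law with the identities on the other sides: `g` acts first. Comparison with
`comp_eq_seq` is the commutation of Peiffer branchings. -/
theorem ExtCat.comp_eq_seq' (D : ExtCat C) {i : ℕ} (hi : i < n) (f g : D.cat.Cell) (h h₁ h₂ h₃) :
    D.cat.comp i f g h = D.seq (D.cat.comp i (D.ι (D.face false f)) g h₁)
      (D.cat.comp i f (D.ι (D.face true g)) h₂) h₃ := by
  have e₁ : D.face true (D.ι (D.face false f)) = D.face false f := D.face_ι _ _
  have e₂ : D.face true g = D.face false (D.ι (D.face true g)) := (D.face_ι _ _).symm
  have a₁ : D.seq (D.ι (D.face false f)) f e₁ = f := D.id_seq _ _ _ rfl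
  have a₂ : D.seq g (D.ι (D.face true g)) e₂ = g := D.seq_id _ _ _ rfl
  refine (D.cat.comp_congr a₁.symm a₂.symm h (by rw [a₁, a₂]; exact h)).trans ?_
  exact D.cat.exchange _ _ _ _ _ _ _ _ _ _ hi

namespace Branching

/-- The branching `b` has a confluence that bounds a fillable square. -/
def Coherent (Γ : SqExt (freeGpd E) H) (b : Branching E) : Prop :=
  ∃ c : Confluence b, Γ.VEq ((toGpd E).map ((free E).seq b.fst c.fst c.src_fst))
    ((toGpd E).map ((free E).seq b.snd c.snd c.src_snd))

variable {Γ : SqExt (freeGpd E) H} {b b' : Branching E}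

theorem Coherent.swap (h : b.Coherent Γ) : b.swap.Coherent Γ := by
  obtain ⟨c, hc⟩ := h
  exact ⟨⟨c.snd, c.fst, c.src_snd, c.src_fst, c.tgt_eq.symm⟩, hc.symm⟩

theorem coherent_of_eq (h : b.fst = b.snd) : b.Coherent Γ := by
  refine ⟨⟨(free E).ι ((free E).face true b.fst), (free E).ι ((free E).face true b.fst),
    ((free E).face_ι _ _).symm, ?_, rfl⟩, .of_eq (congrArg _ ?_)⟩
  · rw [(free E).face_ι, h]
  · exact (free E).seq_congr h rfl _ _

/-- Performing `f` then `g`, or `g` then `f`, gives `f ⋆ᵢ g` in both cases. The two sides are equal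
cells of `C[E]`, so an identity square fills the confluence and no generating square is needed. -/
theorem Peiffer.coherent (h : b.Peiffer) : b.Coherent Γ := by
  obtain ⟨i, hi, f, g, h₁, h₂, -, -, hf, hg⟩ := h
  -- Composability is given for the sources; below dimension `n` it then holds for every choice of
  -- faces of `f` and `g`.
  have k := fun β β' => ((free E).bd_iff hi f g β β').1
    (((free E).bd_iff hi _ _ false false).2 (by
      have := (free E).right_bd hi h₁ false
      exact this))
  have l₁ := (free E).whisker_left hi ((free E).face true f) g false (k true false)
  have l₂ := (free E).whisker_right hi f ((free E).face true g) false (k false true)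
  have m₁ : (free E).face true b.fst = (free E).face false ((free E).cat.comp i _ g l₁) := by
    rw [hf, (free E).face_whisker_right _ hi _ _ _ (k _ _),
      (free E).face_whisker_left _ hi _ _ _ (k _ _)]
  have m₂ : (free E).face true b.snd = (free E).face false ((free E).cat.comp i f _ l₂) := by
    rw [hg, (free E).face_whisker_right _ hi _ _ _ (k _ _),
      (free E).face_whisker_left _ hi _ _ _ (k _ _)]
  have m₃ : (free E).face true ((free E).cat.comp i _ g l₁) =
      (free E).face true ((free E).cat.comp i f _ l₂) := by
    rw [(free E).face_whisker_right _ hi _ _ _ (k _ _),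
      (free E).face_whisker_left _ hi _ _ _ (k _ _)]
  refine ⟨⟨_, _, m₁, m₂, m₃⟩, .of_eq (congrArg _ ?_)⟩
  dsimp only
  have kb := ((free E).bd_iff hi f g false false).2 (k _ _)
  have n₁ := m₁
  have n₂ := m₂
  rw [hf] at n₁
  rw [hg] at n₂
  rw [(free E).seq_congr hf rfl m₁ n₁, (free E).seq_congr hg rfl m₂ n₂,
    ← (free E).comp_eq_seq hi f g kb, ← (free E).comp_eq_seq' hi f g kb]

/-- The confluence and its filling are whiskered along with the branching: whiskering distributes
over `⋆ₙ`, commutes with `toGpd`, and preserves the equivalence of vertical cells. -/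
theorem Coherent.of_le (h : b.Coherent Γ) (hle : b.Le b') : b'.Coherent Γ := by
  induction hle with
  | refl => exact h
  | left i hi w b' k k' he _ ih =>
    obtain ⟨c, hc⟩ := ih
    have t : ∀ {f g : (free E).cat.Cell} (_ : (free E).face true f = (free E).face false g)
        (_ : (free E).cat.bd true i ((free E).ι w) = (free E).cat.bd false i f),
        C.bd true i w = C.bd false i ((free E).face false g) :=
      fun p q => (p ▸ (free E).left_bd hi q true :)
    have l₁ := (free E).whisker_left hi w c.fst false (t c.src_fst k)
    have l₂ := (free E).whisker_left hi w c.snd false (t c.src_snd k')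
    have m₁ : (free E).face true ((free E).cat.comp i ((free E).ι w) b'.fst k) =
        (free E).face false ((free E).cat.comp i _ _ l₁) := by
      rw [(free E).face_whisker_left _ hi _ _ _ ((free E).left_bd hi k _),
        (free E).face_whisker_left _ hi _ _ _ ((free E).left_bd hi l₁ _)]
      exact C.comp_congr rfl c.src_fst _ _
    have m₂ : (free E).face true ((free E).cat.comp i ((free E).ι w) b'.snd k') =
        (free E).face false ((free E).cat.comp i _ _ l₂) := by
      rw [(free E).face_whisker_left _ hi _ _ _ ((free E).left_bd hi k' _),
        (free E).face_whisker_left _ hi _ _ _ ((free E).left_bd hi l₂ _)]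
      exact C.comp_congr rfl c.src_snd _ _
    have m₃ : (free E).face true ((free E).cat.comp i _ _ l₁) =
        (free E).face true ((free E).cat.comp i _ _ l₂) := by
      rw [(free E).face_whisker_left _ hi _ _ _ ((free E).left_bd hi l₁ _),
        (free E).face_whisker_left _ hi _ _ _ ((free E).left_bd hi l₂ _)]
      exact C.comp_congr rfl c.tgt_eq _ _
    refine ⟨⟨_, _, m₁, m₂, m₃⟩, ?_⟩
    dsimp only
    have s₁ := k.trans ((free E).bd_seq_left hi c.src_fst false).symm
    have s₂ := k'.trans ((free E).bd_seq_left hi c.src_snd false).symm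
    rw [← (free E).whisker_left_seq hi w _ _ c.src_fst s₁ k l₁ m₁,
      ← (free E).whisker_left_seq hi w _ _ c.src_snd s₂ k' l₂ m₂]
    -- Passage to the free groupoid commutes with whiskering; the composability proof in the target
    -- is supplied together with the equality.
    have key : ∀ (f : (free E).cat.Cell) (s), ∃ s',
        (toGpd E).map ((free E).cat.comp i ((free E).ι w) f s) =
          (freeGpd E).cat.comp i ((freeGpd E).ι w) ((toGpd E).map f) s' := by
      intro f s
      have s' := (freeGpd E).whisker_left hi w ((toGpd E).map f) false (by
        rw [(toGpd E).face_map]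
        exact (free E).left_bd hi s false)
      exact ⟨s', (toGpd E).map_comp _ _ _ _ s'⟩
    obtain ⟨q₁, e₁⟩ := key _ s₁
    obtain ⟨q₂, e₂⟩ := key _ s₂
    rw [e₁, e₂]
    exact hc.whisker_left hi w _ _
  | right i hi w b' k k' he _ ih =>
    obtain ⟨c, hc⟩ := ih
    have t : ∀ {f g : (free E).cat.Cell} (_ : (free E).face true f = (free E).face false g)
        (_ : (free E).cat.bd true i f = (free E).cat.bd false i ((free E).ι w)),
        C.bd true i ((free E).face false g) = C.bd false i w :=
      fun p q => (p ▸ (free E).right_bd hi q true :)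
    have l₁ := (free E).whisker_right hi c.fst w false (t c.src_fst k)
    have l₂ := (free E).whisker_right hi c.snd w false (t c.src_snd k')
    have m₁ : (free E).face true ((free E).cat.comp i b'.fst ((free E).ι w) k) =
        (free E).face false ((free E).cat.comp i _ _ l₁) := by
      rw [(free E).face_whisker_right _ hi _ _ _ ((free E).right_bd hi k _),
        (free E).face_whisker_right _ hi _ _ _ ((free E).right_bd hi l₁ _)]
      exact C.comp_congr c.src_fst rfl _ _
    have m₂ : (free E).face true ((free E).cat.comp i b'.snd ((free E).ι w) k') =
        (free E).face false ((free E).cat.comp i _ _ l₂) := by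
      rw [(free E).face_whisker_right _ hi _ _ _ ((free E).right_bd hi k' _),
        (free E).face_whisker_right _ hi _ _ _ ((free E).right_bd hi l₂ _)]
      exact C.comp_congr c.src_snd rfl _ _
    have m₃ : (free E).face true ((free E).cat.comp i _ _ l₁) =
        (free E).face true ((free E).cat.comp i _ _ l₂) := by
      rw [(free E).face_whisker_right _ hi _ _ _ ((free E).right_bd hi l₁ _),
        (free E).face_whisker_right _ hi _ _ _ ((free E).right_bd hi l₂ _)]
      exact C.comp_congr c.tgt_eq rfl _ _
    refine ⟨⟨_, _, m₁, m₂, m₃⟩, ?_⟩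
    dsimp only
    have s₁ := ((free E).bd_seq_left hi c.src_fst true).trans k
    have s₂ := ((free E).bd_seq_left hi c.src_snd true).trans k'
    rw [← (free E).whisker_right_seq hi w _ _ c.src_fst s₁ k l₁ m₁,
      ← (free E).whisker_right_seq hi w _ _ c.src_snd s₂ k' l₂ m₂]
    have key : ∀ (f : (free E).cat.Cell) (s), ∃ s',
        (toGpd E).map ((free E).cat.comp i f ((free E).ι w) s) =
          (freeGpd E).cat.comp i ((toGpd E).map f) ((freeGpd E).ι w) s' := by
      intro f s
      have s' := (freeGpd E).whisker_right hi ((toGpd E).map f) w false (by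
        rw [(toGpd E).face_map]
        exact (free E).right_bd hi s false)
      exact ⟨s', (toGpd E).map_comp _ _ _ _ s'⟩
    obtain ⟨q₁, e₁⟩ := key _ s₁
    obtain ⟨q₂, e₂⟩ := key _ s₂
    rw [e₁, e₂]
    exact hc.whisker_right hi w _ _

/-- If the critical branchings are coherently confluent, so are the local branchings. -/
theorem Local.coherent (G : Grading C) (hcrit : ∀ b : Branching E, b.Critical → b.Coherent Γ)
    (hb : b.Local) : b.Coherent Γ := by
  -- A minimal local branching that is neither aspherical nor Peiffer, in either order, is critical
  -- by definition.
  obtain ⟨b₀, hle, hmin⟩ := exists_minimal G b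
  refine Coherent.of_le ?_ hle
  by_cases h₁ : b₀.fst = b₀.snd
  · exact coherent_of_eq h₁
  by_cases h₂ : b₀.Peiffer
  · exact h₂.coherent
  by_cases h₃ : b₀.swap.Peiffer
  · exact (h₃.coherent (Γ := Γ)).swap
  exact hcrit _ ⟨⟨hle.local hb, h₁, h₂, h₃⟩, hmin⟩

end Branching

/-- The family contains only one of `b` and `b.swap`; in the second case the coherence is obtained
by exchanging the two sides. -/
theorem GenConfluences.coherent (K : GenConfluences E) {Γ : SqExt (freeGpd E) H}
    (hK : ∀ A, Γ.VEq ((K.squares H).sq A).left ((K.squares H).sq A).right) (b : Branching E)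
    (hb : b.Critical) : b.Coherent Γ := by
  rcases K.total b hb with h | h
  · exact ⟨K.conf ⟨b, h⟩, hK ⟨b, h⟩⟩
  · exact Branching.Coherent.swap (b := b.swap) ⟨K.conf ⟨b.swap, h⟩, hK ⟨b.swap, h⟩⟩

section Reduced

variable {Γ : SqExt (freeGpd E) H}

/-- Under coherent local confluence, any two reductions of a cell to reduced cells are equivalent. -/
theorem veq_of_reduced (hE : Terminating E)
    (hloc : ∀ b : Branching E, b.Local → b.Coherent Γ) {f g : (free E).cat.Cell}
    (hfg : (free E).face false f = (free E).face false g) (hf : (free E).face true f ∈ Irr E)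
    (hg : (free E).face true g ∈ Irr E) : Γ.VEq ((toGpd E).map f) ((toGpd E).map g) := by
  -- The common source is named so that noetherian induction can vary it together with `f` and `g`.
  obtain ⟨u, hu⟩ : ∃ u, (free E).face false f = u := ⟨_, rfl⟩
  induction u using hE.wellFounded.induction generalizing f g with
  | h u ih =>
  rcases free_cases_first f with h | ⟨f₁, f₂, k, hf₁, rfl⟩
  -- If `f` is an identity, the common source is reduced, hence `g` is the same identity.
  · have e := h.eq _ true
    have e' := h.eq _ false
    rw [← (free E).face_ι false ((free E).face true f), ← e, hfg] at hf
    have eg := eq_ι_of_mem_irr hf false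
    rw [← hfg, ← e'] at eg
    exact .of_eq (by rw [eg])
  rcases free_cases_first g with h | ⟨g₁, g₂, l, hg₁, rfl⟩
  · have e := h.eq _ true
    have e' := h.eq _ false
    rw [← (free E).face_ι false ((free E).face true g), ← e, ← hfg] at hg
    have ef := eq_ι_of_mem_irr hg false
    rw [hfg, ← e'] at ef
    exact .of_eq (by rw [ef])
  rw [(free E).face_false_seq] at hu hfg
  rw [(free E).face_true_seq] at hf hg
  rw [(free E).face_false_seq] at hfg
  -- The first steps form a local branching, which has a coherent confluence `c`; its target is then
  -- reduced further, by `r`.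
  obtain ⟨c, hc⟩ := hloc ⟨f₁, g₁, hfg⟩ ⟨hf₁, hg₁⟩
  have hcf : (free E).face true f₁ = (free E).face false c.fst := c.src_fst
  have hcg : (free E).face true g₁ = (free E).face false c.snd := c.src_snd
  obtain ⟨r, hr, hr'⟩ := exists_reduced hE ((free E).face true c.fst)
  have a₁ : (free E).face true c.fst = (free E).face false r := hr.symm
  have a₂ : (free E).face true c.snd = (free E).face false r := by rw [← c.tgt_eq, hr]
  -- Induction at the target of `f₁` compares `f₂` with the detour through `c` and `r`; the next
  -- step does the same at the target of `g₁`.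
  have i₁ := ih _ ⟨f₁, hu, k, not_isId_of_size_one hf₁⟩ (f := f₂) (g := (free E).seq c.fst r a₁)
    (by rw [(free E).face_false_seq, ← hcf, k]) hf (by rwa [(free E).face_true_seq]) rfl
  have i₂ := ih _ ⟨g₁, hfg.symm.trans hu, l, not_isId_of_size_one hg₁⟩ (f := g₂)
    (g := (free E).seq c.snd r a₂)
    (by rw [(free E).face_false_seq, ← hcg, l]) hg (by rwa [(free E).face_true_seq]) rfl
  have m : ∀ (p q : (free E).cat.Cell) (h), ∃ h', (toGpd E).map ((free E).seq p q h) =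
      (freeGpd E).seq ((toGpd E).map p) ((toGpd E).map q) h' := by
    intro p q h
    have h' : (freeGpd E).face true ((toGpd E).map p) = (freeGpd E).face false ((toGpd E).map q) := by
      rw [(toGpd E).face_map, (toGpd E).face_map, h]
    exact ⟨h', (toGpd E).map_seq _ _ _ _⟩
  have step : ∀ (p q q' : (free E).cat.Cell) (h h'), Γ.VEq ((toGpd E).map q) ((toGpd E).map q') →
      Γ.VEq ((toGpd E).map ((free E).seq p q h)) ((toGpd E).map ((free E).seq p q' h')) := by
    intro p q q' h h' hq
    obtain ⟨x, e⟩ := m p q h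
    obtain ⟨y, e'⟩ := m p q' h'
    rw [e, e']
    exact (SqExt.VEq.refl _).seq hq _ _
  have b₁ : (free E).face true f₁ = (free E).face false ((free E).seq c.fst r a₁) := by
    rw [(free E).face_false_seq, hcf]
  have b₂ : (free E).face true g₁ = (free E).face false ((free E).seq c.snd r a₂) := by
    rw [(free E).face_false_seq, hcg]
  have s₁ := step f₁ _ _ k b₁ i₁
  have s₂ := step g₁ _ _ l b₂ i₂
  -- The two detours differ by the filling of the local branching, followed by the common reduction
  -- `r`.
  have mid : Γ.VEq ((toGpd E).map ((free E).seq f₁ ((free E).seq c.fst r a₁) b₁))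
      ((toGpd E).map ((free E).seq g₁ ((free E).seq c.snd r a₂) b₂)) := by
    have d₁ : (free E).face true ((free E).seq f₁ c.fst hcf) = (free E).face false r := by
      rw [(free E).face_true_seq, a₁]
    have d₂ : (free E).face true ((free E).seq g₁ c.snd hcg) = (free E).face false r := by
      rw [(free E).face_true_seq, a₂]
    rw [← (free E).seq_assoc f₁ c.fst r hcf d₁, ← (free E).seq_assoc g₁ c.snd r hcg d₂]
    obtain ⟨x, e⟩ := m _ r d₁
    obtain ⟨y, e'⟩ := m _ r d₂
    rw [e, e']
    exact SqExt.VEq.seq hc (SqExt.VEq.refl _) _ _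
  exact s₁.trans (mid.trans s₂.symm)

end Reduced

end Coherence

end PolyMod

namespace PolyMod

/-! ### Zigzags of reductions and equivalence of parallel cells of the free groupoid. -/

section Groupoids

variable {n : ℕ} {C : NCat.{u} n} {E : CellExt C}

theorem toGpd_seq {f g : (free E).cat.Cell} (h : (free E).face true f = (free E).face false g) :
    (toGpd E).map ((free E).seq f g h) = (freeGpd E).seq ((toGpd E).map f) ((toGpd E).map g)
      (by rw [(toGpd E).face_map, (toGpd E).face_map, h]) :=
  (toGpd E).map_seq _ _ _ _

/-- The cells of `C(E)` that come from `C[E]`, and their inverses. -/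
def Directed (f : (freeGpd E).cat.Cell) : Prop :=
  (∃ p, f = (toGpd E).map p) ∨ ∃ p, (freeGpd E).IsInv ((toGpd E).map p) f

/-- Whiskering commutes with `toGpd` and, by `IsInv.star`, with taking inverses. -/
theorem directed_whiskerStable : (freeGpd E).WhiskerStable Directed where
  left := by
    intro i hi w f h hf
    rcases hf with ⟨p, rfl⟩ | ⟨p, hp⟩
    · have h' := (free E).whisker_left hi w p false (by
        rw [← (toGpd E).face_map]
        exact (freeGpd E).left_bd hi h false)
      exact .inl ⟨_, ((toGpd E).map_comp i _ p h' h).symm⟩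
    · have h' := (free E).whisker_left hi w p true (by
        rw [← (toGpd E).face_map, hp.tgt]
        exact (freeGpd E).left_bd hi h false)
      have k := h.trans (hp.bd _ hi false).symm
      refine .inr ⟨(free E).cat.comp i ((free E).ι w) p h', ?_⟩
      have e := (toGpd E).map_comp i _ p h' k
      rw [e]
      exact ((freeGpd E).isInv_ι w).star _ hp hi _ _
  right := by
    intro i hi w f h hf
    rcases hf with ⟨p, rfl⟩ | ⟨p, hp⟩
    · have h' := (free E).whisker_right hi p w false (by
        rw [← (toGpd E).face_map]
        exact (freeGpd E).right_bd hi h false)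
      exact .inl ⟨_, ((toGpd E).map_comp i p _ h' h).symm⟩
    · have h' := (free E).whisker_right hi p w true (by
        rw [← (toGpd E).face_map, hp.tgt]
        exact (freeGpd E).right_bd hi h false)
      have k := (hp.bd _ hi true).trans h
      refine .inr ⟨(free E).cat.comp i p ((free E).ι w) h', ?_⟩
      have e := (toGpd E).map_comp i p _ h' k
      rw [e]
      exact hp.star _ ((freeGpd E).isInv_ι w) hi _ _

/-- Every cell of `C(E)` is a zigzag of cells of `C[E]`. -/
theorem freeGpd_chain (f : (freeGpd E).cat.Cell) : (freeGpd E).Chain Directed f := by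
  refine freeMod_chain directed_whiskerStable ?_ f
  rintro (γ | γ | γ)
  · exact γ.elim
  · exact .inl ⟨freeGen γ, rfl⟩
  · exact .inr ⟨freeGen γ, isInv_invGen _ γ⟩

theorem ExtCat.IsInv.cancel_left {D : ExtCat C} {p q : D.cat.Cell} (h : D.IsInv p q)
    (f : D.cat.Cell) (h₁ h₂) : D.seq p (D.seq q f h₁) h₂ = f := by
  have a : D.face true (D.ι (D.face false p)) = D.face false f := by
    rw [D.face_ι, ← h₁, h.src]
  rw [← D.seq_assoc _ _ _ h.tgt (by rw [D.face_true_seq, h₁]), D.seq_congr h.right rfl _ a]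
  exact D.id_seq _ _ _ (h.src.symm.trans h₁)

theorem ExtCat.IsInv.cancel_right {D : ExtCat C} {p q : D.cat.Cell} (h : D.IsInv p q)
    (f : D.cat.Cell) (h₁ h₂) : D.seq (D.seq f p h₁) q h₂ = f := by
  have a : D.face true f = D.face false (D.ι (D.face false p)) := by
    rw [D.face_ι, h₁]
  rw [D.seq_assoc _ _ _ _ _ h.tgt (by rw [D.face_false_seq, h₁]), D.seq_congr rfl h.right _ a]
  exact D.seq_id _ _ _ h₁.symm

variable {H : ExtCat C} {Γ : SqExt (freeGpd E) H}

/-- Under coherent local confluence, a cell of `C(E)` is compatible with reductions. -/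
theorem veq_seq_of_reduced (hE : Terminating E)
    (hloc : ∀ b : Branching E, b.Local → b.Coherent Γ) (e : (freeGpd E).cat.Cell)
    {p q : (free E).cat.Cell} (hp : (free E).face true p ∈ Irr E)
    (hq : (free E).face true q ∈ Irr E) (hpe : (freeGpd E).face false e = (free E).face false p)
    (h : (freeGpd E).face true e = (freeGpd E).face false ((toGpd E).map q)) :
    Γ.VEq ((toGpd E).map p) ((freeGpd E).seq e ((toGpd E).map q) h) := by
  have hc := freeGpd_chain e
  induction hc generalizing p q with
  | id x =>
    rw [(freeGpd E).face_ι, (toGpd E).face_map] at h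
    rw [(freeGpd E).face_ι] at hpe
    rw [(freeGpd E).id_seq _ _ _ (by rw [(toGpd E).face_map, h])]
    exact veq_of_reduced hE hloc (hpe.symm.trans h) hp hq
  | of e he =>
    rcases he with ⟨r, rfl⟩ | ⟨r, hr⟩
    -- A forward cell followed by `q` is itself a reduction from the source of `p`.
    · have h' := h
      rw [(toGpd E).face_map] at hpe h'
      rw [(toGpd E).face_map] at h'
      rw [← toGpd_seq h']
      exact veq_of_reduced hE hloc (by rw [(free E).face_false_seq, hpe]) hp
        (by rwa [(free E).face_true_seq])
    -- For the inverse of `r`, the reductions `r ⋆ₙ p` and `q` have the same source; composing their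
    -- equivalence with `e` on the left cancels `r`.
    · have h₁ : (free E).face true r = (free E).face false p := by
        rw [← hpe, ← hr.tgt, (toGpd E).face_map]
      have h₂ : (free E).face false r = (free E).face false q := by
        rw [← (toGpd E).face_map, ← hr.src, h, (toGpd E).face_map]
      have key := veq_of_reduced (Γ := Γ) hE hloc (f := (free E).seq r p h₁) (g := q)
        (by rw [(free E).face_false_seq, h₂]) (by rwa [(free E).face_true_seq]) hq
      have k₁ : (freeGpd E).face true e =
          (freeGpd E).face false ((toGpd E).map ((free E).seq r p h₁)) := by
        rw [h, (toGpd E).face_map, (toGpd E).face_map, (free E).face_false_seq, h₂]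
      have := (SqExt.VEq.refl e).seq key k₁ h
      have k₂ := k₁
      rw [toGpd_seq] at k₂
      rwa [(freeGpd E).seq_congr rfl (toGpd_seq h₁) k₁ k₂, hr.symm.cancel_left] at this
  | seq e₁ e₂ k _ _ ih₁ ih₂ =>
    -- A reduction of the middle cell serves as the target reduction for `e₁` and as the source
    -- reduction for `e₂`.
    obtain ⟨r, hr, hr'⟩ := exists_reduced hE ((freeGpd E).face true e₁)
    rw [(freeGpd E).face_false_seq] at hpe
    have l₁ : (freeGpd E).face true e₁ = (freeGpd E).face false ((toGpd E).map r) := by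
      rw [(toGpd E).face_map, hr]
    have l₂ : (freeGpd E).face true e₂ = (freeGpd E).face false ((toGpd E).map q) := by
      rw [← h, (freeGpd E).face_true_seq]
    have i₁ := ih₁ hp hr' hpe l₁
    have i₂ := ih₂ hr' hq (by rw [← k, hr]) l₂
    have l₃ : (freeGpd E).face true e₁ = (freeGpd E).face false ((freeGpd E).seq e₂ _ l₂) := by
      rw [(freeGpd E).face_false_seq, k]
    rw [(freeGpd E).seq_assoc _ _ _ _ _ l₂ l₃]
    exact i₁.trans ((SqExt.VEq.refl e₁).seq i₂ _ _)

/-- Under coherent local confluence, parallel cells of `C(E)` are equivalent. -/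
theorem veq_of_parallel (hE : Terminating E)
    (hloc : ∀ b : Branching E, b.Local → b.Coherent Γ) {e e' : (freeGpd E).cat.Cell}
    (h : ∀ α, (freeGpd E).face α e = (freeGpd E).face α e') : Γ.VEq e e' := by
  -- With `p` and `q` reducing the common source and the common target, both `e ⋆ₙ q` and `e' ⋆ₙ q`
  -- are equivalent to `p`; then `q` is cancelled.
  obtain ⟨p, hp, hp'⟩ := exists_reduced hE ((freeGpd E).face false e)
  obtain ⟨q, hq, hq'⟩ := exists_reduced hE ((freeGpd E).face true e)
  obtain ⟨q', hqq⟩ := freeInv_exists_inv E ((toGpd E).map q)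
  have l : (freeGpd E).face true e = (freeGpd E).face false ((toGpd E).map q) := by
    rw [(toGpd E).face_map, hq]
  have l' := (h true).symm.trans l
  have k := veq_seq_of_reduced (Γ := Γ) hE hloc e hp' hq' hp.symm l
  have k' := veq_seq_of_reduced (Γ := Γ) hE hloc e' hp' hq' ((h false).symm.trans hp.symm) l'
  exact SqExt.VEq.cancel_right l l' hqq (k.symm.trans k')

end Groupoids

/-! ### Transport of fillings and of termination along functors. -/

section Functoriality

variable {n : ℕ} {C : NCat.{u} n} {V H H' : ExtCat C}

theorem ExtHom.bd_iff {F : ExtHom H H'} {i : ℕ} (hi : i < n) {f g : H.cat.Cell}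
    (h : H.cat.bd true i f = H.cat.bd false i g) :
    H'.cat.bd true i (F.map f) = H'.cat.bd false i (F.map g) := by
  rw [H'.bd_iff hi _ _ false false, F.face_map, F.face_map]
  exact (H.bd_iff hi _ _ _ _).1 h

/-- A functor on horizontal cells preserves fillings. -/
theorem SqTerm.fillable_map (F : ExtHom H H') {Γ : SqExt V H} {Δ : SqExt V H'}
    (hgen : ∀ A, Δ.Fillable (F.map (Γ.sq A).top) (F.map (Γ.sq A).bot) (Γ.sq A).left (Γ.sq A).right)
    {f g : H.cat.Cell} {e e' : V.cat.Cell} (A : SqTerm Γ False f g e e') :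
    Δ.Fillable (F.map f) (F.map g) e e' := by
  have face : ∀ {f g : H.cat.Cell}, H.face true f = H.face false g →
      H'.face true (F.map f) = H'.face false (F.map g) := by
    intro f g h
    rw [F.face_map, F.face_map, h]
  induction A with
  | gen A => exact hgen A
  | idH f =>
    have := SqExt.Fillable.idH (Γ := Δ) (F.map f)
    rwa [F.face_map, F.face_map] at this
  | idV e =>
    rw [F.map_ι, F.map_ι]
    exact SqExt.VEq.refl e
  | compV A B h hf hg ihA ihB =>
    subst h
    rw [F.map_seq _ _ hf (face hf), F.map_seq _ _ hg (face hg)]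
    exact ihA.compV ihB _ _
  | compH A B h he he' ihA ihB =>
    subst h
    exact ihA.compH ihB _ _
  | star i hi A B hf hg he he' ihA ihB =>
    rw [F.map_comp _ _ _ hf (ExtHom.bd_iff hi hf), F.map_comp _ _ _ hg (ExtHom.bd_iff hi hg)]
    obtain ⟨A'⟩ := ihA
    obtain ⟨B'⟩ := ihB
    exact ⟨.star i hi A' B' _ _ _ _⟩
  | invH A d d' h h' ih => exact ih.invH h h'
  -- The formal composite lives in the version without `⋄ᵛ`-inverses.
  | invV h => exact h.elim

/-- Both sizes are additive and vanish on identities, so agreement on generators propagates to all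
chains. -/
theorem size_map {Γ Δ : CellExt C} (F : ExtHom (free Γ) (free Δ))
    (hF : ∀ γ, size (F.map (freeGen γ)) = 1) (f : (free Γ).cat.Cell) : size (F.map f) = size f := by
  have hW : (free Γ).WhiskerStable (fun f => size (F.map f) = size f) := by
    constructor
    · intro i hi w f h hf
      rw [F.map_comp _ _ _ h (ExtHom.bd_iff hi h), size_comp hi.le, size_comp hi.le, hf, F.map_ι,
        size_ι, size_ι]
    · intro i hi w f h hf
      rw [F.map_comp _ _ _ h (ExtHom.bd_iff hi h), size_comp hi.le, size_comp hi.le, hf, F.map_ι,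
        size_ι, size_ι]
  induction freeMod_chain hW hF f with
  | id x => rw [F.map_ι, size_ι, size_ι]
  | of f hf => exact hf
  | seq f g h _ _ ihf ihg =>
    rw [F.map_seq _ _ h (by rw [F.face_map, F.face_map, h]), size_seq, size_seq, ihf, ihg]

/-- The induced functor sends generators to generators, hence preserves size and non-identities; an
infinite reduction sequence of the sub-extension would be one of `Γ`. -/
theorem Terminating.sub {Γ : CellExt C} (h : Terminating Γ) (S : Set Γ.Gen) :
    Terminating (Γ.sub S) := by
  rintro ⟨u, hu⟩
  refine h ⟨u, fun k => ?_⟩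
  obtain ⟨f, hf, hf', hne⟩ := hu k
  let F : ExtHom (free (Γ.sub S)) (free Γ) :=
    freeLift (free Γ) (fun γ => freeGen γ.1) (by rintro (_ | _) γ <;> rfl)
  refine ⟨F.map f, by rw [F.face_map, hf], by rw [F.face_map, hf'], ?_⟩
  rwa [isId_iff_size, size_map F (fun _ => rfl), ← isId_iff_size]

end Functoriality

end PolyMod

namespace PolyMod

/-! ### Confluence modulo `E`, coherent Church-Rosser property, and acyclicity. -/

section Confluence

variable {n : ℕ} {C : NCat.{u} n} {E S : CellExt C} {Γ : SqExt (freeGpd E) (freeGpd S)}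

namespace SqExt

/-- Confluence modulo `E`: every branching of `S` modulo `E` whose first cell is not an identity
can be completed to a fillable square. -/
def ConfluentModulo (Γ : SqExt (freeGpd E) (freeGpd S)) : Prop :=
  ∀ (f g : (free S).cat.Cell) (e : (freeGpd E).cat.Cell),
    (free S).face false f = (freeGpd E).face false e →
    (freeGpd E).face true e = (free S).face false g → ¬ (free S).IsId f →
    ∃ (f' g' : (free S).cat.Cell) (hf : (free S).face true f = (free S).face false f')
      (hg : (free S).face true g = (free S).face false g') (e' : (freeGpd E).cat.Cell),
      Γ.Fillable ((toGpd S).map ((free S).seq f f' hf)) ((toGpd S).map ((free S).seq g g' hg)) e e'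

/-- Composition of two squares whose horizontal faces are positive. -/
theorem Fillable.seq_map {f g f' g' : (free S).cat.Cell} {e e' d : (freeGpd E).cat.Cell}
    (A : Γ.Fillable ((toGpd S).map f) ((toGpd S).map g) e e')
    (B : Γ.Fillable ((toGpd S).map f') ((toGpd S).map g') e' d)
    (hf : (free S).face true f = (free S).face false f')
    (hg : (free S).face true g = (free S).face false g') :
    Γ.Fillable ((toGpd S).map ((free S).seq f f' hf)) ((toGpd S).map ((free S).seq g g' hg))
      e d := by
  rw [toGpd_seq, toGpd_seq]
  exact A.compV B _ _

/-- The identity square of `p` is pasted on the left; the vertical identity is necessarily the one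
on the target of `p`. -/
theorem Fillable.prepend {f g : (free S).cat.Cell} {e : (freeGpd E).cat.Cell} {x : C.Cell}
    (p : (free S).cat.Cell)
    (A : Γ.Fillable ((toGpd S).map f) ((toGpd S).map g) ((freeGpd E).ι x) e)
    (hf : (free S).face true p = (free S).face false f)
    (hg : (free S).face true p = (free S).face false g) :
    Γ.Fillable ((toGpd S).map ((free S).seq p f hf)) ((toGpd S).map ((free S).seq p g hg))
      ((freeGpd E).ι ((free S).face false p)) e := by
  have hx : x = (free S).face true p := by
    have := A.incidence.1
    rw [(toGpd S).face_map, (freeGpd E).face_ι] at this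
    rw [hf, this]
  subst hx
  have B := Fillable.idH (Γ := Γ) ((toGpd S).map p)
  rw [(toGpd S).face_map, (toGpd S).face_map] at B
  exact B.seq_map A hf hg

/-- Confluence modulo yields a square whose upper target need not be reduced. When the lower side
has already reached a reduced cell, repeated confluence reduces the upper side alone, and
termination makes this stop. -/
theorem ConfluentModulo.exists_reduced_left (h : Γ.ConfluentModulo) (hS : Terminating S)
    {v : C.Cell} (hv : v ∈ Irr S) (w : C.Cell) (e : (freeGpd E).cat.Cell)
    (hw : (freeGpd E).face false e = w) (hev : (freeGpd E).face true e = v) :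
    ∃ (f : (free S).cat.Cell) (e' : (freeGpd E).cat.Cell), (free S).face false f = w ∧
      (free S).face true f ∈ Irr S ∧
      Γ.Fillable ((toGpd S).map f) ((toGpd S).map ((free S).ι v)) e e' := by
  induction w using hS.wellFounded.induction generalizing e with
  | h w ih =>
  by_cases hirr : w ∈ Irr S
  · refine ⟨(free S).ι w, e, (free S).face_ι _ _, by rwa [(free S).face_ι], ?_⟩
    rw [(toGpd S).map_ι, (toGpd S).map_ι]
    exact (VEq.refl e).fillable hw.symm hev.symm
  · simp only [Irr, Set.mem_ofPred_eq, not_forall, not_not] at hirr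
    obtain ⟨w₁, k, hk, -, hne⟩ := hirr
    -- Confluence is applied to a proper step `k` against the identity of `v`; its completion `g'`
    -- starts at the reduced cell `v`, hence is trivial.
    obtain ⟨k', g', hkk, hg, e₁, A⟩ := h k ((free S).ι v) e (hk.trans hw.symm)
      (by rw [(free S).face_ι, hev]) hne
    have hg' : (free S).face false g' = v := by rw [← hg, (free S).face_ι]
    have eg : g' = (free S).ι v := by
      rw [← hg']
      exact eq_ι_of_mem_irr (by rwa [hg']) false
    subst eg
    rw [(free S).ι_seq_ι] at A
    obtain ⟨i₁, i₂, i₃, i₄⟩ := A.incidence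
    rw [(toGpd S).face_map, (free S).face_true_seq] at i₂
    rw [(toGpd S).face_map, (free S).face_ι] at i₄
    -- The induction continues from the target of `k'`, which is strictly below `w` because `k`
    -- alone is already not an identity.
    obtain ⟨f, e₂, hf, hf', B⟩ := ih ((free S).face true k')
      ⟨(free S).seq k k' hkk, by rw [(free S).face_false_seq, hk], (free S).face_true_seq _ _ _, by
        rw [isId_iff_size] at hne ⊢
        rw [size_seq]
        omega⟩ e₁ i₂.symm i₄.symm
    have a : (free S).face true ((free S).seq k k' hkk) = (free S).face false f := by
      rw [(free S).face_true_seq, hf]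
    have AB := A.seq_map B a (by rw [(free S).face_ι, (free S).face_ι])
    rw [(free S).ι_seq_ι] at AB
    exact ⟨_, e₂, by rw [(free S).face_false_seq, (free S).face_false_seq, hk],
      by rwa [(free S).face_true_seq], AB⟩

/-- Noetherian induction on the source of `f`. Confluence modulo applies only when the upper cell is
not an identity; `hfg` excludes the case where only the upper cell is trivial, which is recovered
afterwards by symmetry. -/
theorem ConfluentModulo.exists_filling_aux (h : Γ.ConfluentModulo) (hS : Terminating S)
    {f g : (free S).cat.Cell} {e : (freeGpd E).cat.Cell}
    (hfg : (free S).IsId f → (free S).IsId g)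
    (hf : (free S).face false f = (freeGpd E).face false e)
    (hg : (free S).face false g = (freeGpd E).face true e)
    (hf' : (free S).face true f ∈ Irr S) (hg' : (free S).face true g ∈ Irr S) :
    ∃ e', Γ.Fillable ((toGpd S).map f) ((toGpd S).map g) e e' := by
  obtain ⟨u, hu⟩ : ∃ u, (free S).face false f = u := ⟨_, rfl⟩
  induction u using hS.wellFounded.induction generalizing f g e with
  | h u ih =>
  rcases free_cases_first f with hid | ⟨f₁, f₂, k, hsize, rfl⟩
  · refine ⟨e, ?_⟩
    rw [hid.eq _ false, (hfg hid).eq _ false, (toGpd S).map_ι, (toGpd S).map_ι]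
    exact (VEq.refl e).fillable hf hg
  rw [(free S).face_false_seq] at hf hu
  rw [(free S).face_true_seq] at hf'
  have hne := not_isId_of_size_one hsize
  -- Only the first step of `f` is confronted with the whole of `g`. As `g` ends at a reduced cell,
  -- its completion is trivial.
  obtain ⟨f₁', g₁', k₁, l₁, e₁, A⟩ := h f₁ g e hf hg.symm hne
  have eg : g₁' = (free S).ι ((free S).face true g) := by
    rw [l₁]
    exact eq_ι_of_mem_irr (by rwa [← l₁]) false
  subst eg
  rw [(free S).seq_id _ _ _ rfl] at A
  obtain ⟨-, i₂, -, i₄⟩ := A.incidence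
  rw [(toGpd S).face_map, (free S).face_true_seq] at i₂
  rw [(toGpd S).face_map] at i₄
  -- The completion `f₁'` is continued by `r` to a reduced cell, so that it becomes comparable with
  -- `f₂`.
  obtain ⟨r, e₂, hr, hr', B⟩ := h.exists_reduced_left hS hg' _ e₁ i₂.symm i₄.symm
  have a : (free S).face true ((free S).seq f₁ f₁' k₁) = (free S).face false r := by
    rw [(free S).face_true_seq, hr]
  have AB := A.seq_map B a (by rw [(free S).face_ι])
  have b : (free S).face true f₁ = (free S).face false ((free S).seq f₁' r hr.symm) := by
    rw [(free S).face_false_seq, k₁]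
  rw [(free S).seq_id _ _ _ rfl, (free S).seq_assoc _ _ _ _ _ hr.symm b] at AB
  -- Both `f₂` and `f₁' ⋆ₙ r` start at the target of `f₁`, so the induction applies with an identity
  -- of `E^⊤` as left side. If `f₂` is an identity, that source is reduced and the other cell is an
  -- identity too.
  obtain ⟨e₃, D⟩ := ih ((free S).face true f₁) ⟨f₁, hu, rfl, hne⟩ (f := f₂)
    (g := (free S).seq f₁' r hr.symm) (e := (freeGpd E).ι ((free S).face true f₁))
    (fun hid => by
      rw [hid.eq _ false, (free S).face_ι] at hf'
      refine isId_of_mem_irr ?_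
      rwa [← b, k])
    (by rw [(freeGpd E).face_ι, k]) (by rw [(freeGpd E).face_ι, b])
    hf' (by rwa [(free S).face_true_seq]) k.symm
  have D' := D.prepend f₁ k b
  have j₁ := D'.incidence.2.2.2
  have j₂ := AB.incidence.2.1
  -- The square from `f₁ ⋆ₙ f₂` to `f₁ ⋆ₙ f₁' ⋆ₙ r` is stacked on the one from there to `g`.
  have := D'.compH AB (by rw [(freeGpd E).face_ι, hf]) (j₁.symm.trans j₂)
  rw [(freeGpd E).id_seq _ _ _ hf] at this
  exact ⟨_, this⟩

/-- Coherent confluence modulo `E` for reductions to reduced cells. -/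
theorem ConfluentModulo.exists_filling (h : Γ.ConfluentModulo) (hS : Terminating S)
    {f g : (free S).cat.Cell} {e : (freeGpd E).cat.Cell}
    (hf : (free S).face false f = (freeGpd E).face false e)
    (hg : (free S).face false g = (freeGpd E).face true e)
    (hf' : (free S).face true f ∈ Irr S) (hg' : (free S).face true g ∈ Irr S) :
    ∃ e', Γ.Fillable ((toGpd S).map f) ((toGpd S).map g) e e' := by
  by_cases hfg : (free S).IsId f → (free S).IsId g
  · exact h.exists_filling_aux hS hfg hf hg hf' hg'
  · push Not at hfg
    -- Here `f` is an identity and `g` is not: the filling is built upside down along the inverse of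
    -- `e`, then turned over by the `⋄ʰ`-inverse.
    obtain ⟨d, hd⟩ := freeInv_exists_inv E e
    obtain ⟨e', A⟩ := h.exists_filling_aux hS (e := d) (fun hid => (hfg.2 hid).elim)
      (hg.trans hd.tgt) (hf.trans hd.src.symm) hg' hf'
    obtain ⟨d', hd'⟩ := freeInv_exists_inv E e'
    exact ⟨d', A.invH (ExtCat.IsInv.symm _ hd) hd'⟩

/-- A cell of `C(S)` is compatible with reductions to reduced cells, up to cells of `C(E)`. -/
theorem ConfluentModulo.exists_filling_gpd (h : Γ.ConfluentModulo) (hS : Terminating S)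
    (f : (freeGpd S).cat.Cell) {p q : (free S).cat.Cell}
    (hp : (free S).face true p ∈ Irr S) (hq : (free S).face true q ∈ Irr S)
    (hpf : (freeGpd S).face false f = (free S).face false p)
    (hqf : (freeGpd S).face true f = (freeGpd S).face false ((toGpd S).map q)) :
    ∃ e, Γ.Fillable ((toGpd S).map p) ((freeGpd S).seq f ((toGpd S).map q) hqf)
      ((freeGpd E).ι ((free S).face false p)) e := by
  have hc := freeGpd_chain f
  induction hc generalizing p q with
  | id x =>
    rw [(freeGpd S).face_ι, (toGpd S).face_map] at hqf
    rw [(freeGpd S).face_ι] at hpf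
    rw [(freeGpd S).id_seq _ _ _ (by rw [(toGpd S).face_map, hqf])]
    exact h.exists_filling hS (by rw [(freeGpd E).face_ι])
      (by rw [(freeGpd E).face_ι, ← hqf, hpf]) hp hq
  | of f hf =>
    rcases hf with ⟨r, rfl⟩ | ⟨r, hr⟩
    · have h' := hqf
      rw [(toGpd S).face_map] at hpf h'
      rw [(toGpd S).face_map] at h'
      rw [← toGpd_seq h']
      exact h.exists_filling hS (by rw [(freeGpd E).face_ι])
        (by rw [(freeGpd E).face_ι, (free S).face_false_seq, hpf]) hp
        (by rwa [(free S).face_true_seq])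
    · have h₁ : (free S).face true r = (free S).face false p := by
        rw [← hpf, ← hr.tgt, (toGpd S).face_map]
      have h₂ : (free S).face false r = (free S).face false q := by
        rw [← (toGpd S).face_map, ← hr.src, hqf, (toGpd S).face_map]
      -- For `f` inverse to `r`, compare `r ⋆ₙ p` with `q`, paste the identity square of `f` on the
      -- left, and cancel `f ⋆ₙ r`.
      obtain ⟨e, A⟩ := h.exists_filling hS (f := (free S).seq r p h₁) (g := q)
        (e := (freeGpd E).ι ((free S).face false r))
        (by rw [(freeGpd E).face_ι, (free S).face_false_seq]) (by rw [(freeGpd E).face_ι, h₂])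
        (by rwa [(free S).face_true_seq]) hq
      have k₁ : (freeGpd S).face true f =
          (freeGpd S).face false ((toGpd S).map ((free S).seq r p h₁)) := by
        rw [hqf, (toGpd S).face_map, (toGpd S).face_map, (free S).face_false_seq, h₂]
      have B := Fillable.idH (Γ := Γ) f
      have hx : (free S).face false r = (freeGpd S).face true f := by
        rw [hqf, (toGpd S).face_map, h₂]
      rw [hx] at A
      have := B.compV A k₁ hqf
      have k₂ := k₁
      rw [toGpd_seq] at k₂
      rw [(freeGpd S).seq_congr rfl (toGpd_seq h₁) k₁ k₂,
        (ExtCat.IsInv.symm _ hr).cancel_left, hpf] at this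
      exact ⟨e, this⟩
  | seq f₁ f₂ k _ _ ih₁ ih₂ =>
    obtain ⟨r, hr, hr'⟩ := exists_reduced hS ((freeGpd S).face true f₁)
    rw [(freeGpd S).face_false_seq] at hpf
    have l₁ : (freeGpd S).face true f₁ = (freeGpd S).face false ((toGpd S).map r) := by
      rw [(toGpd S).face_map, hr]
    have l₂ : (freeGpd S).face true f₂ = (freeGpd S).face false ((toGpd S).map q) := by
      rw [← hqf, (freeGpd S).face_true_seq]
    obtain ⟨e₁, A₁⟩ := ih₁ hp hr' hpf l₁
    obtain ⟨e₂, A₂⟩ := ih₂ hr' hq (by rw [← k, hr]) l₂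
    have l₃ : (freeGpd S).face true f₁ = (freeGpd S).face false ((freeGpd S).seq f₂ _ l₂) := by
      rw [(freeGpd S).face_false_seq, k]
    rw [(freeGpd S).seq_assoc _ _ _ _ _ l₂ l₃]
    rw [hr] at A₂
    -- Prepending `f₁` to the second square makes its top equal to the bottom `f₁ ⋆ₙ r` of the
    -- first, so that the two can be stacked.
    have B := (Fillable.idH f₁).compV A₂ l₁ l₃
    rw [hpf] at B
    have D := A₁.compH B (by rw [(freeGpd E).face_ι, (freeGpd E).face_ι])
      (A₁.incidence.2.2.2.symm.trans B.incidence.2.1)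
    rw [(freeGpd E).ι_seq_ι] at D
    exact ⟨_, D⟩

/-- Coherent confluence modulo `E` and coherence of `E` imply acyclicity. -/
theorem ConfluentModulo.acyclic (h : Γ.ConfluentModulo) (hS : Terminating S)
    (hE : ∀ e e' : (freeGpd E).cat.Cell,
      (∀ α, (freeGpd E).face α e = (freeGpd E).face α e') → Γ.VEq e e') : Γ.Acyclic := by
  intro s
  obtain ⟨f, g, e, e', nw, ne, sw, se⟩ := s
  suffices hs : Γ.Fillable f g e e' by
    obtain ⟨A⟩ := hs
    exact ⟨Quotient.mk (sqSetoid Γ True) A.pack, rfl⟩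
  -- Reductions of the four corners: `p` and `q` at the ends of `f`, `r` and `t` at the ends of `g`.
  obtain ⟨p, hp, hp'⟩ := exists_reduced hS ((freeGpd S).face false f)
  obtain ⟨q, hq, hq'⟩ := exists_reduced hS ((freeGpd S).face true f)
  obtain ⟨r, hr, hr'⟩ := exists_reduced hS ((freeGpd S).face false g)
  obtain ⟨t, ht, ht'⟩ := exists_reduced hS ((freeGpd S).face true g)
  obtain ⟨q', hqi⟩ := freeInv_exists_inv S ((toGpd S).map q)
  obtain ⟨t', hti⟩ := freeInv_exists_inv S ((toGpd S).map t)
  have lq : (freeGpd S).face true f = (freeGpd S).face false ((toGpd S).map q) := by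
    rw [(toGpd S).face_map, hq]
  have lt : (freeGpd S).face true g = (freeGpd S).face false ((toGpd S).map t) := by
    rw [(toGpd S).face_map, ht]
  obtain ⟨a, A⟩ := h.exists_filling_gpd hS f hp' hq' hp.symm lq
  obtain ⟨b, B⟩ := h.exists_filling_gpd hS g hr' ht' hr.symm lt
  obtain ⟨c, D⟩ := h.exists_filling hS (f := p) (g := r) (e := e) (hp.trans nw) (hr.trans sw) hp' hr'
  obtain ⟨c', D'⟩ := h.exists_filling hS (f := q) (g := t) (e := e') (hq.trans ne) (ht.trans se)
    hq' ht'
  obtain ⟨a', ha⟩ := freeInv_exists_inv E a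
  have A' := A.invH ((freeGpd E).isInv_ι _) ha
  -- Stacking the inverted `A`, then `D`, then `B` gives a square from `f ⋆ₙ q` to `g ⋆ₙ t` with
  -- left side `e` and right side `a⁻ ⋆ₙ c ⋆ₙ b`.
  have A₁ := A'.compH D (by rw [(freeGpd E).face_ι, hp, nw])
    (A'.incidence.2.2.2.symm.trans D.incidence.2.1)
  rw [(freeGpd E).id_seq _ _ _ (hp.trans nw)] at A₁
  have A₂ := A₁.compH B (by rw [(freeGpd E).face_ι, hr, sw])
    (A₁.incidence.2.2.2.symm.trans B.incidence.2.1)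
  rw [(freeGpd E).seq_id _ _ _ (hr.trans sw)] at A₂
  -- The right side `c'` of the square from `q` to `t` is parallel to `a⁻ ⋆ₙ c ⋆ₙ b`. This is the
  -- only use of the coherence of `E`.
  have par := D'.congr_vertical (VEq.refl e') (hE c' _ (fun α => by
    cases α
    · exact D'.incidence.2.1.symm.trans
        (((freeGpd S).face_true_seq _ _ _).symm.trans A₂.incidence.2.1)
    · exact D'.incidence.2.2.2.symm.trans
        (((freeGpd S).face_true_seq _ _ _).symm.trans A₂.incidence.2.2.2)))
  -- Pasting the `⋄ᵛ`-inverse of that square on the right cancels `q` and `t` and puts `e'` on the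
  -- right side.
  have := A₂.compV (par.invV hqi hti) (by rw [(freeGpd S).face_true_seq, hqi.tgt])
    (by rw [(freeGpd S).face_true_seq, hti.tgt])
  rwa [hqi.cancel_right, hti.cancel_right] at this

end SqExt

end Confluence

end PolyMod

/-! ### The theorem: application to the completed square extension. -/

theorem theoremT {n : ℕ} (P : PolyMod.PolygraphModulo.{u} n)
    (Γ : PolyMod.SqExt P.Etop P.Stop)
    (hΓ : P.GammaDiconvergent (Γ.restrictH P.starToTop))
    (hE : P.ENormalizing (PolyMod.Irr P.E))
    (K : PolyMod.GenConfluences P.E) :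
    (((P.biaction (Γ.restrictH P.starToTop)).union (PolyMod.peiffer P.Etop P.Sstar)).mapH
      P.starToTop |>.union (K.squares P.Stop)).Acyclic := by
  obtain ⟨hconf, hterm, hconv, -⟩ := hΓ
  obtain ⟨G⟩ := P.base.exists_grading
  refine PolyMod.SqExt.ConfluentModulo.acyclic (E := P.E) (S := P.rules) ?_ (hterm.sub P.S) ?_
  · intro f g e hf hg hne
    obtain ⟨f', g', kf, kg, A, hA, hA', hA''⟩ := hconf f g e hf hg hne
    refine ⟨f', g', kf, kg, A.boundary.right, ?_⟩
    -- The goal is displayed through `starToTop`, so that the horizontal faces can be replaced by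
    -- those of the square cell given by confluence.
    change PolyMod.SqExt.Fillable _ (P.starToTop.map (P.Sstar.seq f f' kf))
      (P.starToTop.map (P.Sstar.seq g g' kg)) e A.boundary.right
    rw [← hA, ← hA', ← hA'']
    -- Any formal composite representing the square cell is transported to `S^⊤`; its generating
    -- squares belong to the first part of the union.
    induction A using Quotient.inductionOn with
    | h A => exact A.term.fillable_map P.starToTop (fun x => PolyMod.SqExt.Fillable.of_union_left
      (Γ := ((P.biaction (Γ.restrictH P.starToTop)).union
        (PolyMod.peiffer P.Etop P.Sstar)).mapH P.starToTop) x)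
  · intro e e' hee
    -- The squares of `conf(E)`, in the second part of the union, supply the coherence of critical
    -- branchings; the grading of the base extends it to local branchings.
    refine PolyMod.veq_of_parallel (H := P.Stop) hconv (fun b hb => hb.coherent G fun b hb =>
      K.coherent (fun A => PolyMod.SqExt.VEq.of_fillable
        (PolyMod.SqExt.Fillable.of_union_right (Δ := K.squares P.Stop) A)) b hb) hee
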